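/- Let $\lambda=(\lambda_1\ge\lambda_2\ge\lambda_3\ge 0)$ be any partition with at most three nonzero parts. Let $P=P_6^{\lambda_1+3}(X)$ be the pump (the semi-irreducible poset of class 12) given by $$X=\{(\emptyset,3,1),\ (\emptyset,2,1),\ (\lambda,4,2),\ (\emptyset,2,3),\ (\emptyset,3,4),\ (\emptyset,2,5)\}.$$ Then $P$ has the hook length property: $P$ is a $d$-complete poset, the hook lengths $h(x)$ of its elements are well defined, and, as formal power series in $q$, $$\sum_{\sigma}q^{|\sigma|}=\prod_{x\in P}\frac{1}{1-q^{h(x)}},$$ where $\sigma$ runs over all $P$-partitions, i.e. maps $\sigma:P\to\{0,1,2,\dots\}$ such that $x\le y$ implies $\sigma(x)\ge\sigma(y)$, and $|\sigma|=\sum_{x\in P}\sigma(x)$. Here the following definitions are used. **The posets $P_n^m(X)$.** Let $X$ be a finite family of triples $(\mu,N,s)$ with $N,s\ge1$, $s+N-1\le n$ and $\mu=(\mu_1,\dots,\mu_N)$ a partition with at most $N$ nonzero parts. Start with a chain $x_1<\dots<x_n$. For each triple take the shifted Young diagram of the strict partition $(\mu_1+N,\mu_2+N-1,\dots,\mu_N+1)$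 (row $i$ is moved $i-1$ units to the right), ordered by letting $u\le v$ when $u$ is weakly below and weakly to the right of $v$, and identify its diagonal cells (the leftmost cells of its rows), from top to bottom, with $x_{s+N-1},x_{s+N-2},\dots,x_s$. Finally attach a chain with $m$ elements above $x_n$. The order of $P_n^m(X)$ is the one generated by the orders of these pieces. **$d$-complete posets.** For $k\ge3$, the double-tailed diamond $d_k(1)$ has $2k-2$ elements: two incomparable elements, a chain of $k-2$ elements above both and a chain of $k-2$ elements below both. An interval isomorphic to $d_k(1)$ is a $d_k$-interval; its neck consists of the $k-2$ elements above its two incomparable elements. A convex subset isomorphic to $d_k(1)$ without its maximal element is a $d_k^-$-convex set. A poset is $d$-complete if for all $k\ge3$: (1) for each $d_k^-$-convex set $I$ there is $z$ covering the maximal element(s) of $I$ such that $I\cup\{z\}$ is a $d_k$-interval; (2) if $[w,z]$ is a $d_k$-interval, $z$ covers no element outside $[w,z]$; (3) no two distinct $d_k^-$-convex sets differ only in their minimal elements. **Hook lengths.** If $z$ is not in the neck of any $d_k$-interval, $h(z)$ is the number of elements $\le z$. Otherwise $z$ is the maximum of a $d_l$-interval $[w,z]$, and $h(z)=h(x)+h(y)-h(w)$,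 where $x,y$ are the two incomparable elements of $[w,z]$. -/

import Mathlib

open PowerSeries

/-! ### Double-tailed diamonds and `d`-complete posets -/

/-- The double-tailed diamond `d_k(1)`, for `k ≥ 3`. It has one element in each of the ranks
`0, 1, …, 2(k - 2)`, except that there are two elements (with `side = false` and `side = true`)
in the middle rank `k - 2`; every element lies below all the elements of larger rank, and the two
elements of rank `k - 2` are incomparable. Thus the ranks `k - 3, k - 2, k - 1` form a diamond, and
a chain with `k - 3` elements is attached above its top, another one below its bottom. -/
@[ext]
structure DoubleTailedDiamond (k : ℕ) where
  rank : ℕ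
  side : Bool
  rank_le : rank ≤ 2 * (k - 2)
  side_eq : rank ≠ k - 2 → side = false

instance (k : ℕ) : PartialOrder (DoubleTailedDiamond k) where
  le a b := a = b ∨ a.rank < b.rank
  le_refl a := Or.inl rfl
  le_trans a b c hab hbc := by
    rcases hab with rfl | hab
    · exact hbc
    · rcases hbc with rfl | hbc
      · exact Or.inr hab
      · exact Or.inr (hab.trans hbc)
  le_antisymm a b hab hba := by
    rcases hab with rfl | hab
    · rfl
    · rcases hba with rfl | hba
      · rfl
      · exact absurd hab hba.asymm

section DComplete

variable {P : Type*} [PartialOrder P]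

/-- The interval `[w, z]` is a `d_k`-interval: it is isomorphic to `d_k(1)`. -/
def IsDkInterval (k : ℕ) (w z : P) : Prop :=
  Nonempty (Set.Icc w z ≃o DoubleTailedDiamond k)

/-- `I` is a `d_k⁻`-convex set: it is convex, and isomorphic to `d_k(1)` without its maximal
element. -/
def IsDkMinusConvex (k : ℕ) (I : Set P) : Prop :=
  I.OrdConnected ∧ Nonempty (I ≃o {t : DoubleTailedDiamond k // ¬ IsMax t})

variable (P) in
/-- `P` is `d`-complete. -/
structure IsDComplete : Prop where
  /-- Every `d_k⁻`-convex set is completed to a `d_k`-interval by an element that covers its maximal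
  element(s). -/
  exists_top : ∀ k, 3 ≤ k → ∀ I : Set P, IsDkMinusConvex k I →
    ∃ w z : P, (∀ m, Maximal (· ∈ I) m → m ⋖ z) ∧ I ∪ {z} = Set.Icc w z ∧ IsDkInterval k w z
  /-- The top of a `d_k`-interval covers no element outside the interval. -/
  mem_of_covBy : ∀ k, 3 ≤ k → ∀ w z : P, IsDkInterval k w z → ∀ y, y ⋖ z → y ∈ Set.Icc w z
  /-- No two distinct `d_k⁻`-convex sets differ only in their minimal elements. -/
  eq_of_minimal : ∀ k, 3 ≤ k → ∀ I J : Set P, IsDkMinusConvex k I → IsDkMinusConvex k J →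
    I \ {u | Minimal (· ∈ I) u} = J \ {u | Minimal (· ∈ J) u} → I = J

/-- `z` is in the neck of some `d_k`-interval: it belongs to the interval and lies above its two
incomparable elements. -/
def InNeck (z : P) : Prop :=
  ∃ k, 3 ≤ k ∧ ∃ w t : P, IsDkInterval k w t ∧ z ∈ Set.Icc w t ∧
    ∃ x ∈ Set.Icc w t, ∃ y ∈ Set.Icc w t, ¬ x ≤ y ∧ ¬ y ≤ x ∧ x ≤ z ∧ y ≤ z

/-- `h` is the hook length function of `P`: if `z` is not in a neck, `h z` is the number of elements
of the principal order ideal of `z`; if `[w, z]` is a `d_l`-interval with incomparable elements `x`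
and `y`, then `h z = h x + h y - h w`. See `InNeck.exists_isDkInterval` and `IsHookLength.unique`:
a finite poset has at most one such function. -/
structure IsHookLength (h : P → ℕ) : Prop where
  of_not_inNeck : ∀ z, ¬ InNeck z → h z = Nat.card (Set.Iic z)
  of_isDkInterval : ∀ l, 3 ≤ l → ∀ w z : P, IsDkInterval l w z →
    ∀ x ∈ Set.Icc w z, ∀ y ∈ Set.Icc w z, ¬ x ≤ y → ¬ y ≤ x → (h z : ℤ) = h x + h y - h w

/-- Two incomparable elements of a double-tailed diamond both have the middle rank. -/
theorem DoubleTailedDiamond.rank_of_incomp {k : ℕ} {a b : DoubleTailedDiamond k}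
    (h₁ : ¬ a ≤ b) (h₂ : ¬ b ≤ a) : a.rank = k - 2 ∧ b.rank = k - 2 := by
  have e₁ : ¬ (a = b ∨ a.rank < b.rank) := h₁
  have e₂ : ¬ (b = a ∨ b.rank < a.rank) := h₂
  have hr : a.rank = b.rank := by omega
  by_cases ha : a.rank = k - 2
  · exact ⟨ha, hr ▸ ha⟩
  · exact absurd (DoubleTailedDiamond.ext hr ((a.side_eq ha).trans (b.side_eq (hr ▸ ha)).symm))
      (fun h => e₁ (Or.inl h))

/-- An element in the neck of a `d_k`-interval is the top of a `d_l`-interval with `l ≤ k`. -/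
theorem InNeck.exists_isDkInterval {z : P} (hz : InNeck z) :
    ∃ l, 3 ≤ l ∧ ∃ w : P, IsDkInterval l w z ∧
      ∃ x ∈ Set.Icc w z, ∃ y ∈ Set.Icc w z, ¬ x ≤ y ∧ ¬ y ≤ x := by
  obtain ⟨k, hk, w, t, ⟨φ⟩, hzI, x, hx, y, hy, hxy, hyx, hxz, hyz⟩ := hz
  have h₁ : ¬ φ ⟨x, hx⟩ ≤ φ ⟨y, hy⟩ := by simpa using hxy
  have h₂ : ¬ φ ⟨y, hy⟩ ≤ φ ⟨x, hx⟩ := by simpa using hyx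
  have h₃ : φ ⟨x, hx⟩ ≤ φ ⟨z, hzI⟩ := by simpa using hxz
  have h₄ : φ ⟨y, hy⟩ ≤ φ ⟨z, hzI⟩ := by simpa using hyz
  obtain ⟨rx, ry⟩ := DoubleTailedDiamond.rank_of_incomp h₁ h₂
  have hzr : k - 2 < (φ ⟨z, hzI⟩).rank := by
    rcases h₃ with h | h
    · exact absurd (h ▸ h₄) h₂
    · omega
  set a := φ ⟨z, hzI⟩ with ha
  have har := a.rank_le
  obtain ⟨j, hj⟩ : ∃ j, a.rank = k - 2 + j := ⟨a.rank - (k - 2), by omega⟩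
  let b : DoubleTailedDiamond k := ⟨k - 2 - j, false, by omega, fun _ => rfl⟩
  have hbr : b.rank = k - 2 - j := rfl
  have hba : b ≤ a := Or.inr (by omega)
  have hbx : b ≤ φ ⟨x, hx⟩ := Or.inr (by omega)
  have hby : b ≤ φ ⟨y, hy⟩ := Or.inr (by omega)
  have hwx : ((φ.symm b : Set.Icc w t) : P) ≤ x := by
    have h := φ.symm.monotone hbx
    rw [φ.symm_apply_apply] at h
    exact h
  have hwy : ((φ.symm b : Set.Icc w t) : P) ≤ y := by
    have h := φ.symm.monotone hby
    rw [φ.symm_apply_apply] at h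
    exact h
  refine ⟨j + 2, by omega, (φ.symm b : Set.Icc w t), ⟨?_⟩, x, ⟨hwx, hxz⟩, y, ⟨hwy, hyz⟩, hxy, hyx⟩
  have memI : ∀ u ∈ Set.Icc ((φ.symm b : Set.Icc w t) : P) z, u ∈ Set.Icc w t := fun u hu =>
    ⟨(φ.symm b).2.1.trans hu.1, hu.2.trans hzI.2⟩
  have hb' : ∀ u (hu : u ∈ Set.Icc ((φ.symm b : Set.Icc w t) : P) z),
      b ≤ φ ⟨u, memI u hu⟩ ∧ φ ⟨u, memI u hu⟩ ≤ a := fun u hu => by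
    constructor
    · rw [← φ.symm_apply_le]; exact hu.1
    · rw [ha]; simpa using hu.2
  have rlo : ∀ u (hu : u ∈ Set.Icc ((φ.symm b : Set.Icc w t) : P) z),
      k - 2 - j ≤ (φ ⟨u, memI u hu⟩).rank ∧ (φ ⟨u, memI u hu⟩).rank ≤ k - 2 + j := fun u hu => by
    obtain ⟨hl, hh⟩ := hb' u hu
    constructor
    · rcases hl with hl | hl
      · rw [← hl]
      · omega
    · rcases hh with hh | hh
      · rw [hh]; omega
      · omega
  let f : Set.Icc ((φ.symm b : Set.Icc w t) : P) z → DoubleTailedDiamond (j + 2) := fun u =>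
    ⟨(φ ⟨u.1, memI u.1 u.2⟩).rank - (k - 2 - j), (φ ⟨u.1, memI u.1 u.2⟩).side,
      by have := rlo u.1 u.2; omega,
      fun h => (φ ⟨u.1, memI u.1 u.2⟩).side_eq (by have := rlo u.1 u.2; omega)⟩
  have hle : ∀ u v, f u ≤ f v ↔ u ≤ v := fun u v => by
    have hu := rlo u.1 u.2
    have hv := rlo v.1 v.2
    have key : u ≤ v ↔ φ ⟨u.1, memI u.1 u.2⟩ ≤ φ ⟨v.1, memI v.1 v.2⟩ := by
      rw [φ.le_iff_le]; exact Iff.rfl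
    rw [key]
    constructor
    · rintro (h | h)
      · have h' := congrArg DoubleTailedDiamond.rank h
        have h'' := congrArg DoubleTailedDiamond.side h
        refine Or.inl (DoubleTailedDiamond.ext ?_ h'')
        simp only [f] at h'
        omega
      · refine Or.inr ?_
        simp only [f] at h
        omega
    · rintro (h | h)
      · refine Or.inl (DoubleTailedDiamond.ext ?_ ?_)
        · simp only [f]
          rw [h]
        · simp only [f]
          rw [h]
      · refine Or.inr ?_
        simp only [f]
        omega
  have hsurj : Function.Surjective f := fun c => by
    have hc := c.rank_le
    let d : DoubleTailedDiamond k :=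
      ⟨c.rank + (k - 2 - j), c.side, by omega, fun h => c.side_eq (by omega)⟩
    have hdr : d.rank = c.rank + (k - 2 - j) := rfl
    have hbd : b ≤ d := by
      rcases Nat.eq_zero_or_pos c.rank with h0 | h0
      · exact Or.inl (DoubleTailedDiamond.ext (by omega) (c.side_eq (by omega)).symm)
      · exact Or.inr (by omega)
    have hda : d ≤ a := by
      by_cases h0 : c.rank = 2 * j
      · refine Or.inl (DoubleTailedDiamond.ext (by omega) ?_)
        rw [a.side_eq (by omega)]
        exact c.side_eq (by omega)
      · exact Or.inr (by omega)
    have hdz : ((φ.symm d : Set.Icc w t) : P) ≤ z := by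
      have h := φ.symm.monotone hda
      rw [ha, φ.symm_apply_apply] at h
      exact h
    refine ⟨⟨(φ.symm d : Set.Icc w t), ⟨φ.symm.monotone hbd, hdz⟩⟩, ?_⟩
    apply DoubleTailedDiamond.ext
    · simp [f, d]
    · simp [f, d]
  exact RelIso.ofSurjective (OrderEmbedding.ofMapLEIff f hle) hsurj

/-- A finite poset has at most one hook length function. -/
theorem IsHookLength.unique [Finite P] {h h' : P → ℕ} (hh : IsHookLength h)
    (hh' : IsHookLength h') : h = h' := by
  funext z
  induction z using WellFoundedLT.induction with
  | ind z ih =>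
    by_cases hz : InNeck z
    · obtain ⟨l, hl, w, hw, x, hx, y, hy, hxy, hyx⟩ := hz.exists_isDkInterval
      have hxz : x < z := lt_of_le_of_ne hx.2 fun e => hyx (e ▸ hy.2)
      have hyz : y < z := lt_of_le_of_ne hy.2 fun e => hxy (e ▸ hx.2)
      have hwz : w < z := hx.1.trans_lt hxz
      have e₁ := hh.of_isDkInterval l hl w z hw x hx y hy hxy hyx
      have e₂ := hh'.of_isDkInterval l hl w z hw x hx y hy hxy hyx
      rw [ih x hxz, ih y hyz, ih w hwz] at e₁
      omega
    · rw [hh.of_not_inNeck z hz, hh'.of_not_inNeck z hz]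

variable (P) in
/-- The `P`-partition generating function `∑ q ^ |σ|`, as a formal power series in `q`: the
coefficient of `q ^ N` is the number of order-reversing maps `σ : P → ℕ` of size `N`. -/
noncomputable def partitionGF [Fintype P] : ℚ⟦X⟧ :=
  PowerSeries.mk fun N => (Nat.card {σ : P → ℕ // Antitone σ ∧ ∑ x, σ x = N} : ℚ)

variable (P) in
/-- The hook length formula for `P`: the hook lengths `h x` are defined, and the `P`-partition
generating function is `∏ 1 / (1 - q ^ h x)`. -/
def HookLengthFormula [Fintype P] : Prop :=
  ∃ h : P → ℕ, IsHookLength h ∧ partitionGF P = ∏ x, (1 - X ^ h x)⁻¹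

variable (P) in
/-- The hook length property: `P` is a `d`-complete poset that satisfies the hook length formula. -/
def HasHookLengthProperty [Fintype P] : Prop :=
  IsDComplete P ∧ HookLengthFormula P

end DComplete

/-! ### The posets `P_n^m(X)` -/

/-- Partitions with at most `n` nonzero parts; the parts of `μ` are `μ.rowLen 0 ≥ μ.rowLen 1 ≥ …`. -/
def Par (n : ℕ) : Type := {μ : YoungDiagram // μ.colLen 0 ≤ n}

/-- A triple `(λ, N, s)` with `N, s ≥ 1`, `s + N - 1 ≤ n` and `λ` a partition with at most `N`
parts. -/
structure Attachment (n : ℕ) where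
  shape : YoungDiagram
  size : ℕ
  start : ℕ
  one_le_size : 1 ≤ size
  one_le_start : 1 ≤ start
  le_bound : start + size - 1 ≤ n
  shape_le : shape.colLen 0 ≤ size

namespace Attachment

variable {n : ℕ} (A : Attachment n)

/-- The cells `(r, c)` (row and column, counted from `0`) of the shifted Young diagram of
`λ + δ_{N+1}`, where `δ_{N+1} = (N, N - 1, …, 1)`: row `r < N` has `λ_r + N - r` cells, beginning
with the diagonal cell `(r, r)`. -/
def shiftedCells : Finset (ℕ × ℕ) :=
  (Finset.range A.size ×ˢ Finset.range (A.size + A.shape.rowLen 0)).filter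
    fun p => p.1 ≤ p.2 ∧ p.2 < p.1 + (A.shape.rowLen p.1 + (A.size - p.1))

/-- The cells that are not on the diagonal. -/
def offDiagCells : Finset (ℕ × ℕ) := A.shiftedCells.filter fun p => p.1 ≠ p.2

/-- The diagonal cells `(0, 0), (1, 1), …, (N - 1, N - 1)` are identified with the elements
`x_{s+N-1}, x_{s+N-2}, …, x_s` of the chain `x_1 < ⋯ < x_n`. Here `x_{j+1}` is encoded as `j`, so
that the cell `(r, r)` is identified with the element encoded as `s + N - 2 - r`. -/
def diagPos (r : ℕ) : ℕ := A.start + A.size - 2 - r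

theorem lt_of_mem {p : ℕ × ℕ} (h : p ∈ A.offDiagCells) : p.1 < p.2 ∧ p.1 < A.size := by
  simp only [offDiagCells, shiftedCells, Finset.mem_filter, Finset.mem_product,
    Finset.mem_range] at h
  omega

theorem diagPos_le_diagPos {r s : ℕ} (h : r ≤ s) : A.diagPos s ≤ A.diagPos r := by
  unfold diagPos; omega

theorem diagPos_lt_diagPos {r s : ℕ} (h : r < s) (hs : s < A.size) :
    A.diagPos s < A.diagPos r := by
  have := A.one_le_start
  unfold diagPos; omega

end Attachment

/-- The poset `P_n^m(X)` for `X = {X_i}`. Its elements are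

* those of a chain `x_1 < ⋯ < x_n < x_{n+1} < ⋯ < x_{n+m}`, where `x_1, …, x_n` are the diagonal
  entries, and `x_{n+1}, …, x_{n+m}` is the chain with `m` elements attached above `x_n`;
* for each `i`, the off-diagonal cells of the shifted Young diagram of `X_i`.

The diagonal cells of the shifted Young diagram of `X_i` are identified with diagonal entries, and
the order is the one generated by the order of the chain and those of the shifted Young posets; see
`AttachedPoset.le_iff_transGen`. -/
def AttachedPoset {n k : ℕ} (m : ℕ) (X : Fin k → Attachment n) : Type :=
  Fin (n + m) ⊕ (Σ i, (X i).offDiagCells)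

namespace AttachedPoset

variable {n k m : ℕ} {X : Fin k → Attachment n}

instance : Fintype (AttachedPoset m X) :=
  inferInstanceAs (Fintype (Fin (n + m) ⊕ (Σ i, (X i).offDiagCells)))

/-- The order relation. In a shifted Young poset, `(r, c) ≤ (r', c')` if and only if `r' ≤ r` and
`c' ≤ c`. So `(r, r)` is the least diagonal cell above the cell `(r, c)`, and `(c, c)` is the
greatest diagonal cell below it (there is none when `c ≥ N`). -/
protected def Le : AttachedPoset m X → AttachedPoset m X → Prop
  | .inl a, .inl b => a ≤ b
  | .inl a, .inr ⟨j, q⟩ => q.1.2 < (X j).size ∧ (a : ℕ) ≤ (X j).diagPos q.1.2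
  | .inr ⟨i, p⟩, .inl b => (X i).diagPos p.1.1 ≤ (b : ℕ)
  | .inr ⟨i, p⟩, .inr ⟨j, q⟩ =>
      (i = j ∧ q.1.1 ≤ p.1.1 ∧ q.1.2 ≤ p.1.2) ∨
        (q.1.2 < (X j).size ∧ (X i).diagPos p.1.1 ≤ (X j).diagPos q.1.2)

instance : PartialOrder (AttachedPoset m X) where
  le := AttachedPoset.Le
  le_refl x := by
    rcases x with a | ⟨i, p⟩
    · exact le_refl a
    · exact Or.inl ⟨rfl, le_rfl, le_rfl⟩
  le_trans x y z hxy hyz := by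
    rcases x with a | ⟨i, p, hp⟩ <;> rcases y with b | ⟨j, q, hq⟩ <;>
      rcases z with c | ⟨l, r, hr⟩ <;> simp only [AttachedPoset.Le] at hxy hyz ⊢
    · exact hxy.trans hyz
    · exact ⟨hyz.1, le_trans (by exact_mod_cast hxy) hyz.2⟩
    · have h₁ := (X j).diagPos_le_diagPos ((X j).lt_of_mem hq).1.le
      exact Fin.le_def.mpr (hxy.2.trans (h₁.trans hyz))
    · rcases hyz with ⟨rfl, h₁, h₂⟩ | ⟨h₁, h₂⟩
      · exact ⟨by omega, hxy.2.trans ((X j).diagPos_le_diagPos h₂)⟩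
      · exact ⟨h₁, hxy.2.trans
          (((X j).diagPos_le_diagPos ((X j).lt_of_mem hq).1.le).trans h₂)⟩
    · exact hxy.trans (by exact_mod_cast hyz)
    · exact Or.inr ⟨hyz.1, hxy.trans hyz.2⟩
    · rcases hxy with ⟨rfl, h₁, h₂⟩ | ⟨h₁, h₂⟩
      · exact ((X i).diagPos_le_diagPos h₁).trans hyz
      · exact h₂.trans (((X j).diagPos_le_diagPos ((X j).lt_of_mem hq).1.le).trans hyz)
    · rcases hxy with ⟨rfl, h₁, h₂⟩ | ⟨h₁, h₂⟩
      · rcases hyz with ⟨rfl, h₃, h₄⟩ | ⟨h₃, h₄⟩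
        · exact Or.inl ⟨rfl, h₃.trans h₁, h₄.trans h₂⟩
        · exact Or.inr ⟨h₃, ((X i).diagPos_le_diagPos h₁).trans h₄⟩
      · rcases hyz with ⟨rfl, h₃, h₄⟩ | ⟨h₃, h₄⟩
        · exact Or.inr ⟨by omega, h₂.trans ((X j).diagPos_le_diagPos h₄)⟩
        · exact Or.inr ⟨h₃, h₂.trans
            (((X j).diagPos_le_diagPos ((X j).lt_of_mem hq).1.le).trans h₄)⟩
  le_antisymm x y hxy hyx := by
    rcases x with a | ⟨i, p, hp⟩ <;> rcases y with b | ⟨j, q, hq⟩ <;>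
      simp only [AttachedPoset.Le] at hxy hyx
    · exact congrArg _ (le_antisymm hxy hyx)
    · have := (X j).diagPos_lt_diagPos ((X j).lt_of_mem hq).1 hxy.1
      omega
    · have := (X i).diagPos_lt_diagPos ((X i).lt_of_mem hp).1 hyx.1
      omega
    · have hp' := (X i).lt_of_mem hp
      have hq' := (X j).lt_of_mem hq
      rcases hxy with ⟨rfl, h₁, h₂⟩ | ⟨h₁, h₂⟩
      · rcases hyx with ⟨-, h₃, h₄⟩ | ⟨h₃, h₄⟩
        · obtain rfl : p = q := Prod.ext (by omega) (by omega)
          rfl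
        · have := (X i).diagPos_lt_diagPos hp'.1 h₃
          have := (X i).diagPos_le_diagPos h₁
          omega
      · have := (X j).diagPos_lt_diagPos hq'.1 h₁
        rcases hyx with ⟨rfl, h₃, h₄⟩ | ⟨h₃, h₄⟩
        · have := (X j).diagPos_le_diagPos h₃
          omega
        · have := (X i).diagPos_lt_diagPos hp'.1 h₃
          omega

/-- `IsCell i p x` says that `x` is the element of `P_n^m(X)` given by the cell `p` of the shifted
Young diagram of `X_i`. -/
def IsCell (i : Fin k) (p : ℕ × ℕ) : AttachedPoset m X → Prop
  | .inl a => p.1 = p.2 ∧ p ∈ (X i).shiftedCells ∧ (a : ℕ) = (X i).diagPos p.1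
  | .inr ⟨j, q⟩ => i = j ∧ p = q.1

/-- The order of `P_n^m(X)` is generated by the order of the chain and the orders of the shifted
Young posets. -/
theorem le_iff_transGen (x y : AttachedPoset m X) :
    x ≤ y ↔ Relation.TransGen (fun u v : AttachedPoset m X =>
      (∃ a b : Fin (n + m), a ≤ b ∧ u = .inl a ∧ v = .inl b) ∨
      (∃ i p q, IsCell i p u ∧ IsCell i q v ∧ q.1 ≤ p.1 ∧ q.2 ≤ p.2)) x y := by
  have hd : ∀ i r, r < (X i).size → (r, r) ∈ (X i).shiftedCells ∧
      (X i).diagPos r < n + m := fun i r hr => by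
    have := (X i).le_bound
    have := (X i).one_le_start
    constructor
    · simp only [Attachment.shiftedCells, Finset.mem_filter, Finset.mem_product, Finset.mem_range]
      omega
    · unfold Attachment.diagPos; omega
  constructor
  · intro h
    rcases x with a | ⟨i, p, hp⟩ <;> rcases y with b | ⟨j, q, hq⟩
    · exact .single (Or.inl ⟨a, b, h, rfl, rfl⟩)
    · have h' : q.2 < (X j).size ∧ (a : ℕ) ≤ (X j).diagPos q.2 := h
      obtain ⟨h₁, h₂⟩ := hd j _ h'.1
      exact .trans (.single (Or.inl ⟨a, ⟨_, h₂⟩, h'.2, rfl, rfl⟩))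
        (.single (Or.inr ⟨j, (q.2, q.2), q, ⟨rfl, h₁, rfl⟩, ⟨rfl, rfl⟩,
          ((X j).lt_of_mem hq).1.le, le_rfl⟩))
    · have h' : (X i).diagPos p.1 ≤ (b : ℕ) := h
      obtain ⟨h₁, h₂⟩ := hd i _ ((X i).lt_of_mem hp).2
      have hc : IsCell (m := m) (X := X) i (p.1, p.1) (.inl ⟨_, h₂⟩) := ⟨rfl, h₁, rfl⟩
      exact .trans (.single (Or.inr ⟨i, p, (p.1, p.1), ⟨rfl, rfl⟩, hc, le_rfl,
        ((X i).lt_of_mem hp).1.le⟩)) (.single (Or.inl ⟨⟨_, h₂⟩, b, h', rfl, rfl⟩))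
    · have h' : (i = j ∧ q.1 ≤ p.1 ∧ q.2 ≤ p.2) ∨
        (q.2 < (X j).size ∧ (X i).diagPos p.1 ≤ (X j).diagPos q.2) := h
      rcases h' with ⟨rfl, h₁, h₂⟩ | ⟨h₁, h₂⟩
      · exact .single (Or.inr ⟨i, p, q, ⟨rfl, rfl⟩, ⟨rfl, rfl⟩, h₁, h₂⟩)
      · obtain ⟨h₃, h₄⟩ := hd i _ ((X i).lt_of_mem hp).2
        obtain ⟨h₅, h₆⟩ := hd j _ h₁
        have hc : IsCell (m := m) (X := X) i (p.1, p.1) (.inl ⟨_, h₄⟩) := ⟨rfl, h₃, rfl⟩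
        exact .trans (.single (Or.inr ⟨i, p, (p.1, p.1), ⟨rfl, rfl⟩, hc, le_rfl,
          ((X i).lt_of_mem hp).1.le⟩)) (.trans
          (.single (Or.inl ⟨⟨_, h₄⟩, ⟨_, h₆⟩, h₂, rfl, rfl⟩))
          (.single (Or.inr ⟨j, (q.2, q.2), q, ⟨rfl, h₅, rfl⟩, ⟨rfl, rfl⟩,
            ((X j).lt_of_mem hq).1.le, le_rfl⟩)))
  · intro h
    refine Relation.TransGen.trans_induction_on (motive := fun {u v} _ => u ≤ v) h ?_
      fun _ _ h₁ h₂ => h₁.trans h₂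
    rintro u v (⟨a, b, hab, rfl, rfl⟩ | ⟨i, p, q, hp, hq, h₁, h₂⟩)
    · exact hab
    · rcases u with a | ⟨i', p', hp'⟩ <;> rcases v with b | ⟨j', q', hq'⟩
      · obtain ⟨-, -, e⟩ := hp
        obtain ⟨-, -, e'⟩ := hq
        refine Fin.le_def.mpr ?_
        rw [e, e']
        exact (X i).diagPos_le_diagPos h₁
      · obtain ⟨e₀, hm, e⟩ := hp
        obtain ⟨rfl, rfl⟩ := hq
        refine ⟨?_, ?_⟩
        · simp only [Attachment.shiftedCells, Finset.mem_filter, Finset.mem_product,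
            Finset.mem_range] at hm
          change q.2 < (X i).size
          omega
        · rw [e, e₀]
          exact (X i).diagPos_le_diagPos h₂
      · obtain ⟨rfl, rfl⟩ := hp
        obtain ⟨-, -, e⟩ := hq
        change (X i).diagPos p.1 ≤ (b : ℕ)
        rw [e]
        exact (X i).diagPos_le_diagPos h₁
      · obtain ⟨rfl, rfl⟩ := hp
        obtain ⟨rfl, rfl⟩ := hq
        exact Or.inl ⟨rfl, h₁, h₂⟩

end AttachedPoset

/-! ### Pumps -/

/-- The data
`X = {(∅, 3, 1), (∅, 2, 1), (λ, 4, 2), (∅, 2, 3), (∅, 3, 4), (∅, 2, 5)}`, on `6` diagonal entries,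
for a partition `λ` with at most three parts. -/
def pumpData (lam : Par 3) : Fin 6 → Attachment 6 :=
  let e (N s : ℕ) (hN : 1 ≤ N) (hs : 1 ≤ s) (h : s + N - 1 ≤ 6) : Attachment 6 :=
    ⟨⊥, N, s, hN, hs, h, by
      rw [YoungDiagram.colLen_eq_card]
      exact (Finset.card_eq_zero.mpr (by simp [YoungDiagram.col])).le.trans (Nat.zero_le _)⟩
  ![e 3 1 (by decide) (by decide) (by decide),
    e 2 1 (by decide) (by decide) (by decide),
    ⟨lam.1, 4, 2, by decide, by decide, by decide, lam.2.trans (by decide)⟩,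
    e 2 3 (by decide) (by decide) (by decide),
    e 3 4 (by decide) (by decide) (by decide),
    e 2 5 (by decide) (by decide) (by decide)]

/-- The pump `P_6^{λ_1 + 3}(X)` of a partition `λ` with at most three parts; `λ_1` is the largest
part of `λ`. -/
abbrev Pump (lam : Par 3) : Type := AttachedPoset (lam.1.rowLen 0 + 3) (pumpData lam)

/-! Two things are proved independently: the pump is d-complete with explicitly known hook lengths,
and its generating function is the product over these hook lengths.

Order. Colour the pump by the vertices of a tree with three arms: the six diagonal entries receive
the centre, an off-diagonal cell of content d receives depth d on the arm of its attachment, and the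
chain above x_6 runs out along the arm that belongs to λ. With suitable heights, x ≤ y means that
the distance of the colours is at most the difference of the heights, with one small exception
(`pump_le_iff`). In these coordinates the pump is seen to satisfy the local conditions of a dominant
minuscule heap (`pump_spiderHeap`). In every such heap the tails of a double-tailed diamond run
straight along one arm, so that d_k-intervals are exactly the intervals between consecutive elements
of one colour. This yields d-completeness (`SpiderHeap.isDComplete`). It also reduces hook lengths
to a local relation, h z + h w = h u + h v when u and v are the two neighbours between consecutive
elements w < z of one colour, together with a count below the lowest element of each colour
(`SpiderHeap.isHookLength`). The function `pumpHook` satisfies both.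

Generating function. Write l = λ + (3, 2, 1). The chain above x_6 splits off as geometric factors
(`AttachedPoset.partitionGF_chain`). Once the values on x_1, …, x_6 are fixed, the attachments are
independent. The sum over the cells of one attachment is, up to explicit factors, the determinant of
the powers q ^ ((a_r + r) l_s), where a_r are the diagonal values (`X_pow_mul_fillingGF`). For the
attachments of size 2 and 3 this is a Vandermonde product; for that of λ it is an alternating sum of
24 monomials. For each monomial the sum over the chain is six nested geometric series
(`hasSum_chainTerm`). The generating function has thereby become an alternating sum of explicit
rational functions of q and the powers q ^ (l_r + 3). That this sum factors rests on two polynomial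
identities, `qAlt_pair` and `qAlt_chain`; each is verified by evaluation at a single point with huge
integral coordinates (Kronecker substitution).

Comparison. As in the classical hook formula, the hook lengths in a row of λ and the differences l_r
- l_s, together with l_r, fill up the numbers 1, …, l_r. The same mechanism works for the upper
chain. So the product over the hook lengths collapses to the factored generating function
(`prod_pumpHook`, `partitionGF_pump`). -/

/-! ### Posets coloured by a spider with three arms -/

/-- Adjacency of the vertices `(arm, depth)` of a spider, whose centre has depth `0`. -/
def SpiderAdj (c d : ℕ × ℕ) : Prop :=
  (c.1 = d.1 ∧ (c.2 + 1 = d.2 ∨ d.2 + 1 = c.2)) ∨ (c.2 = 0 ∧ d.2 = 1) ∨ (c.2 = 1 ∧ d.2 = 0)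

theorem SpiderAdj.symm {c d : ℕ × ℕ} (h : SpiderAdj c d) : SpiderAdj d c := by
  unfold SpiderAdj at *; omega

theorem SpiderAdj.ne {c d : ℕ × ℕ} (h : SpiderAdj c d) : c ≠ d := by
  rintro rfl; unfold SpiderAdj at h; omega

section Spider

variable {P : Type*} [PartialOrder P]

/-- `w < z` are consecutive elements of the same colour. -/
def Consec (κ : P → ℕ × ℕ) (w z : P) : Prop :=
  w < z ∧ κ w = κ z ∧ ∀ t, w < t → t < z → κ t ≠ κ w

/-- `P` is a heap over a spider with three arms, satisfying the local conditions of a dominant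
minuscule heap. -/
structure SpiderHeap (κ : P → ℕ × ℕ) : Prop where
  arm_lt : ∀ x, (κ x).1 < 3
  arm_center : ∀ x, (κ x).2 = 0 → (κ x).1 = 0
  exists_adj : ∀ x y, x < y → ∃ x', x < x' ∧ x' ≤ y ∧ SpiderAdj (κ x) (κ x')
  comparable : ∀ x y, κ x = κ y ∨ SpiderAdj (κ x) (κ y) → x ≤ y ∨ y ≤ x
  neighbors : ∀ w z, Consec κ w z → ∃ u v, u ≠ v ∧ w < u ∧ u < z ∧ w < v ∧ v < z ∧
    SpiderAdj (κ w) (κ u) ∧ SpiderAdj (κ w) (κ v) ∧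
    (∀ t, w < t → t < z → SpiderAdj (κ w) (κ t) → t = u ∨ t = v) ∧
    (κ u = κ v ∨ (¬ u ≤ v ∧ ¬ v ≤ u))
  exists_above : ∀ w u v, w < u → w < v → u ≠ v → SpiderAdj (κ w) (κ u) → SpiderAdj (κ w) (κ v) →
    ∃ z, w < z ∧ κ z = κ w

/-- The ranks and sides that occur in the first `R` ranks of a double-tailed diamond with middle
rank `n`. -/
def ValidRank (n R r : ℕ) (s : Bool) : Prop := r < R ∧ (r ≠ n → s = false)

/-- `e` embeds the first `R` ranks of a double-tailed diamond with middle rank `n` as a convex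
subset. -/
structure DiamondEmb (n R : ℕ) (e : ℕ → Bool → P) : Prop where
  le_iff : ∀ r s r' s', ValidRank n R r s → ValidRank n R r' s' →
    (e r s ≤ e r' s' ↔ (r = r' ∧ s = s') ∨ r < r')
  conv : ∀ r s r' s' t, ValidRank n R r s → ValidRank n R r' s' → e r s ≤ t → t ≤ e r' s' →
    ∃ r'' s'', ValidRank n R r'' s'' ∧ t = e r'' s''

theorem DoubleTailedDiamond.le_def {k : ℕ} (a b : DoubleTailedDiamond k) :
    a ≤ b ↔ a = b ∨ a.rank < b.rank := Iff.rfl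

/-- The element of given rank and side of `d_k(1)`, when there is one. -/
def DoubleTailedDiamond.mk' (k r : ℕ) (s : Bool) : DoubleTailedDiamond k :=
  if h : r ≤ 2 * (k - 2) ∧ (r ≠ k - 2 → s = false) then ⟨r, s, h.1, h.2⟩
  else ⟨0, false, Nat.zero_le _, fun _ => rfl⟩

theorem DoubleTailedDiamond.mk'_eq {k r : ℕ} {s : Bool} (h : ValidRank (k - 2) (2 * (k - 2) + 1) r s) :
    (mk' k r s).rank = r ∧ (mk' k r s).side = s := by
  have : r ≤ 2 * (k - 2) ∧ (r ≠ k - 2 → s = false) := ⟨by have := h.1; omega, h.2⟩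
  rw [mk', dif_pos this]
  exact ⟨rfl, rfl⟩

theorem DoubleTailedDiamond.mk'_le {k r r' : ℕ} {s s' : Bool}
    (h : ValidRank (k - 2) (2 * (k - 2) + 1) r s) (h' : ValidRank (k - 2) (2 * (k - 2) + 1) r' s') :
    mk' k r s ≤ mk' k r' s' ↔ (r = r' ∧ s = s') ∨ r < r' := by
  rw [le_def, DoubleTailedDiamond.ext_iff, (mk'_eq h).1, (mk'_eq h).2, (mk'_eq h').1, (mk'_eq h').2]

theorem DoubleTailedDiamond.validRank {k : ℕ} (a : DoubleTailedDiamond k) :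
    ValidRank (k - 2) (2 * (k - 2) + 1) a.rank a.side :=
  ⟨by have := a.rank_le; omega, a.side_eq⟩

theorem DoubleTailedDiamond.mk'_rank_side {k : ℕ} (a : DoubleTailedDiamond k) :
    mk' k a.rank a.side = a :=
  DoubleTailedDiamond.ext (mk'_eq a.validRank).1 (mk'_eq a.validRank).2

theorem DoubleTailedDiamond.not_isMax_iff {k : ℕ} (a : DoubleTailedDiamond k) :
    ¬ IsMax a ↔ a.rank < 2 * (k - 2) := by
  have hv : ValidRank (k - 2) (2 * (k - 2) + 1) (2 * (k - 2)) false := ⟨by omega, fun _ => rfl⟩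
  have ha := a.rank_le
  constructor
  · intro h
    by_contra hlt
    refine h fun b hb => ?_
    have hb' := b.rank_le
    rcases hb with rfl | hb
    · exact le_rfl
    · omega
  · intro h hmax
    have := hmax (b := mk' k (2 * (k - 2)) false) (Or.inr (by rw [(mk'_eq hv).1]; exact h))
    rcases this with h' | h'
    · rw [← h', (mk'_eq hv).1] at h; omega
    · rw [(mk'_eq hv).1] at h'; omega

/-- Replaces the isomorphism by coordinates (rank, side). Smaller and larger diamonds then arise by
shifting or extending a function of the rank. -/
theorem IsDkInterval.exists_diamondEmb {k : ℕ} (hk : 3 ≤ k) {w z : P} (h : IsDkInterval k w z) :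
    ∃ e : ℕ → Bool → P, DiamondEmb (k - 2) (2 * (k - 2) + 1) e ∧ e 0 false = w ∧
      e (2 * (k - 2)) false = z ∧
      ∀ t, t ∈ Set.Icc w z ↔ ∃ r s, ValidRank (k - 2) (2 * (k - 2) + 1) r s ∧ t = e r s := by
  obtain ⟨φ⟩ := h
  let e : ℕ → Bool → P := fun r s => φ.symm (DoubleTailedDiamond.mk' k r s)
  have hle : ∀ r s r' s', ValidRank (k - 2) (2 * (k - 2) + 1) r s →
      ValidRank (k - 2) (2 * (k - 2) + 1) r' s' →
      (e r s ≤ e r' s' ↔ (r = r' ∧ s = s') ∨ r < r') := fun r s r' s' hr hr' => by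
    rw [← DoubleTailedDiamond.mk'_le hr hr', ← φ.symm.le_iff_le]
    exact Iff.rfl
  have hmem : ∀ t, t ∈ Set.Icc w z ↔
      ∃ r s, ValidRank (k - 2) (2 * (k - 2) + 1) r s ∧ t = e r s := fun t => by
    constructor
    · intro ht
      refine ⟨(φ ⟨t, ht⟩).rank, (φ ⟨t, ht⟩).side, (φ ⟨t, ht⟩).validRank, ?_⟩
      simp [e, DoubleTailedDiamond.mk'_rank_side]
    · rintro ⟨r, s, -, rfl⟩
      exact (φ.symm _).2
  have v0 : ValidRank (k - 2) (2 * (k - 2) + 1) 0 false := ⟨by omega, fun _ => rfl⟩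
  have v1 : ValidRank (k - 2) (2 * (k - 2) + 1) (2 * (k - 2)) false := ⟨by omega, fun _ => rfl⟩
  have hwz : w ≤ z := (((hmem (e 0 false)).2 ⟨_, _, v0, rfl⟩).1).trans
    (((hmem (e 0 false)).2 ⟨_, _, v0, rfl⟩).2)
  refine ⟨e, ⟨hle, fun r s r' s' t hr hr' h₁ h₂ => ?_⟩, ?_, ?_, hmem⟩
  · exact (hmem t).1 ⟨((hmem _).2 ⟨r, s, hr, rfl⟩).1.trans h₁,
      h₂.trans ((hmem _).2 ⟨r', s', hr', rfl⟩).2⟩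
  · apply le_antisymm
    · obtain ⟨r, s, hr, h⟩ := (hmem w).1 ⟨le_rfl, hwz⟩
      rw [h, hle _ _ _ _ v0 hr]
      rcases Nat.eq_zero_or_pos r with rfl | h0
      · exact Or.inl ⟨rfl, (hr.2 (by omega)).symm⟩
      · exact Or.inr h0
    · exact ((hmem _).2 ⟨_, _, v0, rfl⟩).1
  · apply le_antisymm
    · exact ((hmem _).2 ⟨_, _, v1, rfl⟩).2
    · obtain ⟨r, s, hr, h⟩ := (hmem z).1 ⟨hwz, le_rfl⟩
      rw [h, hle _ _ _ _ hr v1]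
      have := hr.1
      rcases eq_or_ne r (2 * (k - 2)) with rfl | h0
      · exact Or.inl ⟨rfl, hr.2 (by omega)⟩
      · exact Or.inr (by omega)

theorem IsDkMinusConvex.exists_diamondEmb {k : ℕ} (hk : 3 ≤ k) {I : Set P}
    (h : IsDkMinusConvex k I) :
    ∃ e : ℕ → Bool → P, DiamondEmb (k - 2) (2 * (k - 2)) e ∧
      ∀ t, t ∈ I ↔ ∃ r s, ValidRank (k - 2) (2 * (k - 2)) r s ∧ t = e r s := by
  classical
  obtain ⟨hc, ⟨φ⟩⟩ := h
  have hV : ∀ {r s}, ValidRank (k - 2) (2 * (k - 2)) r s →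
      ValidRank (k - 2) (2 * (k - 2) + 1) r s := fun h => ⟨by have := h.1; omega, h.2⟩
  have hm : ∀ {r s}, ValidRank (k - 2) (2 * (k - 2)) r s →
      ¬ IsMax (DoubleTailedDiamond.mk' k r s) := fun {r s} hr => by
    rw [DoubleTailedDiamond.not_isMax_iff, (DoubleTailedDiamond.mk'_eq (hV hr)).1]
    exact hr.1
  have v0 : ValidRank (k - 2) (2 * (k - 2)) 0 false := ⟨by omega, fun _ => rfl⟩
  -- The second branch is a dummy value for the missing top rank.
  let e : ℕ → Bool → P := fun r s =>
    if h : ¬ IsMax (DoubleTailedDiamond.mk' k r s) then φ.symm ⟨_, h⟩ else φ.symm ⟨_, hm v0⟩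
  have he : ∀ {r s} (hr : ValidRank (k - 2) (2 * (k - 2)) r s), e r s = φ.symm ⟨_, hm hr⟩ :=
    fun hr => dif_pos (hm hr)
  have hmem : ∀ t, t ∈ I ↔ ∃ r s, ValidRank (k - 2) (2 * (k - 2)) r s ∧ t = e r s := fun t => by
    constructor
    · intro ht
      have hr : ValidRank (k - 2) (2 * (k - 2)) (φ ⟨t, ht⟩).1.rank (φ ⟨t, ht⟩).1.side :=
        ⟨(DoubleTailedDiamond.not_isMax_iff _).1 (φ ⟨t, ht⟩).2, (φ ⟨t, ht⟩).1.side_eq⟩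
      refine ⟨_, _, hr, ?_⟩
      rw [he hr]
      have : (⟨_, hm hr⟩ : {t : DoubleTailedDiamond k // ¬ IsMax t}) = φ ⟨t, ht⟩ :=
        Subtype.ext (DoubleTailedDiamond.mk'_rank_side _)
      rw [this, φ.symm_apply_apply]
    · rintro ⟨r, s, hr, rfl⟩
      rw [he hr]
      exact (φ.symm _).2
  refine ⟨e, ⟨fun r s r' s' hr hr' => ?_, fun r s r' s' t hr hr' h₁ h₂ => ?_⟩, hmem⟩
  · rw [← DoubleTailedDiamond.mk'_le (hV hr) (hV hr'), he hr, he hr']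
    exact φ.symm.le_iff_le
  · exact (hmem t).1 (hc.out ((hmem _).2 ⟨r, s, hr, rfl⟩) ((hmem _).2 ⟨r', s', hr', rfl⟩) ⟨h₁, h₂⟩)

theorem DiamondEmb.isDkInterval {k : ℕ} (hk : 3 ≤ k) {e : ℕ → Bool → P}
    (h : DiamondEmb (k - 2) (2 * (k - 2) + 1) e) :
    IsDkInterval k (e 0 false) (e (2 * (k - 2)) false) := by
  have v0 : ValidRank (k - 2) (2 * (k - 2) + 1) 0 false := ⟨by omega, fun _ => rfl⟩
  have v1 : ValidRank (k - 2) (2 * (k - 2) + 1) (2 * (k - 2)) false := ⟨by omega, fun _ => rfl⟩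
  let f : DoubleTailedDiamond k → Set.Icc (e 0 false) (e (2 * (k - 2)) false) := fun a =>
    ⟨e a.rank a.side, by
      have ha := a.rank_le
      constructor
      · rw [h.le_iff _ _ _ _ v0 a.validRank]
        rcases Nat.eq_zero_or_pos a.rank with h0 | h0
        · exact Or.inl ⟨h0.symm, (a.side_eq (by omega)).symm⟩
        · exact Or.inr h0
      · rw [h.le_iff _ _ _ _ a.validRank v1]
        rcases eq_or_ne a.rank (2 * (k - 2)) with h0 | h0
        · exact Or.inl ⟨h0, a.side_eq (by omega)⟩
        · exact Or.inr (by omega)⟩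
  have hf : ∀ a b, f a ≤ f b ↔ a ≤ b := fun a b => by
    rw [DoubleTailedDiamond.le_def, DoubleTailedDiamond.ext_iff,
      ← h.le_iff _ _ _ _ a.validRank b.validRank]
    exact Iff.rfl
  refine ⟨(RelIso.ofSurjective (OrderEmbedding.ofMapLEIff f hf) fun t => ?_).symm⟩
  obtain ⟨r, s, hr, ht⟩ := h.conv _ _ _ _ _ v0 v1 t.2.1 t.2.2
  refine ⟨DoubleTailedDiamond.mk' k r s, Subtype.ext ?_⟩
  rw [ht]
  change e _ _ = _
  rw [(DoubleTailedDiamond.mk'_eq hr).1, (DoubleTailedDiamond.mk'_eq hr).2]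

/-! ### Colours of double-tailed diamonds in a spider heap -/

theorem SpiderHeap.adj_of_covBy {κ : P → ℕ × ℕ} (H : SpiderHeap κ) {x y : P} (h : x ⋖ y) :
    SpiderAdj (κ x) (κ y) := by
  obtain ⟨x', h₁, h₂, h₃⟩ := H.exists_adj x y h.lt
  rcases h₂.eq_or_lt with rfl | h₂
  · exact h₃
  · exact absurd h₂ (h.2 h₁)

namespace DiamondEmb

variable {n R : ℕ} {e : ℕ → Bool → P}

theorem lt_of_lt (D : DiamondEmb n R e) {r s r' s'} (h : ValidRank n R r s)
    (h' : ValidRank n R r' s') (hr : r < r') : e r s < e r' s' := by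
  refine lt_of_le_not_ge ((D.le_iff _ _ _ _ h h').2 (Or.inr hr)) fun hle => ?_
  rcases (D.le_iff _ _ _ _ h' h).1 hle with h | h <;> omega

theorem exists_between (D : DiamondEmb n R e) {r s r' s'} (h : ValidRank n R r s)
    (h' : ValidRank n R r' s') {t : P} (h₁ : e r s < t) (h₂ : t < e r' s') :
    ∃ r'' s'', ValidRank n R r'' s'' ∧ t = e r'' s'' ∧ r < r'' ∧ r'' < r' := by
  obtain ⟨r'', s'', hv, rfl⟩ := D.conv _ _ _ _ t h h' h₁.le h₂.le
  refine ⟨r'', s'', hv, rfl, ?_, ?_⟩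
  · rcases (D.le_iff _ _ _ _ h hv).1 h₁.le with ⟨rfl, rfl⟩ | h
    · exact absurd h₁ (lt_irrefl _)
    · exact h
  · rcases (D.le_iff _ _ _ _ hv h').1 h₂.le with ⟨rfl, rfl⟩ | h
    · exact absurd h₂ (lt_irrefl _)
    · exact h

theorem covBy (D : DiamondEmb n R e) {r s s'} (h : ValidRank n R r s)
    (h' : ValidRank n R (r + 1) s') : e r s ⋖ e (r + 1) s' := by
  refine ⟨D.lt_of_lt h h' (Nat.lt_succ_self r), fun t h₁ h₂ => ?_⟩
  obtain ⟨r'', s'', -, -, h₃, h₄⟩ := D.exists_between h h' h₁ h₂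
  omega

variable {κ : P → ℕ × ℕ}

theorem color_ne (D : DiamondEmb n R e) (H : SpiderHeap κ) (hn : n < R) :
    κ (e n false) ≠ κ (e n true) := fun h => by
  have v0 : ValidRank n R n false := ⟨hn, fun _ => rfl⟩
  have v1 : ValidRank n R n true := ⟨hn, fun h => absurd rfl h⟩
  rcases H.comparable _ _ (Or.inl h) with h | h
  · simpa using (D.le_iff _ _ _ _ v0 v1).1 h
  · simpa using (D.le_iff _ _ _ _ v1 v0).1 h

/-- Away from the middle there is only one element between the ranks r and r + 2, whereas
`neighbors` demands two between consecutive elements of one colour. So the colours along a tail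
never turn back. -/
theorem color_ne_add_two (D : DiamondEmb n R e) (H : SpiderHeap κ) {r s s'}
    (h : ValidRank n R r s) (h' : ValidRank n R (r + 2) s') (hr : r + 1 ≠ n) :
    κ (e r s) ≠ κ (e (r + 2) s') := fun hc => by
  have hbet : ∀ t, e r s < t → t < e (r + 2) s' → t = e (r + 1) false := fun t h₁ h₂ => by
    obtain ⟨r'', s'', hv, rfl, h₃, h₄⟩ := D.exists_between h h' h₁ h₂
    obtain rfl : r'' = r + 1 := by omega
    rw [hv.2 hr]
  have hv : ValidRank n R (r + 1) false := ⟨by have := h'.1; omega, fun _ => rfl⟩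
  obtain ⟨u, v, huv, h₁, h₂, h₃, h₄, -⟩ := H.neighbors _ _ ⟨D.lt_of_lt h h' (by omega), hc,
    fun t h₁ h₂ => by
      rw [hbet t h₁ h₂]
      exact (H.adj_of_covBy (D.covBy h hv)).symm.ne⟩
  exact huv ((hbet u h₁ h₂).trans (hbet v h₃ h₄).symm)

/-- The colours of a double-tailed diamond: the necks go along one arm of the spider, beginning at
the centre. -/
theorem exists_colors (D : DiamondEmb n R e) (H : SpiderHeap κ) (hn : 2 ≤ n) (hR : 2 * n ≤ R) :
    ∃ α, κ (e (n - 1) false) = (0, 0) ∧ κ (e (n + 1) false) = (0, 0) ∧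
      (∀ s, (κ (e n s)).1 ≠ α ∧ (κ (e n s)).2 = 1) ∧
      (∀ i, i + 2 ≤ n → κ (e (n - 2 - i) false) = (α, i + 1)) ∧
      (∀ i, n + 2 + i < R → i + 2 ≤ n → κ (e (n + 2 + i) false) = (α, i + 1)) := by
  have V : ∀ r, r < R → ValidRank n R r false := fun r h => ⟨h, fun _ => rfl⟩
  have Vn : ∀ s, ValidRank n R n s := fun s => ⟨by omega, fun h => absurd rfl h⟩
  have hxy := D.color_ne H (by omega)
  obtain ⟨k, rfl⟩ : ∃ k, n = k + 2 := ⟨n - 2, by omega⟩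
  have ax : ∀ s, SpiderAdj (κ (e (k + 1) false)) (κ (e (k + 2) s)) := fun s =>
    H.adj_of_covBy (D.covBy (V _ (by omega)) (Vn s))
  have az : ∀ s, SpiderAdj (κ (e (k + 2) s)) (κ (e (k + 3) false)) := fun s =>
    H.adj_of_covBy (D.covBy (Vn s) (V _ (by omega)))
  have aw : SpiderAdj (κ (e k false)) (κ (e (k + 1) false)) :=
    H.adj_of_covBy (D.covBy (V _ (by omega)) (V _ (by omega)))
  have nw : ∀ s, κ (e k false) ≠ κ (e (k + 2) s) := fun s =>
    D.color_ne_add_two H (V _ (by omega)) (Vn s) (by omega)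
  have arm := fun x => H.arm_lt x
  have cen := fun x => H.arm_center x
  -- This colour has three distinct neighbours: the colours of the two incomparable elements and
  -- that of the rank below. Only the centre has three neighbours.
  have c1 : κ (e (k + 1) false) = (0, 0) := by
    have h1 := ax false
    have h2 := ax true
    have h3 := nw false
    have h4 := nw true
    have h5 := cen (e (k + 1) false)
    have h6 := cen (e (k + 2) false)
    have h7 := cen (e (k + 2) true)
    have h8 := cen (e k false)
    simp only [SpiderAdj, Prod.ext_iff, ne_eq] at *
    omega
  -- Only the centre is adjacent to two distinct vertices of depth one.
  have c2 : κ (e (k + 3) false) = (0, 0) := by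
    have h1 := ax false
    have h2 := ax true
    have h3 := az false
    have h4 := az true
    have h5 := cen (e (k + 3) false)
    simp only [SpiderAdj, Prod.ext_iff, ne_eq] at *
    omega
  have cx : ∀ s, (κ (e (k + 2) s)).2 = 1 := fun s => by
    have h1 := ax s
    simp only [SpiderAdj, Prod.ext_iff] at *
    omega
  have cw : (κ (e k false)).2 = 1 := by
    simp only [SpiderAdj, Prod.ext_iff] at *
    omega
  refine ⟨(κ (e k false)).1, c1, c2, fun s => ⟨fun h => nw s ?_, cx s⟩, ?_, ?_⟩
  · exact Prod.ext h.symm (cw.trans (cx s).symm)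
  · intro i hi
    induction i using Nat.strong_induction_on with
    | _ i ih =>
      rcases i with _ | i
      · exact Prod.ext rfl cw
      · have ih1 := ih i (by omega) (by omega)
        obtain ⟨j, hj⟩ : ∃ j, k = j + (i + 1) := ⟨k - (i + 1), by omega⟩
        have e1 : k + 2 - 2 - (i + 1) = j := by omega
        have e2 : k + 2 - 2 - i = j + 1 := by omega
        rw [e2] at ih1
        rw [e1]
        have a1 := H.adj_of_covBy (D.covBy (V j (by omega)) (V (j + 1) (by omega)))
        have a2 := D.color_ne_add_two H (V j (by omega)) (V (j + 2) (by omega)) (by omega)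
        rcases i with _ | i
        · have e3 : j + 2 = k + 1 := by omega
          rw [e3, c1] at a2
          have h5 := cen (e j false)
          simp only [SpiderAdj, Prod.ext_iff, ne_eq] at *
          omega
        · have ih2 := ih i (by omega) (by omega)
          have e3 : k + 2 - 2 - i = j + 2 := by omega
          rw [e3] at ih2
          rw [ih2] at a2
          rw [ih1] at a1
          simp only [SpiderAdj, Prod.ext_iff, ne_eq] at *
          omega
  · intro i hiR hi
    induction i using Nat.strong_induction_on with
    | _ i ih =>
      rcases i with _ | i
      -- There are only three arms, and two are occupied by the middle rank. Hence the upper tail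
      -- goes back into the arm of the lower one.
      · have a1 := H.adj_of_covBy (D.covBy (V (k + 3) (by omega)) (V (k + 3 + 1) (by omega)))
        have a2 := D.color_ne_add_two H (Vn false) (V (k + 2 + 2) (by omega)) (by omega)
        have a3 := D.color_ne_add_two H (Vn true) (V (k + 2 + 2) (by omega)) (by omega)
        have h1 := nw false
        have h2 := nw true
        have h3 := cx false
        have h4 := cx true
        have h5 := arm (e k false)
        have h6 := arm (e (k + 2) false)
        have h7 := arm (e (k + 2) true)
        have h8 := arm (e (k + 2 + 2) false)
        have e1 : k + 3 + 1 = k + 2 + 2 := rfl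
        rw [e1] at a1
        simp only [SpiderAdj, Prod.ext_iff, ne_eq, add_zero] at *
        omega
      · have ih1 := ih i (by omega) (by omega) (by omega)
        have a1 := H.adj_of_covBy (D.covBy (V (k + 2 + 2 + i) (by omega))
          (V (k + 2 + 2 + i + 1) (by omega)))
        have e1 : k + 2 + 2 + (i + 1) = k + 2 + 2 + i + 1 := rfl
        rw [e1]
        rcases i with _ | i
        · have a2 := D.color_ne_add_two H (V (k + 3) (by omega)) (V (k + 3 + 2) (by omega))
            (by omega)
          have e3 : k + 3 + 2 = k + 2 + 2 + 0 + 1 := rfl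
          rw [e3, c2] at a2
          have h5 := cen (e (k + 2 + 2 + 0 + 1) false)
          simp only [SpiderAdj, Prod.ext_iff, ne_eq] at *
          omega
        · have ih2 := ih i (by omega) (by omega) (by omega)
          have a2 := D.color_ne_add_two H (V (k + 2 + 2 + i) (by omega))
            (V (k + 2 + 2 + i + 2) (by omega)) (by omega)
          rw [ih2] at a2
          rw [ih1] at a1
          have e3 : k + 2 + 2 + i + 2 = k + 2 + 2 + (i + 1) + 1 := by omega
          rw [e3] at a2
          simp only [SpiderAdj, Prod.ext_iff, ne_eq] at *
          omega

end DiamondEmb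

end Spider

/-! ### Completion and extension of double-tailed diamonds -/

section Spider

variable {P : Type*} [PartialOrder P]

namespace DiamondEmb

variable {n R : ℕ} {e : ℕ → Bool → P} {κ : P → ℕ × ℕ}

/-- The colour (α, n - 1) of the bottom is the end of the tail and is not reached again before rank
2n. Only the ranks below 2n are needed, so this also serves diamonds that still lack their top. -/
theorem color_ne_bot (D : DiamondEmb n R e) (H : SpiderHeap κ) (hn : 1 ≤ n) (hR : 2 * n ≤ R)
    {r s} (h : ValidRank n R r s) (h0 : 0 < r) (h1 : r < 2 * n) : κ (e r s) ≠ κ (e 0 false) := by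
  rcases eq_or_lt_of_le hn with rfl | hn
  · obtain rfl : r = 1 := by omega
    exact (H.adj_of_covBy (D.covBy ⟨by omega, fun _ => rfl⟩ h)).symm.ne
  · obtain ⟨α, c₁, c₂, cx, cd, cu⟩ := D.exists_colors H hn hR
    have hb := cd (n - 2) (by omega)
    have e0 : n - 2 - (n - 2) = 0 := by omega
    rw [e0] at hb
    rw [hb]
    intro hc
    rcases lt_trichotomy r n with hr | rfl | hr
    · rw [h.2 (by omega)] at hc
      rcases eq_or_ne (r + 1) n with hr' | hr'
      · rw [show r = n - 1 by omega, c₁] at hc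
        simp only [Prod.ext_iff] at hc; omega
      · have := cd (n - 2 - r) (by omega)
        rw [show n - 2 - (n - 2 - r) = r by omega, hc] at this
        simp only [Prod.ext_iff] at this; omega
    · exact (cx s).1 (by rw [hc])
    · rw [h.2 (by omega)] at hc
      rcases eq_or_ne r (n + 1) with hr' | hr'
      · rw [hr', c₂] at hc
        simp only [Prod.ext_iff] at hc; omega
      · have := cu (r - n - 2) (by omega) (by omega)
        rw [show n + 2 + (r - n - 2) = r by omega, hc] at this
        simp only [Prod.ext_iff] at this; omega

/-- Both tails go out to depth n - 1 on the same arm. For n = 1 the bottom and the top have two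
distinct common neighbours, and a tree contains no 4-cycle. -/
theorem color_top (D : DiamondEmb n (2 * n + 1) e) (H : SpiderHeap κ) (hn : 1 ≤ n) :
    κ (e (2 * n) false) = κ (e 0 false) := by
  rcases eq_or_lt_of_le hn with rfl | hn
  · have hxy := D.color_ne H (by omega)
    have v : ∀ s, ValidRank 1 3 1 s := fun s => ⟨by omega, fun h => absurd rfl h⟩
    have a : ∀ s, SpiderAdj (κ (e 0 false)) (κ (e 1 s)) := fun s =>
      H.adj_of_covBy (D.covBy ⟨by omega, fun _ => rfl⟩ (v s))
    have b : ∀ s, SpiderAdj (κ (e 1 s)) (κ (e 2 false)) := fun s =>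
      H.adj_of_covBy (D.covBy (v s) ⟨by omega, fun _ => rfl⟩)
    have h1 := a false
    have h2 := a true
    have h3 := b false
    have h4 := b true
    have h5 := H.arm_center (e 0 false)
    have h6 := H.arm_center (e 2 false)
    have h7 := H.arm_center (e 1 false)
    have h8 := H.arm_center (e 1 true)
    clear a b D H v
    rw [show 2 * 1 = 2 from rfl]
    simp only [SpiderAdj, Prod.ext_iff, ne_eq] at *
    omega
  · obtain ⟨α, c₁, c₂, cx, cd, cu⟩ := D.exists_colors H hn (by omega)
    have h₁ := cd (n - 2) (by omega)
    have h₂ := cu (n - 2) (by omega) (by omega)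
    rw [show n - 2 - (n - 2) = 0 by omega] at h₁
    rw [show n + 2 + (n - 2) = 2 * n by omega] at h₂
    rw [h₁, h₂]

theorem consec (D : DiamondEmb n (2 * n + 1) e) (H : SpiderHeap κ) (hn : 1 ≤ n) :
    Consec κ (e 0 false) (e (2 * n) false) := by
  have v0 : ValidRank n (2 * n + 1) 0 false := ⟨by omega, fun _ => rfl⟩
  have v1 : ValidRank n (2 * n + 1) (2 * n) false := ⟨by omega, fun _ => rfl⟩
  refine ⟨D.lt_of_lt v0 v1 (by omega), (D.color_top H hn).symm, fun t h₁ h₂ => ?_⟩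
  obtain ⟨r, s, hv, rfl, h₃, h₄⟩ := D.exists_between v0 v1 h₁ h₂
  exact D.color_ne_bot H hn (by omega) hv h₃ h₄

/-- The concentric diamond with middle rank `i`. It carries statements about the two ends of a
diamond over to all pairs of ranks n - i and n + i. -/
theorem shift (D : DiamondEmb n R e) {i : ℕ} (hi : i ≤ n) (hR : n + i < R) :
    DiamondEmb i (2 * i + 1) fun r s => e (n - i + r) s := by
  have hv : ∀ {r s}, ValidRank i (2 * i + 1) r s → ValidRank n R (n - i + r) s := fun h =>
    ⟨by have := h.1; omega, fun h' => h.2 (by omega)⟩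
  refine ⟨fun r s r' s' h h' => ?_, fun r s r' s' t h h' h₁ h₂ => ?_⟩
  · rw [D.le_iff _ _ _ _ (hv h) (hv h')]
    simp
  · obtain ⟨r'', s'', hv'', rfl⟩ := D.conv _ _ _ _ t (hv h) (hv h') h₁ h₂
    have hr := h.1
    have hr' := h'.1
    have g1 : n - i + r ≤ r'' := by
      rcases (D.le_iff _ _ _ _ (hv h) hv'').1 h₁ with ⟨h, -⟩ | h <;> omega
    have g2 : r'' ≤ n - i + r' := by
      rcases (D.le_iff _ _ _ _ hv'' (hv h')).1 h₂ with ⟨h, -⟩ | h <;> omega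
    refine ⟨r'' - (n - i), s'', ⟨by omega, fun h => hv''.2 (by omega)⟩, ?_⟩
    rw [show n - i + (r'' - (n - i)) = r'' by omega]

/-- Adding a top element. -/
theorem extend_top (D : DiamondEmb n (2 * n) e) {z : P} (hn : 1 ≤ n)
    (hlt : ∀ r s, ValidRank n (2 * n) r s → e r s < z)
    (hz : ∀ t, e 0 false ≤ t → t < z → ∃ r s, ValidRank n (2 * n) r s ∧ t = e r s) :
    DiamondEmb n (2 * n + 1) fun r s => if r = 2 * n then z else e r s := by
  have hv : ∀ {r s}, ValidRank n (2 * n + 1) r s → r ≠ 2 * n → ValidRank n (2 * n) r s :=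
    fun h h' => ⟨by have := h.1; omega, h.2⟩
  have hv' : ∀ {r s}, ValidRank n (2 * n) r s → ValidRank n (2 * n + 1) r s ∧ r ≠ 2 * n :=
    fun h => ⟨⟨by have := h.1; omega, h.2⟩, by have := h.1; omega⟩
  have v0 : ValidRank n (2 * n) 0 false := ⟨by omega, fun _ => rfl⟩
  have hbot : ∀ r s, ValidRank n (2 * n) r s → e 0 false ≤ e r s := fun r s h => by
    rw [D.le_iff _ _ _ _ v0 h]
    rcases Nat.eq_zero_or_pos r with rfl | h0
    · exact Or.inl ⟨rfl, (h.2 (by omega)).symm⟩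
    · exact Or.inr h0
  refine ⟨fun r s r' s' h h' => ?_, fun r s r' s' t h h' h₁ h₂ => ?_⟩
  · have := h.1
    have := h'.1
    by_cases hr : r = 2 * n <;> by_cases hr' : r' = 2 * n
    · simp [hr, hr', h.2 (by omega), h'.2 (by omega)]
    · simp only [hr, if_true, hr', if_false]
      constructor
      · intro hle
        exact absurd hle (hlt _ _ (hv h' hr')).not_ge
      · omega
    · simp only [hr, if_true, hr', if_false]
      constructor
      · intro; omega
      · intro; exact (hlt _ _ (hv h hr)).le
    · simp only [hr, hr', if_false]
      exact D.le_iff _ _ _ _ (hv h hr) (hv h' hr')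
  · have key : e 0 false ≤ t ∧ t ≤ z := by
      constructor
      · refine le_trans ?_ h₁
        split_ifs with hr
        · exact (hlt _ _ v0).le
        · exact hbot _ _ (hv h hr)
      · refine h₂.trans ?_
        split_ifs with hr
        · exact le_rfl
        · exact (hlt _ _ (hv h' hr)).le
    rcases key.2.eq_or_lt with rfl | hlt'
    · exact ⟨2 * n, false, ⟨by omega, fun _ => rfl⟩, by simp⟩
    · obtain ⟨r, s, hrs, rfl⟩ := hz t key.1 hlt'
      exact ⟨r, s, (hv' hrs).1, by simp [(hv' hrs).2]⟩

/-- Adding a top and a bottom element. -/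
theorem extend (D : DiamondEmb n (2 * n + 1) e) (hn : 1 ≤ n) {w z : P}
    (hw : w < e 0 false) (hz : e (2 * n) false < z)
    (hb : ∀ t, w < t → t < z → e 0 false ≤ t ∧ t ≤ e (2 * n) false) :
    DiamondEmb (n + 1) (2 * (n + 1) + 1)
      fun r s => if r = 0 then w else if r = 2 * (n + 1) then z else e (r - 1) s := by
  have v0 : ValidRank n (2 * n + 1) 0 false := ⟨by omega, fun _ => rfl⟩
  have v1 : ValidRank n (2 * n + 1) (2 * n) false := ⟨by omega, fun _ => rfl⟩
  have hv : ∀ {r s}, ValidRank (n + 1) (2 * (n + 1) + 1) r s → r ≠ 0 → r ≠ 2 * (n + 1) →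
      ValidRank n (2 * n + 1) (r - 1) s :=
    fun h h' h'' => ⟨by have := h.1; omega, fun h₁ => h.2 (by omega)⟩
  have hbot : ∀ r s, ValidRank n (2 * n + 1) r s → w < e r s := fun r s h => by
    by_cases h0 : r = 0
    · subst h0
      rw [h.2 (by omega)]
      exact hw
    · exact hw.trans (D.lt_of_lt v0 h (by omega))
  have htop : ∀ r s, ValidRank n (2 * n + 1) r s → e r s < z := fun r s h => by
    have := h.1
    by_cases h0 : r = 2 * n
    · subst h0
      rw [h.2 (by omega)]
      exact hz
    · exact (D.lt_of_lt h v1 (by omega)).trans hz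
  have hwz : w < z := (hbot _ _ v0).trans (htop _ _ v0)
  refine ⟨fun r s r' s' h h' => ?_, fun r s r' s' t h h' h₁ h₂ => ?_⟩
  · have := h.1
    have := h'.1
    by_cases hr : r = 0
    · subst hr
      rw [h.2 (by omega), if_pos rfl]
      by_cases hr' : r' = 0
      · subst hr'
        rw [h'.2 (by omega), if_pos rfl]
        simp
      · rw [if_neg hr']
        have : w ≤ if r' = 2 * (n + 1) then z else e (r' - 1) s' := by
          split_ifs with h3
          · exact hwz.le
          · exact (hbot _ _ (hv h' hr' h3)).le
        simp only [this, true_iff]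
        omega
    · rw [if_neg hr]
      by_cases hr2 : r = 2 * (n + 1)
      · rw [if_pos hr2, h.2 (by omega)]
        by_cases hr2' : r' = 2 * (n + 1)
        · rw [if_neg (by omega), if_pos hr2', h'.2 (by omega)]
          simp [hr2, hr2']
        · have : ¬ (z ≤ if r' = 0 then w else if r' = 2 * (n + 1) then z else e (r' - 1) s') := by
            split_ifs with h3
            · exact hwz.not_ge
            · exact (htop _ _ (hv h' h3 hr2')).not_ge
          simp only [this, false_iff]
          omega
      · rw [if_neg hr2]
        have hrv := hv h hr hr2
        by_cases hr' : r' = 0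
        · rw [if_pos hr']
          simp only [(hbot _ _ hrv).not_ge, false_iff]
          omega
        · rw [if_neg hr']
          by_cases hr2' : r' = 2 * (n + 1)
          · rw [if_pos hr2']
            simp only [(htop _ _ hrv).le, true_iff]
            omega
          · rw [if_neg hr2', D.le_iff _ _ _ _ hrv (hv h' hr' hr2')]
            constructor
            · rintro (⟨h₁, h₂⟩ | h₁)
              · exact Or.inl ⟨by omega, h₂⟩
              · exact Or.inr (by omega)
            · rintro (⟨h₁, h₂⟩ | h₁)
              · exact Or.inl ⟨by omega, h₂⟩
              · exact Or.inr (by omega)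
  · have key : w ≤ t ∧ t ≤ z := by
      constructor
      · refine le_trans ?_ h₁
        split_ifs with h3 h4
        · exact le_rfl
        · exact hwz.le
        · exact (hbot _ _ (hv h h3 h4)).le
      · refine h₂.trans ?_
        split_ifs with h3 h4
        · exact hwz.le
        · exact le_rfl
        · exact (htop _ _ (hv h' h3 h4)).le
    rcases key.1.eq_or_lt with rfl | g₁
    · exact ⟨0, false, ⟨by omega, fun _ => rfl⟩, by simp⟩
    · rcases key.2.eq_or_lt with rfl | g₂
      · exact ⟨2 * (n + 1), false, ⟨by omega, fun _ => rfl⟩, by simp⟩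
      · obtain ⟨g₃, g₄⟩ := hb t g₁ g₂
        obtain ⟨r, s, hrs, rfl⟩ := D.conv _ _ _ _ t v0 v1 g₃ g₄
        have := hrs.1
        refine ⟨r + 1, s, ⟨by omega, fun h => hrs.2 (by omega)⟩, ?_⟩
        rw [if_neg (by omega), if_neg (by omega), Nat.add_sub_cancel]

/-- A double-tailed diamond without its top is completed by the next element of the colour of its
bottom. -/
theorem exists_completion [Finite P] (D : DiamondEmb n (2 * n) e) (H : SpiderHeap κ) (hn : 1 ≤ n) :
    ∃ z, (∀ r s, ValidRank n (2 * n) r s → e r s < z) ∧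
      DiamondEmb n (2 * n + 1) fun r s => if r = 2 * n then z else e r s := by
  have v0 : ValidRank n (2 * n) 0 false := ⟨by omega, fun _ => rfl⟩
  have vp : ValidRank n (2 * n) 1 false := ⟨by omega, fun _ => rfl⟩
  -- For n ≥ 2 the element q is the maximum of the set. For n = 1 there are two maximal elements, p
  -- and q. In both cases an element above p and q is above everything.
  obtain ⟨sq, vq, hq⟩ : ∃ sq, ValidRank n (2 * n) (2 * n - 1) sq ∧
      (∀ r s, ValidRank n (2 * n) r s → e r s ≤ e (2 * n - 1) sq ∨ e r s = e 1 false) := by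
    rcases eq_or_lt_of_le hn with rfl | hn
    · refine ⟨true, ⟨by omega, fun h => absurd rfl h⟩, fun r s h => ?_⟩
      have := h.1
      rcases s with _ | _
      · rcases Nat.eq_zero_or_pos r with rfl | h0
        · exact Or.inl (D.lt_of_lt h ⟨by omega, fun h => absurd rfl h⟩ (by omega)).le
        · obtain rfl : r = 1 := by omega
          exact Or.inr rfl
      · by_cases hr : r = 1
        · subst hr; exact Or.inl le_rfl
        · exact absurd (h.2 hr) (by simp)
    · have vq : ValidRank n (2 * n) (2 * n - 1) false := ⟨by omega, fun _ => rfl⟩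
      refine ⟨false, vq, fun r s h => Or.inl ?_⟩
      have := h.1
      rw [D.le_iff _ _ _ _ h vq]
      by_cases hr : r = 2 * n - 1
      · exact Or.inl ⟨hr, h.2 (by omega)⟩
      · exact Or.inr (by omega)
  set w := e 0 false
  set p := e 1 false
  set q := e (2 * n - 1) sq
  have hwp : w ⋖ p := D.covBy v0 vp
  have hwq : w < q := D.lt_of_lt v0 vq (by omega)
  have hpq : p ≠ q := by
    intro h
    have h' := (D.le_iff _ _ _ _ vq vp).1 (ge_of_eq h)
    have h'' := (D.le_iff _ _ _ _ vp vq).1 (le_of_eq h)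
    rcases eq_or_lt_of_le hn with rfl | hn
    · rcases sq with _ | _
      · have hxy := D.color_ne H (by omega)
        have v : ValidRank 1 (2 * 1) 1 true := ⟨by omega, fun h => absurd rfl h⟩
        rcases hq 1 true v with g | g
        · have := (D.le_iff _ _ _ _ v vq).1 g
          simp at this
        · rw [g] at hxy
          exact hxy rfl
      · simp at h'
    · omega
  have ap : SpiderAdj (κ w) (κ p) := H.adj_of_covBy hwp
  -- For n ≥ 2 the bottom has the colour (α, n - 1) and q has the colour (α, n - 2), read as the
  -- centre when n = 2.
  have aq : SpiderAdj (κ w) (κ q) := by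
    rcases eq_or_lt_of_le hn with rfl | hn
    · exact H.adj_of_covBy (D.covBy v0 vq)
    · have hs : sq = false := vq.2 (by omega)
      obtain ⟨α, c₁, c₂, cx, cd, cu⟩ := D.exists_colors H hn le_rfl
      have hb := cd (n - 2) (by omega)
      rw [show n - 2 - (n - 2) = 0 by omega] at hb
      have : κ q = if n = 2 then (0, 0) else (α, n - 2) := by
        split_ifs with h2
        · subst h2; simp only [q, hs]; exact c₂
        · have := cu (n - 3) (by omega) (by omega)
          rw [show n + 2 + (n - 3) = 2 * n - 1 by omega] at this
          simp only [q, hs, this]; exact Prod.ext rfl (by change n - 3 + 1 = n - 2; omega)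
      rw [this, hb]
      split_ifs with h2
      · subst h2; simp [SpiderAdj]
      · exact Or.inl ⟨rfl, Or.inr rfl⟩
  -- The top is the next element with the colour of the bottom. By `neighbors`, p and q are then the
  -- only elements of adjacent colour in between.
  obtain ⟨z, hz, hzmin⟩ := (Set.toFinite {z | w < z ∧ κ z = κ w}).exists_minimal
    (H.exists_above w p q hwp.lt hwq hpq ap aq)
  have hwz : Consec κ w z := ⟨hz.1, hz.2.symm, fun t h₁ h₂ h₃ => (hzmin ⟨h₁, h₃⟩ h₂.le).not_gt h₂⟩
  have hpz : p < z := by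
    rcases H.comparable p z (Or.inr (by rw [hz.2]; exact ap.symm)) with h | h
    · exact lt_of_le_of_ne h fun h' => ap.ne (by rw [h', hz.2])
    · rcases h.eq_or_lt with h | h
      · exact absurd (by rw [← h, hz.2]) ap.ne
      · exact absurd h (hwp.2 hz.1)
  have hqz : q < z := by
    rcases H.comparable q z (Or.inr (by rw [hz.2]; exact aq.symm)) with h | h
    · exact lt_of_le_of_ne h fun h' => aq.ne (by rw [h', hz.2])
    · obtain ⟨r, s, hrs, rfl⟩ := D.conv _ _ _ _ z v0 vq hz.1.le h
      have hr : 0 < r := by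
        rcases (D.le_iff _ _ _ _ v0 hrs).1 hz.1.le with ⟨rfl, rfl⟩ | h
        · exact absurd hz.1 (lt_irrefl _)
        · exact h
      exact absurd hz.2 (D.color_ne_bot H hn le_rfl hrs hr hrs.1)
  obtain ⟨u, v, huv, -, -, -, -, -, -, hnb, -⟩ := H.neighbors w z hwz
  have hnb' : ∀ t, w < t → t < z → SpiderAdj (κ w) (κ t) → t = p ∨ t = q := fun t h₁ h₂ h₃ => by
    have e1 := hnb p hwp.lt hpz ap
    have e2 := hnb q hwq hqz aq
    have e3 := hnb t h₁ h₂ h₃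
    clear_value p q
    grind
  have hlt : ∀ r s, ValidRank n (2 * n) r s → e r s < z := fun r s h => by
    rcases hq r s h with h | h
    · exact h.trans_lt hqz
    · rw [h]; exact hpz
  -- An element strictly between w and z lies above a neighbour of w and below a neighbour of z.
  -- Both of these are p or q, so convexity puts the element into the set.
  refine ⟨z, hlt, D.extend_top hn hlt fun t h₁ h₂ => ?_⟩
  rcases h₁.eq_or_lt with rfl | h₁
  · exact ⟨_, _, v0, rfl⟩
  · obtain ⟨t', g₁, g₂, g₃⟩ := H.exists_adj w t h₁
    obtain ⟨t'', g₄, g₅⟩ := exists_le_covBy_of_lt h₂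
    have e1 := hnb' t' g₁ (g₂.trans_lt h₂) g₃
    have e2 := hnb' t'' (h₁.trans_le g₄) g₅.lt (by
      have := (H.adj_of_covBy g₅).symm
      rwa [hz.2] at this)
    have vt' : ∃ r s, ValidRank n (2 * n) r s ∧ t' = e r s := by
      rcases e1 with h | h
      · exact ⟨_, _, vp, h⟩
      · exact ⟨_, _, vq, h⟩
    have vt'' : ∃ r s, ValidRank n (2 * n) r s ∧ t'' = e r s := by
      rcases e2 with h | h
      · exact ⟨_, _, vp, h⟩
      · exact ⟨_, _, vq, h⟩
    obtain ⟨r, s, hv, rfl⟩ := vt'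
    obtain ⟨r', s', hv', rfl⟩ := vt''
    exact D.conv _ _ _ _ t hv hv' g₂ g₄

end DiamondEmb

end Spider

/-! ### Spider heaps are d-complete; hook lengths in spider heaps -/

section Spider

variable {P : Type*} [PartialOrder P]

theorem diamondEmb_of_diamond {w u v z : P} (wu : w < u) (uz : u < z) (wv : w < v) (vz : v < z)
    (huv : ¬ u ≤ v) (hvu : ¬ v ≤ u) (hbet : ∀ t, w < t → t < z → t = u ∨ t = v) :
    DiamondEmb 1 (2 * 1 + 1) fun r s =>
      if r = 0 then w else if r = 1 then (if s then v else u) else z := by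
  have hwz := wu.trans uz
  have hV : ∀ {r s}, ValidRank 1 (2 * 1 + 1) r s → (r = 0 ∧ s = false) ∨ (r = 1 ∧ s = false) ∨
      (r = 1 ∧ s = true) ∨ (r = 2 ∧ s = false) := by
    rintro r s ⟨h₁, h₂⟩
    rcases s with _ | _
    · simp; omega
    · have : r = 1 := by by_contra h; exact absurd (h₂ h) (by simp)
      simp [this]
  constructor
  · intro r s r' s' h h'
    rcases hV h with ⟨rfl, rfl⟩ | ⟨rfl, rfl⟩ | ⟨rfl, rfl⟩ | ⟨rfl, rfl⟩ <;>
      rcases hV h' with ⟨rfl, rfl⟩ | ⟨rfl, rfl⟩ | ⟨rfl, rfl⟩ | ⟨rfl, rfl⟩ <;>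
      simp [wu.le, uz.le, wv.le, vz.le, hwz.le, wu.not_ge, uz.not_ge, wv.not_ge, vz.not_ge,
        hwz.not_ge, huv, hvu]
  · intro r s r' s' t h h' h₁ h₂
    have hwt : w ≤ t := by
      refine le_trans ?_ h₁
      split_ifs
      exacts [le_rfl, wv.le, wu.le, hwz.le]
    have htz : t ≤ z := by
      refine h₂.trans ?_
      split_ifs
      exacts [hwz.le, vz.le, uz.le, le_rfl]
    rcases hwt.eq_or_lt with rfl | hwt
    · exact ⟨0, false, ⟨by omega, fun _ => rfl⟩, rfl⟩
    · rcases htz.eq_or_lt with rfl | htz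
      · exact ⟨2, false, ⟨by omega, fun _ => rfl⟩, rfl⟩
      · rcases hbet t hwt htz with rfl | rfl
        · exact ⟨1, false, ⟨by omega, fun _ => rfl⟩, rfl⟩
        · exact ⟨1, true, ⟨by omega, fun h => absurd rfl h⟩, rfl⟩

namespace SpiderHeap

variable {κ : P → ℕ × ℕ}

/-- All three axioms are read off from the colours. A missing top is the next element of the colour
of the bottom. An element covered by a top has a colour adjacent to that of the bottom, hence is
comparable with the bottom. Finally, the colour of the bottom is determined by the rest of the set,
and elements of one colour form a chain. -/
theorem isDComplete [Finite P] (H : SpiderHeap κ) : IsDComplete P where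
  exists_top k hk I hI := by
    obtain ⟨e, D, hmem⟩ := hI.exists_diamondEmb hk
    obtain ⟨z, hlt, D'⟩ := D.exists_completion H (by omega)
    have v0 : ValidRank (k - 2) (2 * (k - 2)) 0 false := ⟨by omega, fun _ => rfl⟩
    have hint := D'.isDkInterval hk
    have hIcc : I ∪ {z} = Set.Icc (e 0 false) z := by
      ext t
      simp only [Set.mem_union, Set.mem_singleton_iff, Set.mem_Icc, hmem]
      constructor
      · rintro (⟨r, s, hv, rfl⟩ | rfl)
        · refine ⟨(D.le_iff _ _ _ _ v0 hv).2 ?_, (hlt r s hv).le⟩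
          rcases Nat.eq_zero_or_pos r with rfl | h0
          · exact Or.inl ⟨rfl, (hv.2 (by omega)).symm⟩
          · exact Or.inr h0
        · exact ⟨(hlt _ _ v0).le, le_rfl⟩
      · rintro ⟨h₁, h₂⟩
        obtain ⟨r, s, hv, ht⟩ := D'.conv 0 false (2 * (k - 2)) false t ⟨by omega, fun _ => rfl⟩
          ⟨by omega, fun _ => rfl⟩ (by rwa [if_neg (by omega)]) (by rwa [if_pos rfl])
        split_ifs at ht with hr
        · exact Or.inr ht
        · exact Or.inl ⟨r, s, ⟨by have := hv.1; omega, hv.2⟩, ht⟩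
    refine ⟨e 0 false, z, fun m hm => ?_, hIcc, by simpa [show k - 2 ≠ 0 by omega] using hint⟩
    obtain ⟨r, s, hv, rfl⟩ := (hmem m).1 hm.1
    refine ⟨hlt _ _ hv, fun t h₁ h₂ => ?_⟩
    have ht : t ∈ I ∪ {z} := by
      rw [hIcc]
      exact ⟨(hIcc ▸ Or.inl hm.1 : e r s ∈ Set.Icc (e 0 false) z).1.trans h₁.le, h₂.le⟩
    rcases ht with ht | rfl
    · exact (hm.2 ht h₁.le).not_gt h₁
    · exact lt_irrefl _ h₂
  mem_of_covBy k hk w z h y hy := by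
    obtain ⟨e, D, rfl, rfl, -⟩ := h.exists_diamondEmb hk
    have hc := D.color_top H (by omega)
    have hcs := D.consec H (by omega)
    refine ⟨?_, hy.le⟩
    rcases H.comparable _ y (Or.inr (by
      have := (H.adj_of_covBy hy).symm
      rwa [hc] at this)) with h | h
    · exact h
    · rcases h.eq_or_lt with rfl | h
      · exact le_rfl
      · exact absurd hcs.1 (hy.2 h)
  eq_of_minimal k hk I J hI hJ hIJ := by
    obtain ⟨e, D, hmem⟩ := hI.exists_diamondEmb hk
    obtain ⟨f, F, hmem'⟩ := hJ.exists_diamondEmb hk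
    obtain ⟨n, hn, rfl⟩ : ∃ n, 1 ≤ n ∧ k = n + 2 := ⟨k - 2, by omega, by omega⟩
    rw [Nat.add_sub_cancel] at *
    have key : ∀ {e : ℕ → Bool → P} {I : Set P} (_ : DiamondEmb n (2 * n) e)
        (_ : ∀ t, t ∈ I ↔ ∃ r s, ValidRank n (2 * n) r s ∧ t = e r s),
        (∀ u, Minimal (· ∈ I) u ↔ u = e 0 false) ∧
          ∀ t, t ∈ I \ {u | Minimal (· ∈ I) u} ↔
            ∃ r s, ValidRank n (2 * n) r s ∧ t = e r s ∧ 0 < r := by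
      intro e I D hmem
      have v0 : ValidRank n (2 * n) 0 false := ⟨by omega, fun _ => rfl⟩
      have h₁ : ∀ u, Minimal (· ∈ I) u ↔ u = e 0 false := fun u => by
        constructor
        · intro hu
          obtain ⟨r, s, hv, rfl⟩ := (hmem u).1 hu.1
          rcases Nat.eq_zero_or_pos r with rfl | h0
          · rw [hv.2 (by omega)]
          · have := D.lt_of_lt v0 hv h0
            exact absurd this (hu.2 ((hmem _).2 ⟨_, _, v0, rfl⟩) this.le).not_gt
        · rintro rfl
          refine ⟨(hmem _).2 ⟨_, _, v0, rfl⟩, fun t ht hle => ?_⟩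
          obtain ⟨r, s, hv, rfl⟩ := (hmem t).1 ht
          rcases (D.le_iff _ _ _ _ hv v0).1 hle with ⟨rfl, rfl⟩ | h
          · exact le_rfl
          · omega
      refine ⟨h₁, fun t => ?_⟩
      rw [Set.mem_sdiff, Set.mem_ofPred_eq, h₁, hmem]
      constructor
      · rintro ⟨⟨r, s, hv, rfl⟩, ht⟩
        refine ⟨r, s, hv, rfl, Nat.pos_of_ne_zero ?_⟩
        rintro rfl
        rw [hv.2 (by omega)] at ht
        exact ht rfl
      · rintro ⟨r, s, hv, rfl, h0⟩
        exact ⟨⟨r, s, hv, rfl⟩, (D.lt_of_lt v0 hv h0).ne'⟩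
    obtain ⟨kI, kI'⟩ := key D hmem
    obtain ⟨kJ, kJ'⟩ := key F hmem'
    have v0 : ValidRank n (2 * n) 0 false := ⟨by omega, fun _ => rfl⟩
    have v1 : ValidRank n (2 * n) 1 false := ⟨by omega, fun _ => rfl⟩
    have tr : ∀ r s, ValidRank n (2 * n) r s → 0 < r →
        ∃ r' s', ValidRank n (2 * n) r' s' ∧ e r s = f r' s' ∧ 0 < r' := fun r s hv h0 => by
      have := (kI' (e r s)).2 ⟨r, s, hv, rfl, h0⟩
      rw [hIJ] at this
      exact (kJ' _).1 this
    have tr' : ∀ r s, ValidRank n (2 * n) r s → 0 < r →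
        ∃ r' s', ValidRank n (2 * n) r' s' ∧ f r s = e r' s' ∧ 0 < r' := fun r s hv h0 => by
      have := (kJ' (f r s)).2 ⟨r, s, hv, rfl, h0⟩
      rw [← hIJ] at this
      exact (kI' _).1 this
    have hne : ∀ r s, ValidRank n (2 * n) r s → 0 < r → κ (e r s) ≠ κ (f 0 false) :=
      fun r s hv h0 => by
        obtain ⟨r', s', hv', h, h0'⟩ := tr r s hv h0
        rw [h]
        exact F.color_ne_bot H hn le_rfl hv' h0' hv'.1
    -- The rest of the set determines the colour of its bottom: for n = 1 by two common neighbours,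
    -- for n = 2 because only one arm is left, for n ≥ 3 because the tail goes straight on.
    have h00 : κ (e 0 false) = κ (f 0 false) ∧ e 0 false ⋖ e 1 false ∧ f 0 false ⋖ e 1 false := by
      have c1 := D.covBy v0 v1
      rcases eq_or_lt_of_le hn with rfl | hn
      · have w1 : ∀ s, ValidRank 1 (2 * 1) 1 s := fun s => ⟨by omega, fun h => absurd rfl h⟩
        have hf : ∀ s, f 0 false ⋖ e 1 s := fun s => by
          obtain ⟨r', s', hv', h, h0'⟩ := tr 1 s (w1 s) one_pos
          obtain rfl : r' = 1 := by have := hv'.1; omega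
          rw [h]
          exact F.covBy v0 hv'
        refine ⟨?_, c1, hf false⟩
        have h1 := H.adj_of_covBy (hf false)
        have h2 := H.adj_of_covBy (hf true)
        have h3 := H.adj_of_covBy (D.covBy v0 (w1 false))
        have h4 := H.adj_of_covBy (D.covBy v0 (w1 true))
        have h5 := H.arm_center (e 0 false)
        have h6 := H.arm_center (f 0 false)
        have h7 := H.arm_center (e 1 false)
        have h8 := H.arm_center (e 1 true)
        have h9 := D.color_ne H (by omega)
        simp only [zero_add, SpiderAdj, Prod.ext_iff, ne_eq] at h1 h2 h3 h4 h5 h6 h7 h8 h9 ⊢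
        omega
      · have hef : e 1 false = f 1 false := by
          apply le_antisymm
          · obtain ⟨r', s', hv', h, h0'⟩ := tr' 1 false v1 one_pos
            rw [h, D.le_iff _ _ _ _ v1 hv']
            rcases eq_or_ne r' 1 with rfl | h
            · exact Or.inl ⟨rfl, (hv'.2 (by omega)).symm⟩
            · exact Or.inr (by omega)
          · obtain ⟨r', s', hv', h, h0'⟩ := tr 1 false v1 one_pos
            rw [h, F.le_iff _ _ _ _ v1 hv']
            rcases eq_or_ne r' 1 with rfl | h
            · exact Or.inl ⟨rfl, (hv'.2 (by omega)).symm⟩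
            · exact Or.inr (by omega)
        have c2 : f 0 false ⋖ e 1 false := by rw [hef]; exact F.covBy v0 v1
        refine ⟨?_, c1, c2⟩
        have a2 := H.adj_of_covBy c2
        obtain ⟨α, c₁, c₂, cx, cd, cu⟩ := D.exists_colors H hn le_rfl
        have hb := cd (n - 2) (by omega)
        rw [show n - 2 - (n - 2) = 0 by omega] at hb
        have hcen := H.arm_center (f 0 false)
        rcases eq_or_ne n 2 with rfl | hn2
        · have x1 := hne 2 false ⟨by omega, fun _ => rfl⟩ (by omega)
          have x2 := hne 2 true ⟨by omega, fun h => absurd rfl h⟩ (by omega)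
          have x3 := cx false
          have x4 := cx true
          have x5 := D.color_ne H (by omega)
          have x6 := H.arm_lt (f 0 false)
          have x7 := H.arm_lt (e 2 false)
          have x8 := H.arm_lt (e 2 true)
          have x9 := H.arm_lt (e 0 false)
          rw [show 2 - 1 = 1 from rfl] at c₁
          simp only [SpiderAdj, Prod.ext_iff, ne_eq] at x1 x2 x3 x4 x5 x6 x7 x8 x9 c₁ a2 hcen hb ⊢
          omega
        · have h1 := cd (n - 3) (by omega)
          rw [show n - 2 - (n - 3) = 1 by omega] at h1
          have h2 := hne 2 false ⟨by omega, fun _ => rfl⟩ (by omega)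
          rcases eq_or_ne n 3 with rfl | hn3
          · rw [show 3 - 1 = 2 from rfl] at c₁
            simp only [SpiderAdj, Prod.ext_iff, ne_eq] at h1 h2 c₁ a2 hcen hb ⊢
            omega
          · have h3 := cd (n - 4) (by omega)
            rw [show n - 2 - (n - 4) = 2 by omega] at h3
            simp only [SpiderAdj, Prod.ext_iff, ne_eq] at h1 h2 h3 a2 hcen hb ⊢
            omega
    -- Equal colours make the two bottoms comparable, but both are covered by the same element.
    have hbot : e 0 false = f 0 false := by
      obtain ⟨hc, c1, c2⟩ := h00
      rcases H.comparable _ _ (Or.inl hc) with h | h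
      · rcases h.eq_or_lt with h | h
        · exact h
        · exact absurd c2.lt (c1.2 h)
      · rcases h.eq_or_lt with h | h
        · exact h.symm
        · exact absurd c1.lt (c2.2 h)
    have hmin : {u | Minimal (· ∈ I) u} = {u | Minimal (· ∈ J) u} := by
      ext u
      rw [Set.mem_ofPred_eq, Set.mem_ofPred_eq, kI, kJ, hbot]
    have hsub : ∀ K : Set P, {u | Minimal (· ∈ K) u} ⊆ K := fun K u hu => hu.1
    rw [← Set.sdiff_union_of_subset (hsub I), hIJ, hmin, Set.sdiff_union_of_subset (hsub J)]

/-- Consecutive elements of the same colour are the ends of a double-tailed diamond. -/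
theorem exists_diamondEmb [Finite P] (H : SpiderHeap κ) (z : P) : ∀ w, Consec κ w z →
    ∃ n e, 1 ≤ n ∧ DiamondEmb n (2 * n + 1) e ∧ e 0 false = w ∧ e (2 * n) false = z := by
  induction z using WellFoundedLT.induction with
  | ind z ih =>
    intro w hwz
    -- If u and v are incomparable, then w, u, v, z form a diamond. Otherwise u and v are
    -- consecutive of one colour; by induction they bound a double-tailed diamond, to which w and z
    -- are added.
    obtain ⟨u, v, huv, wu, uz, wv, vz, au, av, hnb, hor⟩ := H.neighbors w z hwz
    have hbet : ∀ t, w < t → t < z → (u ≤ t ∨ v ≤ t) ∧ (t ≤ u ∨ t ≤ v) := fun t h₁ h₂ => by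
      obtain ⟨t', g₁, g₂, g₃⟩ := H.exists_adj w t h₁
      obtain ⟨t'', g₄, g₅⟩ := exists_le_covBy_of_lt h₂
      constructor
      · rcases hnb t' g₁ (g₂.trans_lt h₂) g₃ with rfl | rfl
        · exact Or.inl g₂
        · exact Or.inr g₂
      · rcases hnb t'' (h₁.trans_le g₄) g₅.lt (by
          have := (H.adj_of_covBy g₅).symm
          rwa [← hwz.2.1] at this) with rfl | rfl
        · exact Or.inl g₄
        · exact Or.inr g₄
    by_cases hinc : ¬ u ≤ v ∧ ¬ v ≤ u
    · refine ⟨1, _, le_rfl, diamondEmb_of_diamond wu uz wv vz hinc.1 hinc.2 fun t h₁ h₂ => ?_, rfl,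
        rfl⟩
      obtain ⟨k₃, k₄⟩ := hbet t h₁ h₂
      rcases k₃ with k₃ | k₃ <;> rcases k₄ with k₄ | k₄
      · exact Or.inl (le_antisymm k₄ k₃)
      · exact absurd (k₃.trans k₄) hinc.1
      · exact absurd (k₃.trans k₄) hinc.2
      · exact Or.inr (le_antisymm k₄ k₃)
    · have hc : κ u = κ v := hor.resolve_right hinc
      have main : ∀ u v, u < v → κ u = κ v → w < u → v < z → SpiderAdj (κ w) (κ u) →
          (∀ t, w < t → t < z → SpiderAdj (κ w) (κ t) → t = u ∨ t = v) →
          (∀ t, w < t → t < z → (u ≤ t ∨ v ≤ t) ∧ (t ≤ u ∨ t ≤ v)) →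
          ∃ n e, 1 ≤ n ∧ DiamondEmb n (2 * n + 1) e ∧ e 0 false = w ∧ e (2 * n) false = z := by
        intro u v huv hc wu vz au hnb hbet
        obtain ⟨n, e, hn, D, rfl, rfl⟩ := ih v vz u ⟨huv, hc, fun t h₁ h₂ h₃ => by
          rcases hnb t (wu.trans h₁) (h₂.trans vz) (by rwa [h₃]) with rfl | rfl
          · exact lt_irrefl _ h₁
          · exact lt_irrefl _ h₂⟩
        refine ⟨n + 1, _, by omega, D.extend hn wu vz fun t h₁ h₂ => ?_, by simp, by simp⟩
        obtain ⟨k₁, k₂⟩ := hbet t h₁ h₂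
        constructor
        · rcases k₁ with k₁ | k₁
          · exact k₁
          · exact huv.le.trans k₁
        · rcases k₂ with k₂ | k₂
          · exact k₂.trans huv.le
          · exact k₂
      rcases H.comparable u v (Or.inl hc) with h | h
      · exact main u v (lt_of_le_of_ne h huv) hc wu vz au hnb hbet
      · exact main v u (lt_of_le_of_ne h huv.symm) hc.symm wv uz av
          (fun t h₁ h₂ h₃ => (hnb t h₁ h₂ h₃).symm) fun t h₁ h₂ =>
          ⟨(hbet t h₁ h₂).1.symm, (hbet t h₁ h₂).2.symm⟩

/-- Local conditions that characterise the hook lengths. -/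
theorem isHookLength [Finite P] (H : SpiderHeap κ) {h : P → ℕ}
    (hc : ∀ w z u v, Consec κ w z → u ≠ v → w < u → u < z → w < v → v < z →
      SpiderAdj (κ w) (κ u) → SpiderAdj (κ w) (κ v) → h z + h w = h u + h v)
    (hl : ∀ z, (∀ w, w < z → κ w ≠ κ z) → h z = Nat.card (Set.Iic z)) : IsHookLength h where
  of_not_inNeck z hz := by
    apply hl
    -- A lower element of the same colour would make `z` the top of a double-tailed diamond, hence
    -- put it in a neck.
    by_contra! hex
    obtain ⟨w, hw, hwmax⟩ := (Set.toFinite {w | w < z ∧ κ w = κ z}).exists_maximal hex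
    obtain ⟨n, e, hn, D, rfl, rfl⟩ := H.exists_diamondEmb z w ⟨hw.1, hw.2, fun t h₁ h₂ h₃ =>
      (hwmax ⟨h₂, h₃.trans hw.2⟩ h₁.le).not_gt h₁⟩
    have D' : DiamondEmb (n + 2 - 2) (2 * (n + 2 - 2) + 1) e := D
    have v0 : ValidRank n (2 * n + 1) 0 false := ⟨by omega, fun _ => rfl⟩
    have v1 : ValidRank n (2 * n + 1) (2 * n) false := ⟨by omega, fun _ => rfl⟩
    have vn : ∀ s, ValidRank n (2 * n + 1) n s := fun s => ⟨by omega, fun h => absurd rfl h⟩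
    have l0 : ∀ s, e 0 false ≤ e n s := fun s => (D.lt_of_lt v0 (vn s) (by omega)).le
    have l1 : ∀ s, e n s ≤ e (2 * n) false := fun s => (D.lt_of_lt (vn s) v1 (by omega)).le
    refine hz ⟨n + 2, by omega, _, _, D'.isDkInterval (by omega), ⟨(l0 true).trans (l1 true), le_rfl⟩,
      e n false, ⟨l0 _, l1 _⟩, e n true, ⟨l0 _, l1 _⟩, fun h => ?_, fun h => ?_, l1 _, l1 _⟩
    · simpa using (D.le_iff _ _ _ _ (vn _) (vn _)).1 h
    · simpa using (D.le_iff _ _ _ _ (vn _) (vn _)).1 h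
  of_isDkInterval k hk w z hwz x hx y hy hxy hyx := by
    obtain ⟨e, D, rfl, rfl, hmem⟩ := hwz.exists_diamondEmb hk
    obtain ⟨n, hn, rfl⟩ : ∃ n, 1 ≤ n ∧ k = n + 2 := ⟨k - 2, by omega, by omega⟩
    rw [Nat.add_sub_cancel] at *
    have vn : ∀ s, ValidRank n (2 * n + 1) n s := fun s => ⟨by omega, fun h => absurd rfl h⟩
    have V : ∀ r, r < 2 * n + 1 → ValidRank n (2 * n + 1) r false := fun r h => ⟨h, fun _ => rfl⟩
    have hcons : ∀ i, 1 ≤ i → i ≤ n → Consec κ (e (n - i) false) (e (n + i) false) := by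
      intro i h1 h2
      have := (D.shift h2 (by omega)).consec H h1
      rwa [add_zero, show n - i + 2 * i = n + i by omega] at this
    -- On the way outwards along the two tails the sum of the hook lengths at the ends stays
    -- constant. So the local relation implies the defining recursion for the whole diamond.
    have key : ∀ i, 1 ≤ i → i ≤ n →
        h (e (n + i) false) + h (e (n - i) false) = h (e n false) + h (e n true) := by
      intro i h1
      induction i, h1 using Nat.le_induction with
      | base =>
        intro h2
        have a : ∀ s, e (n - 1) false ⋖ e n s := fun s => by
          have := D.covBy (s' := s) (V (n - 1) (by omega))
            (by rw [show n - 1 + 1 = n by omega]; exact vn s)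
          rwa [show n - 1 + 1 = n by omega] at this
        have b : ∀ s, e n s ⋖ e (n + 1) false := fun s => D.covBy (vn s) (V (n + 1) (by omega))
        refine hc _ _ _ _ (hcons 1 le_rfl h2) (fun h => ?_) (a _).lt (b _).lt (a _).lt (b _).lt
          (H.adj_of_covBy (a _)) (H.adj_of_covBy (a _))
        exact D.color_ne H (by omega) (by rw [h])
      | succ i h1 ih =>
        intro h2
        rw [← ih (by omega), add_comm (h (e (n + i) false))]
        have a : e (n - (i + 1)) false ⋖ e (n - i) false := by
          have := D.covBy (V (n - (i + 1)) (by omega)) (V (n - (i + 1) + 1) (by omega))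
          rwa [show n - (i + 1) + 1 = n - i by omega] at this
        have b : e (n + i) false ⋖ e (n + (i + 1)) false :=
          D.covBy (V (n + i) (by omega)) (V (n + i + 1) (by omega))
        have m : e (n - i) false < e (n + i) false :=
          D.lt_of_lt (V _ (by omega)) (V _ (by omega)) (by omega)
        refine hc _ _ _ _ (hcons (i + 1) (by omega) h2) m.ne a.lt (m.trans b.lt) (a.lt.trans m) b.lt
          (H.adj_of_covBy a) ?_
        have := (H.adj_of_covBy b).symm
        rwa [← (hcons (i + 1) (by omega) h2).2.1] at this
    have hk := key n hn le_rfl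
    rw [Nat.sub_self, ← two_mul] at hk
    obtain ⟨r, s, hv, rfl⟩ := (hmem x).1 hx
    obtain ⟨r', s', hv', rfl⟩ := (hmem y).1 hy
    rw [D.le_iff _ _ _ _ hv hv'] at hxy
    rw [D.le_iff _ _ _ _ hv' hv] at hyx
    have hr : r = r' := by omega
    subst hr
    have hs : s ≠ s' := fun h => hxy (Or.inl ⟨rfl, h⟩)
    have hr : r = n := by
      by_contra hr
      exact hs ((hv.2 hr).trans (hv'.2 hr).symm)
    subst hr
    rcases s with _ | _ <;> rcases s' with _ | _
    · exact absurd rfl hs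
    · omega
    · omega
    · exact absurd rfl hs

end SpiderHeap

end Spider

/-! ### The pump as a heap over a spider -/

theorem Attachment.mem_offDiagCells {n : ℕ} (A : Attachment n) (p : ℕ × ℕ) :
    p ∈ A.offDiagCells ↔ p.1 < p.2 ∧ p.1 < A.size ∧ p.2 < A.shape.rowLen p.1 + A.size := by
  have := A.shape.rowLen_anti 0 p.1 (Nat.zero_le _)
  simp only [offDiagCells, shiftedCells, Finset.mem_filter, Finset.mem_product, Finset.mem_range]
  omega

theorem YoungDiagram.rowLen_bot (r : ℕ) : (⊥ : YoungDiagram).rowLen r = 0 := by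
  rw [YoungDiagram.rowLen_eq_card, Finset.card_eq_zero]
  simp [YoungDiagram.row]

/-- The strict partition `λ + (3, 2, 1)`. -/
def Par.strict (lam : Par 3) (r : ℕ) : ℕ := lam.1.rowLen r + 3 - r

theorem Par.rowLen_three (lam : Par 3) : lam.1.rowLen 3 = 0 := by
  by_contra h
  have h' : (3, 0) ∈ lam.1 := YoungDiagram.mem_iff_lt_rowLen.2 (Nat.pos_of_ne_zero h)
  have := YoungDiagram.mem_iff_lt_colLen.1 h'
  have := lam.2
  omega

theorem Par.strict_lt (lam : Par 3) :
    lam.strict 1 < lam.strict 0 ∧ lam.strict 2 < lam.strict 1 ∧ 1 ≤ lam.strict 2 := by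
  have h₁ := lam.1.rowLen_anti 0 1 (by omega)
  have h₂ := lam.1.rowLen_anti 1 2 (by omega)
  simp only [strict]
  omega

/-- The arms of the spider that correspond to the attachments of the pump. -/
def pumpArm : Fin 6 → ℕ := ![2, 1, 0, 1, 2, 1]

variable {lam : Par 3}

/-- The colour of an element of the pump: a vertex of a spider with three arms. -/
def pumpColor : Pump lam → ℕ × ℕ
  | .inl a => (0, (a : ℕ) - 5)
  | .inr ⟨i, p⟩ => (pumpArm i, p.1.2 - p.1.1)

/-- The height of an element of the pump. -/
def pumpHeight : Pump lam → ℤ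
  | .inl a => if (a : ℕ) < 6 then 2 * (a : ℤ) + 2 else (a : ℤ) + 7
  | .inr ⟨i, p⟩ => 2 * (((pumpData lam i).diagPos p.1.1 : ℕ) : ℤ) + 2 - ((p.1.2 : ℤ) - p.1.1)

/-- The pairs of colours `(a, d)` and heights `h` that occur in the pump. -/
def PumpShape (l₀ l₁ l₂ a d : ℕ) (h : ℤ) : Prop :=
  (a = 0 ∧ d = 0 ∧ (h = 2 ∨ h = 4 ∨ h = 6 ∨ h = 8 ∨ h = 10 ∨ h = 12)) ∨
  (a = 0 ∧ 1 ≤ d ∧ d ≤ l₀ ∧ h = 12 + d) ∨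
  (a = 0 ∧ 1 ≤ d ∧ d ≤ l₀ ∧ h = 10 - d) ∨
  (a = 0 ∧ 1 ≤ d ∧ d ≤ l₁ ∧ h = 8 - d) ∨
  (a = 0 ∧ 1 ≤ d ∧ d ≤ l₂ ∧ h = 6 - d) ∨
  (a = 1 ∧ d = 1 ∧ (h = 3 ∨ h = 7 ∨ h = 11)) ∨
  (a = 2 ∧ d = 1 ∧ (h = 3 ∨ h = 5 ∨ h = 9 ∨ h = 11)) ∨
  (a = 2 ∧ d = 2 ∧ (h = 4 ∨ h = 10))

/-- The distance between the colours is at most the difference of the heights; the least element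
of the centre is not below the elements of the long arm that begin to the right of the last diagonal
cell. -/
def PumpLe (c : ℕ × ℕ) (h : ℤ) (c' : ℕ × ℕ) (h' : ℤ) : Prop :=
  (c.1 = c'.1 → (c.2 : ℤ) - c'.2 ≤ h' - h ∧ (c'.2 : ℤ) - c.2 ≤ h' - h) ∧
    (c.1 ≠ c'.1 → (c.2 : ℤ) + c'.2 ≤ h' - h) ∧
    ¬ (c.2 = 0 ∧ h = 2 ∧ c'.1 = 0 ∧ 1 ≤ c'.2 ∧ h' - c'.2 = 2)

theorem pumpData_size (i : Fin 6) : (pumpData lam i).size = (![3, 2, 4, 2, 3, 2] : Fin 6 → ℕ) i := by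
  fin_cases i <;> rfl

theorem pumpData_start (i : Fin 6) :
    (pumpData lam i).start = (![1, 1, 2, 3, 4, 5] : Fin 6 → ℕ) i := by
  fin_cases i <;> rfl

theorem pumpData_rowLen (i : Fin 6) (r : ℕ) :
    (pumpData lam i).shape.rowLen r = if i = 2 then lam.1.rowLen r else 0 := by
  fin_cases i
  · exact YoungDiagram.rowLen_bot r
  · exact YoungDiagram.rowLen_bot r
  · rfl
  · exact YoungDiagram.rowLen_bot r
  · exact YoungDiagram.rowLen_bot r
  · exact YoungDiagram.rowLen_bot r

theorem pumpData_diagPos (i : Fin 6) (r : ℕ) :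
    (pumpData lam i).diagPos r = (![2, 1, 4, 3, 5, 5] : Fin 6 → ℕ) i - r := by
  rw [Attachment.diagPos, pumpData_size, pumpData_start]
  fin_cases i <;> rfl

theorem mem_pumpData_cells (i : Fin 6) (p : ℕ × ℕ) : p ∈ (pumpData lam i).offDiagCells ↔
    p.1 < p.2 ∧ p.1 < (![3, 2, 4, 2, 3, 2] : Fin 6 → ℕ) i ∧
      p.2 < (if i = 2 then lam.1.rowLen p.1 else 0) + (![3, 2, 4, 2, 3, 2] : Fin 6 → ℕ) i := by
  rw [Attachment.mem_offDiagCells, pumpData_size, pumpData_rowLen]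

theorem mem_pumpData_two (p : ℕ × ℕ) : p ∈ (pumpData lam 2).offDiagCells ↔
    p.1 < p.2 ∧ p.1 < 3 ∧ p.2 ≤ p.1 + lam.strict p.1 := by
  rw [mem_pumpData_cells]
  have := lam.rowLen_three
  simp only [Par.strict, if_true]
  change _ ∧ _ < 4 ∧ _ < _ + 4 ↔ _
  rcases eq_or_ne p.1 3 with h | h
  · rw [h, this]; omega
  · omega

/-- Together with `pump_exists_of_shape`, this trades elements of the pump for triples (arm, depth,
height), on which all later conditions are linear arithmetic. -/
theorem pump_mem_shape (x : Pump lam) : PumpShape (lam.strict 0) (lam.strict 1) (lam.strict 2)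
    (pumpColor x).1 (pumpColor x).2 (pumpHeight x) := by
  rcases x with a | ⟨i, p, hp⟩
  · have := a.2
    have h0 : lam.strict 0 = lam.1.rowLen 0 + 3 := rfl
    simp only [pumpColor, pumpHeight, PumpShape, h0, true_and]
    split_ifs <;> omega
  · obtain ⟨r, c⟩ := p
    simp only [pumpColor, pumpHeight, PumpShape, pumpData_diagPos]
    fin_cases i
    on_goal 3 =>
      have hp' := (mem_pumpData_two _).1 hp
      obtain ⟨h₁, h₂, h₃⟩ := hp'
      simp only at h₁ h₂ h₃
      simp [pumpArm]
      interval_cases r <;> omega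
    all_goals
      have hp' := (mem_pumpData_cells _ _).1 hp
      simp at hp'
      simp [pumpArm]
      omega

theorem pump_exists_of_shape {a d : ℕ} {h : ℤ}
    (hs : PumpShape (lam.strict 0) (lam.strict 1) (lam.strict 2) a d h) :
    ∃ x : Pump lam, pumpColor x = (a, d) ∧ pumpHeight x = h := by
  have h0 : lam.strict 0 = lam.1.rowLen 0 + 3 := rfl
  have cell : ∀ (i : Fin 6) (r c : ℕ), (r, c) ∈ (pumpData lam i).offDiagCells →
      ∃ x : Pump lam, pumpColor x = (pumpArm i, c - r) ∧
        pumpHeight x = 2 * ((((![2, 1, 4, 3, 5, 5] : Fin 6 → ℕ) i - r : ℕ)) : ℤ) + 2 - ((c : ℤ) - r) :=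
    fun i r c hm => ⟨.inr ⟨i, (r, c), hm⟩, rfl, by simp only [pumpHeight, pumpData_diagPos]⟩
  have chain : ∀ b : ℕ, b < 6 + (lam.1.rowLen 0 + 3) → ∃ x : Pump lam, pumpColor x = (0, b - 5) ∧
      pumpHeight x = if b < 6 then 2 * (b : ℤ) + 2 else (b : ℤ) + 7 :=
    fun b hb => ⟨.inl ⟨b, hb⟩, rfl, rfl⟩
  rcases hs with ⟨rfl, rfl, hh⟩ | ⟨rfl, h₁, h₂, rfl⟩ | ⟨rfl, h₁, h₂, rfl⟩ | ⟨rfl, h₁, h₂, rfl⟩ |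
    ⟨rfl, h₁, h₂, rfl⟩ | ⟨rfl, rfl, hh⟩ | ⟨rfl, rfl, hh⟩ | ⟨rfl, rfl, hh⟩
  · rcases hh with rfl | rfl | rfl | rfl | rfl | rfl
    · exact chain 0 (by omega)
    · exact chain 1 (by omega)
    · exact chain 2 (by omega)
    · exact chain 3 (by omega)
    · exact chain 4 (by omega)
    · exact chain 5 (by omega)
  · obtain ⟨x, hx, hx'⟩ := chain (d + 5) (by omega)
    refine ⟨x, hx, hx'.trans ?_⟩
    rw [if_neg (by omega)]
    push_cast; ring
  · obtain ⟨x, hx, hx'⟩ := cell 2 0 d ((mem_pumpData_two _).2 (by simp; omega))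
    exact ⟨x, hx, hx'.trans (by simp)⟩
  · obtain ⟨x, hx, hx'⟩ := cell 2 1 (d + 1) ((mem_pumpData_two _).2 (by simp; omega))
    exact ⟨x, hx, hx'.trans (by simp)⟩
  · obtain ⟨x, hx, hx'⟩ := cell 2 2 (d + 2) ((mem_pumpData_two _).2 (by simp; omega))
    exact ⟨x, hx, hx'.trans (by simp)⟩
  · rcases hh with rfl | rfl | rfl
    · exact cell 1 0 1 ((mem_pumpData_cells _ _).2 (by simp))
    · exact cell 3 0 1 ((mem_pumpData_cells _ _).2 (by simp))
    · exact cell 5 0 1 ((mem_pumpData_cells _ _).2 (by simp))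
  · rcases hh with rfl | rfl | rfl | rfl
    · exact cell 0 1 2 ((mem_pumpData_cells _ _).2 (by simp))
    · exact cell 0 0 1 ((mem_pumpData_cells _ _).2 (by simp))
    · exact cell 4 1 2 ((mem_pumpData_cells _ _).2 (by simp))
    · exact cell 4 0 1 ((mem_pumpData_cells _ _).2 (by simp))
  · rcases hh with rfl | rfl
    · exact cell 0 0 2 ((mem_pumpData_cells _ _).2 (by simp))
    · exact cell 4 0 2 ((mem_pumpData_cells _ _).2 (by simp))

theorem AttachedPoset.le_def {n k m : ℕ} {X : Fin k → Attachment n} (x y : AttachedPoset m X) :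
    x ≤ y ↔ AttachedPoset.Le x y := Iff.rfl

-- For a cell of depth d and height h, the diagonal cell of its row has height h + d, and that of
-- its column, if there is one, has height h - d. So passing through the centre costs exactly the
-- distance of the colours. The exception in `PumpLe` concerns column 4 of the attachment of λ:
-- formally it ends at the height 2 of x_1, but there is no diagonal cell in this column.
set_option maxHeartbeats 1600000 in
theorem pump_le_iff (x y : Pump lam) :
    x ≤ y ↔ PumpLe (pumpColor x) (pumpHeight x) (pumpColor y) (pumpHeight y) := by
  have hst := lam.strict_lt
  rw [AttachedPoset.le_def]
  rcases x with a | ⟨i, ⟨r, c⟩, hp⟩ <;> rcases y with b | ⟨j, ⟨r', c'⟩, hq⟩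
  · simp only [AttachedPoset.Le, pumpColor, pumpHeight, PumpLe, Fin.le_def, forall_const, ne_eq,
      not_true_eq_false, false_implies, true_and]
    split_ifs <;> omega
  · simp only [AttachedPoset.Le, pumpColor, pumpHeight, PumpLe, pumpData_diagPos, pumpData_size]
    fin_cases j
    on_goal 3 =>
      have hq' := (mem_pumpData_two _).1 hq
      simp only at hq'
      simp [pumpArm]
      split_ifs <;> omega
    all_goals
      have hq' := (mem_pumpData_cells _ _).1 hq
      simp at hq'
      simp [pumpArm]
      split_ifs <;> omega
  · simp only [AttachedPoset.Le, pumpColor, pumpHeight, PumpLe, pumpData_diagPos]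
    fin_cases i
    on_goal 3 =>
      have hp' := (mem_pumpData_two _).1 hp
      simp only at hp'
      simp [pumpArm]
      split_ifs <;> omega
    all_goals
      have hp' := (mem_pumpData_cells _ _).1 hp
      simp at hp'
      simp [pumpArm]
      split_ifs <;> omega
  · simp only [AttachedPoset.Le, pumpColor, pumpHeight, PumpLe, pumpData_diagPos, pumpData_size]
    by_cases hi : i = 2 <;> by_cases hj : j = 2
    · subst hi hj
      have hp' := (mem_pumpData_two _).1 hp
      have hq' := (mem_pumpData_two _).1 hq
      simp only at hp' hq'
      simp [pumpArm]
      omega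
    · subst hi
      have hp' := (mem_pumpData_two _).1 hp
      simp only at hp'
      have hq' := (mem_pumpData_cells _ _).1 hq
      clear hq hp hst
      fin_cases j <;> simp [pumpArm] at hq' hj ⊢ <;> omega
    · subst hj
      have hp' := (mem_pumpData_cells _ _).1 hp
      have hq' := (mem_pumpData_two _).1 hq
      simp only at hq'
      clear hq hp hst
      fin_cases i <;> simp [pumpArm] at hp' hi ⊢ <;> omega
    · have hp' := (mem_pumpData_cells _ _).1 hp
      have hq' := (mem_pumpData_cells _ _).1 hq
      clear hq hp hst
      fin_cases i <;> simp at hi <;> fin_cases j <;> simp [pumpArm] at hp' hq' hj ⊢ <;> omega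

-- The height is a grading: a step upwards raises it by one and moves to an adjacent colour. So a
-- path to a larger element can be chosen one step at a time.
set_option linter.unusedSimpArgs false in
set_option maxHeartbeats 2000000 in
theorem pumpShape_exists_adj {l₀ l₁ l₂ a d : ℕ} {h : ℤ} {a' d' : ℕ} {h' : ℤ}
    (h₁₀ : l₁ < l₀) (h₂₁ : l₂ < l₁) (h₂ : 1 ≤ l₂)
    (hx : PumpShape l₀ l₁ l₂ a d h) (hy : PumpShape l₀ l₁ l₂ a' d' h')
    (hle : PumpLe (a, d) h (a', d') h') (hne : ¬ (a = a' ∧ d = d' ∧ h = h')) :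
    ∃ a₁ d₁, PumpShape l₀ l₁ l₂ a₁ d₁ (h + 1) ∧ SpiderAdj (a, d) (a₁, d₁) ∧
      PumpLe (a₁, d₁) (h + 1) (a', d') h' := by
  -- At most two elements of height h + 1 have an adjacent colour. If there is only one, it is
  -- entered twice below.
  have key : ∀ a₁ d₁ a₂ d₂, PumpShape l₀ l₁ l₂ a₁ d₁ (h + 1) → SpiderAdj (a, d) (a₁, d₁) →
      PumpShape l₀ l₁ l₂ a₂ d₂ (h + 1) → SpiderAdj (a, d) (a₂, d₂) →
      (PumpLe (a₁, d₁) (h + 1) (a', d') h' ∨ PumpLe (a₂, d₂) (h + 1) (a', d') h') →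
      ∃ a₁ d₁, PumpShape l₀ l₁ l₂ a₁ d₁ (h + 1) ∧ SpiderAdj (a, d) (a₁, d₁) ∧
        PumpLe (a₁, d₁) (h + 1) (a', d') h' := by
    rintro a₁ d₁ a₂ d₂ s₁ t₁ s₂ t₂ (h | h)
    · exact ⟨a₁, d₁, s₁, t₁, h⟩
    · exact ⟨a₂, d₂, s₂, t₂, h⟩
  rcases hx with ⟨rfl, rfl, rfl | rfl | rfl | rfl | rfl | rfl⟩ | ⟨rfl, g₁, g₂, rfl⟩ |
    ⟨rfl, g₁, g₂, rfl⟩ | ⟨rfl, g₁, g₂, rfl⟩ | ⟨rfl, g₁, g₂, rfl⟩ |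
    ⟨rfl, rfl, rfl | rfl | rfl⟩ | ⟨rfl, rfl, rfl | rfl | rfl | rfl⟩ | ⟨rfl, rfl, rfl | rfl⟩
  · apply key 1 1 2 1
    on_goal 5 => rcases hy with ⟨rfl, rfl, hy⟩ | ⟨rfl, hy⟩ | ⟨rfl, hy⟩ | ⟨rfl, hy⟩ | ⟨rfl, hy⟩ |
      ⟨rfl, rfl, hy⟩ | ⟨rfl, rfl, hy⟩ | ⟨rfl, rfl, hy⟩
    all_goals
      simp only [PumpShape, SpiderAdj, PumpLe, true_and, and_true, true_or, or_true, true_implies,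
        ne_eq, not_true_eq_false, false_implies, zero_ne_one, one_ne_zero, OfNat.ofNat_ne_zero,
        OfNat.zero_ne_ofNat, OfNat.ofNat_ne_one, OfNat.one_ne_ofNat, false_and, and_false, false_or,
        or_false, not_false_eq_true] at hle hne ⊢ <;> omega
  · apply key 0 1 2 1
    on_goal 5 => rcases hy with ⟨rfl, rfl, hy⟩ | ⟨rfl, hy⟩ | ⟨rfl, hy⟩ | ⟨rfl, hy⟩ | ⟨rfl, hy⟩ |
      ⟨rfl, rfl, hy⟩ | ⟨rfl, rfl, hy⟩ | ⟨rfl, rfl, hy⟩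
    all_goals
      simp only [PumpShape, SpiderAdj, PumpLe, true_and, and_true, true_or, or_true, true_implies,
        ne_eq, not_true_eq_false, false_implies, zero_ne_one, one_ne_zero, OfNat.ofNat_ne_zero,
        OfNat.zero_ne_ofNat, OfNat.ofNat_ne_one, OfNat.one_ne_ofNat, false_and, and_false, false_or,
        or_false, not_false_eq_true] at hle hne ⊢ <;> omega
  · apply key 1 1 0 1
    on_goal 5 => rcases hy with ⟨rfl, rfl, hy⟩ | ⟨rfl, hy⟩ | ⟨rfl, hy⟩ | ⟨rfl, hy⟩ | ⟨rfl, hy⟩ |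
      ⟨rfl, rfl, hy⟩ | ⟨rfl, rfl, hy⟩ | ⟨rfl, rfl, hy⟩
    all_goals
      simp only [PumpShape, SpiderAdj, PumpLe, true_and, and_true, true_or, or_true, true_implies,
        ne_eq, not_true_eq_false, false_implies, zero_ne_one, one_ne_zero, OfNat.ofNat_ne_zero,
        OfNat.zero_ne_ofNat, OfNat.ofNat_ne_one, OfNat.one_ne_ofNat, false_and, and_false, false_or,
        or_false, not_false_eq_true] at hle hne ⊢ <;> omega
  · apply key 0 1 2 1
    on_goal 5 => rcases hy with ⟨rfl, rfl, hy⟩ | ⟨rfl, hy⟩ | ⟨rfl, hy⟩ | ⟨rfl, hy⟩ | ⟨rfl, hy⟩ |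
      ⟨rfl, rfl, hy⟩ | ⟨rfl, rfl, hy⟩ | ⟨rfl, rfl, hy⟩
    all_goals
      simp only [PumpShape, SpiderAdj, PumpLe, true_and, and_true, true_or, or_true, true_implies,
        ne_eq, not_true_eq_false, false_implies, zero_ne_one, one_ne_zero, OfNat.ofNat_ne_zero,
        OfNat.zero_ne_ofNat, OfNat.ofNat_ne_one, OfNat.one_ne_ofNat, false_and, and_false, false_or,
        or_false, not_false_eq_true] at hle hne ⊢ <;> omega
  · apply key 1 1 2 1
    on_goal 5 => rcases hy with ⟨rfl, rfl, hy⟩ | ⟨rfl, hy⟩ | ⟨rfl, hy⟩ | ⟨rfl, hy⟩ | ⟨rfl, hy⟩ |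
      ⟨rfl, rfl, hy⟩ | ⟨rfl, rfl, hy⟩ | ⟨rfl, rfl, hy⟩
    all_goals
      simp only [PumpShape, SpiderAdj, PumpLe, true_and, and_true, true_or, or_true, true_implies,
        ne_eq, not_true_eq_false, false_implies, zero_ne_one, one_ne_zero, OfNat.ofNat_ne_zero,
        OfNat.zero_ne_ofNat, OfNat.ofNat_ne_one, OfNat.one_ne_ofNat, false_and, and_false, false_or,
        or_false, not_false_eq_true] at hle hne ⊢ <;> omega
  · apply key 0 1 0 1
    on_goal 5 => rcases hy with ⟨rfl, rfl, hy⟩ | ⟨rfl, hy⟩ | ⟨rfl, hy⟩ | ⟨rfl, hy⟩ | ⟨rfl, hy⟩ |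
      ⟨rfl, rfl, hy⟩ | ⟨rfl, rfl, hy⟩ | ⟨rfl, rfl, hy⟩
    all_goals
      simp only [PumpShape, SpiderAdj, PumpLe, true_and, and_true, true_or, or_true, true_implies,
        ne_eq, not_true_eq_false, false_implies, zero_ne_one, one_ne_zero, OfNat.ofNat_ne_zero,
        OfNat.zero_ne_ofNat, OfNat.ofNat_ne_one, OfNat.one_ne_ofNat, false_and, and_false, false_or,
        or_false, not_false_eq_true] at hle hne ⊢ <;> omega
  -- The topmost element of the chain has nothing above it.
  · have hd : d + 1 ≤ l₀ := by
      rcases hy with ⟨rfl, rfl, hy⟩ | ⟨rfl, hy⟩ | ⟨rfl, hy⟩ | ⟨rfl, hy⟩ | ⟨rfl, hy⟩ |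
        ⟨rfl, rfl, hy⟩ | ⟨rfl, rfl, hy⟩ | ⟨rfl, rfl, hy⟩
      all_goals simp only [PumpLe, true_and, and_true, true_or, or_true, true_implies, ne_eq, not_true_eq_false,
        false_implies] at hle hne <;> omega
    apply key 0 (d + 1) 0 (d + 1)
    on_goal 5 => rcases hy with ⟨rfl, rfl, hy⟩ | ⟨rfl, hy⟩ | ⟨rfl, hy⟩ | ⟨rfl, hy⟩ | ⟨rfl, hy⟩ |
      ⟨rfl, rfl, hy⟩ | ⟨rfl, rfl, hy⟩ | ⟨rfl, rfl, hy⟩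
    all_goals
      simp only [PumpShape, SpiderAdj, PumpLe, true_and, and_true, true_or, or_true, true_implies,
        ne_eq, not_true_eq_false, false_implies, zero_ne_one, one_ne_zero, OfNat.ofNat_ne_zero,
        OfNat.zero_ne_ofNat, OfNat.ofNat_ne_one, OfNat.one_ne_ofNat, false_and, and_false, false_or,
        or_false, not_false_eq_true] at hle hne ⊢ <;> omega
  · apply key 0 (d - 1) 0 (d - 1)
    on_goal 5 => rcases hy with ⟨rfl, rfl, hy⟩ | ⟨rfl, hy⟩ | ⟨rfl, hy⟩ | ⟨rfl, hy⟩ | ⟨rfl, hy⟩ |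
      ⟨rfl, rfl, hy⟩ | ⟨rfl, rfl, hy⟩ | ⟨rfl, rfl, hy⟩
    all_goals
      simp only [PumpShape, SpiderAdj, PumpLe, true_and, and_true, true_or, or_true, true_implies,
        ne_eq, not_true_eq_false, false_implies, zero_ne_one, one_ne_zero, OfNat.ofNat_ne_zero,
        OfNat.zero_ne_ofNat, OfNat.ofNat_ne_one, OfNat.one_ne_ofNat, false_and, and_false, false_or,
        or_false, not_false_eq_true] at hle hne ⊢ <;> omega
  · apply key 0 (d - 1) 0 (d + 1)
    on_goal 5 => rcases hy with ⟨rfl, rfl, hy⟩ | ⟨rfl, hy⟩ | ⟨rfl, hy⟩ | ⟨rfl, hy⟩ | ⟨rfl, hy⟩ |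
      ⟨rfl, rfl, hy⟩ | ⟨rfl, rfl, hy⟩ | ⟨rfl, rfl, hy⟩
    all_goals
      simp only [PumpShape, SpiderAdj, PumpLe, true_and, and_true, true_or, or_true, true_implies,
        ne_eq, not_true_eq_false, false_implies, zero_ne_one, one_ne_zero, OfNat.ofNat_ne_zero,
        OfNat.zero_ne_ofNat, OfNat.ofNat_ne_one, OfNat.one_ne_ofNat, false_and, and_false, false_or,
        or_false, not_false_eq_true] at hle hne ⊢ <;> omega
  · apply key 0 (d - 1) 0 (d + 1)
    on_goal 5 => rcases hy with ⟨rfl, rfl, hy⟩ | ⟨rfl, hy⟩ | ⟨rfl, hy⟩ | ⟨rfl, hy⟩ | ⟨rfl, hy⟩ |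
      ⟨rfl, rfl, hy⟩ | ⟨rfl, rfl, hy⟩ | ⟨rfl, rfl, hy⟩
    all_goals
      simp only [PumpShape, SpiderAdj, PumpLe, true_and, and_true, true_or, or_true, true_implies,
        ne_eq, not_true_eq_false, false_implies, zero_ne_one, one_ne_zero, OfNat.ofNat_ne_zero,
        OfNat.zero_ne_ofNat, OfNat.ofNat_ne_one, OfNat.one_ne_ofNat, false_and, and_false, false_or,
        or_false, not_false_eq_true] at hle hne ⊢ <;> omega
  · apply key 0 0 0 0
    on_goal 5 => rcases hy with ⟨rfl, rfl, hy⟩ | ⟨rfl, hy⟩ | ⟨rfl, hy⟩ | ⟨rfl, hy⟩ | ⟨rfl, hy⟩ |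
      ⟨rfl, rfl, hy⟩ | ⟨rfl, rfl, hy⟩ | ⟨rfl, rfl, hy⟩
    all_goals
      simp only [PumpShape, SpiderAdj, PumpLe, true_and, and_true, true_or, or_true, true_implies,
        ne_eq, not_true_eq_false, false_implies, zero_ne_one, one_ne_zero, OfNat.ofNat_ne_zero,
        OfNat.zero_ne_ofNat, OfNat.ofNat_ne_one, OfNat.one_ne_ofNat, false_and, and_false, false_or,
        or_false, not_false_eq_true] at hle hne ⊢ <;> omega
  · apply key 0 0 0 0
    on_goal 5 => rcases hy with ⟨rfl, rfl, hy⟩ | ⟨rfl, hy⟩ | ⟨rfl, hy⟩ | ⟨rfl, hy⟩ | ⟨rfl, hy⟩ |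
      ⟨rfl, rfl, hy⟩ | ⟨rfl, rfl, hy⟩ | ⟨rfl, rfl, hy⟩
    all_goals
      simp only [PumpShape, SpiderAdj, PumpLe, true_and, and_true, true_or, or_true, true_implies,
        ne_eq, not_true_eq_false, false_implies, zero_ne_one, one_ne_zero, OfNat.ofNat_ne_zero,
        OfNat.zero_ne_ofNat, OfNat.ofNat_ne_one, OfNat.one_ne_ofNat, false_and, and_false, false_or,
        or_false, not_false_eq_true] at hle hne ⊢ <;> omega
  · apply key 0 0 0 0
    on_goal 5 => rcases hy with ⟨rfl, rfl, hy⟩ | ⟨rfl, hy⟩ | ⟨rfl, hy⟩ | ⟨rfl, hy⟩ | ⟨rfl, hy⟩ |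
      ⟨rfl, rfl, hy⟩ | ⟨rfl, rfl, hy⟩ | ⟨rfl, rfl, hy⟩
    all_goals
      simp only [PumpShape, SpiderAdj, PumpLe, true_and, and_true, true_or, or_true, true_implies,
        ne_eq, not_true_eq_false, false_implies, zero_ne_one, one_ne_zero, OfNat.ofNat_ne_zero,
        OfNat.zero_ne_ofNat, OfNat.ofNat_ne_one, OfNat.one_ne_ofNat, false_and, and_false, false_or,
        or_false, not_false_eq_true] at hle hne ⊢ <;> omega
  · apply key 0 0 2 2
    on_goal 5 => rcases hy with ⟨rfl, rfl, hy⟩ | ⟨rfl, hy⟩ | ⟨rfl, hy⟩ | ⟨rfl, hy⟩ | ⟨rfl, hy⟩ |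
      ⟨rfl, rfl, hy⟩ | ⟨rfl, rfl, hy⟩ | ⟨rfl, rfl, hy⟩
    all_goals
      simp only [PumpShape, SpiderAdj, PumpLe, true_and, and_true, true_or, or_true, true_implies,
        ne_eq, not_true_eq_false, false_implies, zero_ne_one, one_ne_zero, OfNat.ofNat_ne_zero,
        OfNat.zero_ne_ofNat, OfNat.ofNat_ne_one, OfNat.one_ne_ofNat, false_and, and_false, false_or,
        or_false, not_false_eq_true] at hle hne ⊢ <;> omega
  · apply key 0 0 0 0
    on_goal 5 => rcases hy with ⟨rfl, rfl, hy⟩ | ⟨rfl, hy⟩ | ⟨rfl, hy⟩ | ⟨rfl, hy⟩ | ⟨rfl, hy⟩ |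
      ⟨rfl, rfl, hy⟩ | ⟨rfl, rfl, hy⟩ | ⟨rfl, rfl, hy⟩
    all_goals
      simp only [PumpShape, SpiderAdj, PumpLe, true_and, and_true, true_or, or_true, true_implies,
        ne_eq, not_true_eq_false, false_implies, zero_ne_one, one_ne_zero, OfNat.ofNat_ne_zero,
        OfNat.zero_ne_ofNat, OfNat.ofNat_ne_one, OfNat.one_ne_ofNat, false_and, and_false, false_or,
        or_false, not_false_eq_true] at hle hne ⊢ <;> omega
  · apply key 0 0 2 2
    on_goal 5 => rcases hy with ⟨rfl, rfl, hy⟩ | ⟨rfl, hy⟩ | ⟨rfl, hy⟩ | ⟨rfl, hy⟩ | ⟨rfl, hy⟩ |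
      ⟨rfl, rfl, hy⟩ | ⟨rfl, rfl, hy⟩ | ⟨rfl, rfl, hy⟩
    all_goals
      simp only [PumpShape, SpiderAdj, PumpLe, true_and, and_true, true_or, or_true, true_implies,
        ne_eq, not_true_eq_false, false_implies, zero_ne_one, one_ne_zero, OfNat.ofNat_ne_zero,
        OfNat.zero_ne_ofNat, OfNat.ofNat_ne_one, OfNat.one_ne_ofNat, false_and, and_false, false_or,
        or_false, not_false_eq_true] at hle hne ⊢ <;> omega
  · apply key 0 0 0 0
    on_goal 5 => rcases hy with ⟨rfl, rfl, hy⟩ | ⟨rfl, hy⟩ | ⟨rfl, hy⟩ | ⟨rfl, hy⟩ | ⟨rfl, hy⟩ |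
      ⟨rfl, rfl, hy⟩ | ⟨rfl, rfl, hy⟩ | ⟨rfl, rfl, hy⟩
    all_goals
      simp only [PumpShape, SpiderAdj, PumpLe, true_and, and_true, true_or, or_true, true_implies,
        ne_eq, not_true_eq_false, false_implies, zero_ne_one, one_ne_zero, OfNat.ofNat_ne_zero,
        OfNat.zero_ne_ofNat, OfNat.ofNat_ne_one, OfNat.one_ne_ofNat, false_and, and_false, false_or,
        or_false, not_false_eq_true] at hle hne ⊢ <;> omega
  · apply key 2 1 2 1
    on_goal 5 => rcases hy with ⟨rfl, rfl, hy⟩ | ⟨rfl, hy⟩ | ⟨rfl, hy⟩ | ⟨rfl, hy⟩ | ⟨rfl, hy⟩ |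
      ⟨rfl, rfl, hy⟩ | ⟨rfl, rfl, hy⟩ | ⟨rfl, rfl, hy⟩
    all_goals
      simp only [PumpShape, SpiderAdj, PumpLe, true_and, and_true, true_or, or_true, true_implies,
        ne_eq, not_true_eq_false, false_implies, zero_ne_one, one_ne_zero, OfNat.ofNat_ne_zero,
        OfNat.zero_ne_ofNat, OfNat.ofNat_ne_one, OfNat.one_ne_ofNat, false_and, and_false, false_or,
        or_false, not_false_eq_true] at hle hne ⊢ <;> omega
  · apply key 2 1 2 1
    on_goal 5 => rcases hy with ⟨rfl, rfl, hy⟩ | ⟨rfl, hy⟩ | ⟨rfl, hy⟩ | ⟨rfl, hy⟩ | ⟨rfl, hy⟩ |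
      ⟨rfl, rfl, hy⟩ | ⟨rfl, rfl, hy⟩ | ⟨rfl, rfl, hy⟩
    all_goals
      simp only [PumpShape, SpiderAdj, PumpLe, true_and, and_true, true_or, or_true, true_implies,
        ne_eq, not_true_eq_false, false_implies, zero_ne_one, one_ne_zero, OfNat.ofNat_ne_zero,
        OfNat.zero_ne_ofNat, OfNat.ofNat_ne_one, OfNat.one_ne_ofNat, false_and, and_false, false_or,
        or_false, not_false_eq_true] at hle hne ⊢ <;> omega

-- The two neighbours between consecutive elements of one colour are either of one colour at
-- different heights, or of different colours at one height. The function `F` stands for the hook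
-- lengths, so that the same case analysis also delivers their local relation; `F0` to `F3` supply
-- this relation for each pair.
set_option linter.unusedSimpArgs false in
set_option maxHeartbeats 2000000 in
theorem pumpShape_neighbors {l₀ l₁ l₂ a d : ℕ} {h h' : ℤ}
    (h₁₀ : l₁ < l₀) (h₂₁ : l₂ < l₁) (h₂ : 1 ≤ l₂) {F : ℕ → ℕ → ℤ → ℕ}
    (F0 : F 0 0 4 + F 0 0 2 = F 1 1 3 + F 2 1 3 ∧ F 0 0 6 + F 0 0 4 = F 0 1 5 + F 2 1 5 ∧
      F 0 0 8 + F 0 0 6 = F 1 1 7 + F 0 1 7 ∧ F 0 0 10 + F 0 0 8 = F 0 1 9 + F 2 1 9 ∧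
      F 0 0 12 + F 0 0 10 = F 1 1 11 + F 2 1 11 ∧ F 1 1 7 + F 1 1 3 = F 0 0 4 + F 0 0 6 ∧
      F 1 1 11 + F 1 1 7 = F 0 0 8 + F 0 0 10 ∧ F 2 1 5 + F 2 1 3 = F 0 0 4 + F 2 2 4 ∧
      F 2 1 9 + F 2 1 5 = F 0 0 6 + F 0 0 8 ∧ F 2 1 11 + F 2 1 9 = F 0 0 10 + F 2 2 10 ∧
      F 2 2 10 + F 2 2 4 = F 2 1 5 + F 2 1 9)
    (F1 : ∀ d : ℕ, 1 ≤ d → d ≤ l₀ →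
      F 0 d (12 + d) + F 0 d (10 - d) = F 0 (d - 1) (11 - d) + F 0 (d - 1) (11 + d))
    (F2 : ∀ d : ℕ, 1 ≤ d → d ≤ l₁ →
      F 0 d (10 - d) + F 0 d (8 - d) = F 0 (d - 1) (9 - d) + F 0 (d + 1) (9 - d))
    (F3 : ∀ d : ℕ, 1 ≤ d → d ≤ l₂ →
      F 0 d (8 - d) + F 0 d (6 - d) = F 0 (d - 1) (7 - d) + F 0 (d + 1) (7 - d))
    (hw : PumpShape l₀ l₁ l₂ a d h) (hz : PumpShape l₀ l₁ l₂ a d h') (hlt : h < h')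
    (hcs : ∀ t, PumpShape l₀ l₁ l₂ a d t → h < t → t < h' → False) :
    ∃ a₁ d₁ h₁ a₂ d₂ h₂, PumpShape l₀ l₁ l₂ a₁ d₁ h₁ ∧ PumpShape l₀ l₁ l₂ a₂ d₂ h₂ ∧
      SpiderAdj (a, d) (a₁, d₁) ∧ SpiderAdj (a, d) (a₂, d₂) ∧ h < h₁ ∧ h₁ < h' ∧ h < h₂ ∧ h₂ < h' ∧
      F a d h' + F a d h = F a₁ d₁ h₁ + F a₂ d₂ h₂ ∧
      ((a₁ = a₂ ∧ d₁ = d₂ ∧ h₁ ≠ h₂) ∨ (¬ (a₁ = a₂ ∧ d₁ = d₂) ∧ h₁ = h₂)) ∧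
      ∀ a₃ d₃ h₃, PumpShape l₀ l₁ l₂ a₃ d₃ h₃ → SpiderAdj (a, d) (a₃, d₃) → h < h₃ → h₃ < h' →
        (a₃ = a₁ ∧ d₃ = d₁ ∧ h₃ = h₁) ∨ (a₃ = a₂ ∧ d₃ = d₂ ∧ h₃ = h₂) := by
  -- In each case `k` is the next height at which the colour occurs, which forces h' = k.
  have fin : ∀ k a₁ d₁ h₁ a₂ d₂ h₂, PumpShape l₀ l₁ l₂ a d k → h < k →
      (∀ t, PumpShape l₀ l₁ l₂ a d t → h < t → k ≤ t) →
      PumpShape l₀ l₁ l₂ a₁ d₁ h₁ → PumpShape l₀ l₁ l₂ a₂ d₂ h₂ →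
      SpiderAdj (a, d) (a₁, d₁) → SpiderAdj (a, d) (a₂, d₂) →
      (h < h₁ ∧ h₁ < k ∧ h < h₂ ∧ h₂ < k) →
      ((a₁ = a₂ ∧ d₁ = d₂ ∧ h₁ ≠ h₂) ∨ (¬ (a₁ = a₂ ∧ d₁ = d₂) ∧ h₁ = h₂)) →
      F a d k + F a d h = F a₁ d₁ h₁ + F a₂ d₂ h₂ →
      (∀ a₃ d₃ h₃, PumpShape l₀ l₁ l₂ a₃ d₃ h₃ → SpiderAdj (a, d) (a₃, d₃) → h < h₃ → h₃ < k →
        (a₃ = a₁ ∧ d₃ = d₁ ∧ h₃ = h₁) ∨ (a₃ = a₂ ∧ d₃ = d₂ ∧ h₃ = h₂)) →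
      ∃ a₁ d₁ h₁ a₂ d₂ h₂, PumpShape l₀ l₁ l₂ a₁ d₁ h₁ ∧ PumpShape l₀ l₁ l₂ a₂ d₂ h₂ ∧
      SpiderAdj (a, d) (a₁, d₁) ∧ SpiderAdj (a, d) (a₂, d₂) ∧ h < h₁ ∧ h₁ < h' ∧ h < h₂ ∧ h₂ < h' ∧
      F a d h' + F a d h = F a₁ d₁ h₁ + F a₂ d₂ h₂ ∧
      ((a₁ = a₂ ∧ d₁ = d₂ ∧ h₁ ≠ h₂) ∨ (¬ (a₁ = a₂ ∧ d₁ = d₂) ∧ h₁ = h₂)) ∧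
      ∀ a₃ d₃ h₃, PumpShape l₀ l₁ l₂ a₃ d₃ h₃ → SpiderAdj (a, d) (a₃, d₃) → h < h₃ → h₃ < h' →
        (a₃ = a₁ ∧ d₃ = d₁ ∧ h₃ = h₁) ∨ (a₃ = a₂ ∧ d₃ = d₂ ∧ h₃ = h₂) := by
    intro k a₁ d₁ h₁ a₂ d₂ h₂ sk hk hmin s₁ s₂ t₁ t₂ hb hne hF hall
    obtain rfl : h' = k := le_antisymm (not_lt.1 fun h => hcs k sk hk h) (hmin h' hz hlt)
    exact ⟨a₁, d₁, h₁, a₂, d₂, h₂, s₁, s₂, t₁, t₂, hb.1, hb.2.1, hb.2.2.1, hb.2.2.2, hF, hne, hall⟩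
  clear hcs
  rcases hw with ⟨rfl, rfl, rfl | rfl | rfl | rfl | rfl | rfl⟩ | ⟨rfl, g₁, g₂, rfl⟩ |
    ⟨rfl, g₁, g₂, rfl⟩ | ⟨rfl, g₁, g₂, rfl⟩ | ⟨rfl, g₁, g₂, rfl⟩ |
    ⟨rfl, rfl, rfl | rfl | rfl⟩ | ⟨rfl, rfl, rfl | rfl | rfl | rfl⟩ | ⟨rfl, rfl, rfl | rfl⟩
  · apply fin 4 1 1 3 2 1 3
    on_goal 11 => rintro a₃ d₃ h₃ (⟨rfl, rfl, s⟩ | ⟨rfl, s⟩ | ⟨rfl, s⟩ | ⟨rfl, s⟩ | ⟨rfl, s⟩ |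
      ⟨rfl, rfl, s⟩ | ⟨rfl, rfl, s⟩ | ⟨rfl, rfl, s⟩)
    on_goal 10 => exact F0.1
    all_goals
      clear F0 F1 F2 F3 fin hz hlt
      intros
      (try simp only [PumpShape, SpiderAdj, true_and, and_true, true_or, or_true, true_implies,
        ne_eq, not_true_eq_false, false_implies] at *) <;> omega
  · apply fin 6 0 1 5 2 1 5
    on_goal 11 => rintro a₃ d₃ h₃ (⟨rfl, rfl, s⟩ | ⟨rfl, s⟩ | ⟨rfl, s⟩ | ⟨rfl, s⟩ | ⟨rfl, s⟩ |
      ⟨rfl, rfl, s⟩ | ⟨rfl, rfl, s⟩ | ⟨rfl, rfl, s⟩)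
    on_goal 10 => exact F0.2.1
    all_goals
      clear F0 F1 F2 F3 fin hz hlt
      intros
      (try simp only [PumpShape, SpiderAdj, true_and, and_true, true_or, or_true, true_implies,
        ne_eq, not_true_eq_false, false_implies] at *) <;> omega
  · apply fin 8 1 1 7 0 1 7
    on_goal 11 => rintro a₃ d₃ h₃ (⟨rfl, rfl, s⟩ | ⟨rfl, s⟩ | ⟨rfl, s⟩ | ⟨rfl, s⟩ | ⟨rfl, s⟩ |
      ⟨rfl, rfl, s⟩ | ⟨rfl, rfl, s⟩ | ⟨rfl, rfl, s⟩)
    on_goal 10 => exact F0.2.2.1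
    all_goals
      clear F0 F1 F2 F3 fin hz hlt
      intros
      (try simp only [PumpShape, SpiderAdj, true_and, and_true, true_or, or_true, true_implies,
        ne_eq, not_true_eq_false, false_implies] at *) <;> omega
  · apply fin 10 0 1 9 2 1 9
    on_goal 11 => rintro a₃ d₃ h₃ (⟨rfl, rfl, s⟩ | ⟨rfl, s⟩ | ⟨rfl, s⟩ | ⟨rfl, s⟩ | ⟨rfl, s⟩ |
      ⟨rfl, rfl, s⟩ | ⟨rfl, rfl, s⟩ | ⟨rfl, rfl, s⟩)
    on_goal 10 => exact F0.2.2.2.1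
    all_goals
      clear F0 F1 F2 F3 fin hz hlt
      intros
      (try simp only [PumpShape, SpiderAdj, true_and, and_true, true_or, or_true, true_implies,
        ne_eq, not_true_eq_false, false_implies] at *) <;> omega
  · apply fin 12 1 1 11 2 1 11
    on_goal 11 => rintro a₃ d₃ h₃ (⟨rfl, rfl, s⟩ | ⟨rfl, s⟩ | ⟨rfl, s⟩ | ⟨rfl, s⟩ | ⟨rfl, s⟩ |
      ⟨rfl, rfl, s⟩ | ⟨rfl, rfl, s⟩ | ⟨rfl, rfl, s⟩)
    on_goal 10 => exact F0.2.2.2.2.1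
    all_goals
      clear F0 F1 F2 F3 fin hz hlt
      intros
      (try simp only [PumpShape, SpiderAdj, true_and, and_true, true_or, or_true, true_implies,
        ne_eq, not_true_eq_false, false_implies] at *) <;> omega
  · simp only [PumpShape, true_and, and_true, true_or, or_true, true_implies, ne_eq, not_true_eq_false,
        false_implies] at hz
    omega
  · simp only [PumpShape, true_and, and_true, true_or, or_true, true_implies, ne_eq, not_true_eq_false,
        false_implies] at hz
    omega
  · apply fin (12 + d) 0 (d - 1) (11 - d) 0 (d - 1) (11 + d)
    on_goal 11 => rintro a₃ d₃ h₃ (⟨rfl, rfl, s⟩ | ⟨rfl, s⟩ | ⟨rfl, s⟩ | ⟨rfl, s⟩ | ⟨rfl, s⟩ |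
      ⟨rfl, rfl, s⟩ | ⟨rfl, rfl, s⟩ | ⟨rfl, rfl, s⟩)
    on_goal 10 => exact F1 d g₁ g₂
    all_goals
      clear F0 F1 F2 F3 fin hz hlt
      intros
      (try simp only [PumpShape, SpiderAdj, true_and, and_true, true_or, or_true, true_implies,
        ne_eq, not_true_eq_false, false_implies] at *) <;> omega
  · apply fin (10 - d) 0 (d - 1) (9 - d) 0 (d + 1) (9 - d)
    on_goal 11 => rintro a₃ d₃ h₃ (⟨rfl, rfl, s⟩ | ⟨rfl, s⟩ | ⟨rfl, s⟩ | ⟨rfl, s⟩ | ⟨rfl, s⟩ |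
      ⟨rfl, rfl, s⟩ | ⟨rfl, rfl, s⟩ | ⟨rfl, rfl, s⟩)
    on_goal 10 => exact F2 d g₁ g₂
    all_goals
      clear F0 F1 F2 F3 fin hz hlt
      intros
      (try simp only [PumpShape, SpiderAdj, true_and, and_true, true_or, or_true, true_implies,
        ne_eq, not_true_eq_false, false_implies] at *) <;> omega
  · apply fin (8 - d) 0 (d - 1) (7 - d) 0 (d + 1) (7 - d)
    on_goal 11 => rintro a₃ d₃ h₃ (⟨rfl, rfl, s⟩ | ⟨rfl, s⟩ | ⟨rfl, s⟩ | ⟨rfl, s⟩ | ⟨rfl, s⟩ |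
      ⟨rfl, rfl, s⟩ | ⟨rfl, rfl, s⟩ | ⟨rfl, rfl, s⟩)
    on_goal 10 => exact F3 d g₁ g₂
    all_goals
      clear F0 F1 F2 F3 fin hz hlt
      intros
      (try simp only [PumpShape, SpiderAdj, true_and, and_true, true_or, or_true, true_implies,
        ne_eq, not_true_eq_false, false_implies] at *) <;> omega
  · apply fin 7 0 0 4 0 0 6
    on_goal 11 => rintro a₃ d₃ h₃ (⟨rfl, rfl, s⟩ | ⟨rfl, s⟩ | ⟨rfl, s⟩ | ⟨rfl, s⟩ | ⟨rfl, s⟩ |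
      ⟨rfl, rfl, s⟩ | ⟨rfl, rfl, s⟩ | ⟨rfl, rfl, s⟩)
    on_goal 10 => exact F0.2.2.2.2.2.1
    all_goals
      clear F0 F1 F2 F3 fin hz hlt
      intros
      (try simp only [PumpShape, SpiderAdj, true_and, and_true, true_or, or_true, true_implies,
        ne_eq, not_true_eq_false, false_implies] at *) <;> omega
  · apply fin 11 0 0 8 0 0 10
    on_goal 11 => rintro a₃ d₃ h₃ (⟨rfl, rfl, s⟩ | ⟨rfl, s⟩ | ⟨rfl, s⟩ | ⟨rfl, s⟩ | ⟨rfl, s⟩ |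
      ⟨rfl, rfl, s⟩ | ⟨rfl, rfl, s⟩ | ⟨rfl, rfl, s⟩)
    on_goal 10 => exact F0.2.2.2.2.2.2.1
    all_goals
      clear F0 F1 F2 F3 fin hz hlt
      intros
      (try simp only [PumpShape, SpiderAdj, true_and, and_true, true_or, or_true, true_implies,
        ne_eq, not_true_eq_false, false_implies] at *) <;> omega
  · simp only [PumpShape, true_and, and_true, true_or, or_true, true_implies, ne_eq, not_true_eq_false,
        false_implies] at hz
    omega
  · apply fin 5 0 0 4 2 2 4
    on_goal 11 => rintro a₃ d₃ h₃ (⟨rfl, rfl, s⟩ | ⟨rfl, s⟩ | ⟨rfl, s⟩ | ⟨rfl, s⟩ | ⟨rfl, s⟩ |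
      ⟨rfl, rfl, s⟩ | ⟨rfl, rfl, s⟩ | ⟨rfl, rfl, s⟩)
    on_goal 10 => exact F0.2.2.2.2.2.2.2.1
    all_goals
      clear F0 F1 F2 F3 fin hz hlt
      intros
      (try simp only [PumpShape, SpiderAdj, true_and, and_true, true_or, or_true, true_implies,
        ne_eq, not_true_eq_false, false_implies] at *) <;> omega
  · apply fin 9 0 0 6 0 0 8
    on_goal 11 => rintro a₃ d₃ h₃ (⟨rfl, rfl, s⟩ | ⟨rfl, s⟩ | ⟨rfl, s⟩ | ⟨rfl, s⟩ | ⟨rfl, s⟩ |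
      ⟨rfl, rfl, s⟩ | ⟨rfl, rfl, s⟩ | ⟨rfl, rfl, s⟩)
    on_goal 10 => exact F0.2.2.2.2.2.2.2.2.1
    all_goals
      clear F0 F1 F2 F3 fin hz hlt
      intros
      (try simp only [PumpShape, SpiderAdj, true_and, and_true, true_or, or_true, true_implies,
        ne_eq, not_true_eq_false, false_implies] at *) <;> omega
  · apply fin 11 0 0 10 2 2 10
    on_goal 11 => rintro a₃ d₃ h₃ (⟨rfl, rfl, s⟩ | ⟨rfl, s⟩ | ⟨rfl, s⟩ | ⟨rfl, s⟩ | ⟨rfl, s⟩ |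
      ⟨rfl, rfl, s⟩ | ⟨rfl, rfl, s⟩ | ⟨rfl, rfl, s⟩)
    on_goal 10 => exact F0.2.2.2.2.2.2.2.2.2.1
    all_goals
      clear F0 F1 F2 F3 fin hz hlt
      intros
      (try simp only [PumpShape, SpiderAdj, true_and, and_true, true_or, or_true, true_implies,
        ne_eq, not_true_eq_false, false_implies] at *) <;> omega
  · simp only [PumpShape, true_and, and_true, true_or, or_true, true_implies, ne_eq, not_true_eq_false,
        false_implies] at hz
    omega
  · apply fin 10 2 1 5 2 1 9
    on_goal 11 => rintro a₃ d₃ h₃ (⟨rfl, rfl, s⟩ | ⟨rfl, s⟩ | ⟨rfl, s⟩ | ⟨rfl, s⟩ | ⟨rfl, s⟩ |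
      ⟨rfl, rfl, s⟩ | ⟨rfl, rfl, s⟩ | ⟨rfl, rfl, s⟩)
    on_goal 10 => exact F0.2.2.2.2.2.2.2.2.2.2
    all_goals
      clear F0 F1 F2 F3 fin hz hlt
      intros
      (try simp only [PumpShape, SpiderAdj, true_and, and_true, true_or, or_true, true_implies,
        ne_eq, not_true_eq_false, false_implies] at *) <;> omega
  · simp only [PumpShape, true_and, and_true, true_or, or_true, true_implies, ne_eq, not_true_eq_false,
        false_implies] at hz
    omega


/-! ### Explicit hook lengths of the pump -/

/-- The hook length of the cell `(r, c)` of the shifted diagram of `λ + (4, 3, 2, 1)` in the pump. -/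
def cellHook (lam : Par 3) (r c : ℕ) : ℕ :=
  if c ≤ 3 then lam.strict r + 7 - c else lam.strict r + lam.1.colLen (c - 4) - c

/-- The hook length of the element of the pump with colour `(a, d)` and height `h`. -/
def pumpHookAt (lam : Par 3) (a d : ℕ) (h : ℤ) : ℕ :=
  if d = 0 then
    if h = 2 then 1 else if h = 4 then 3 else if h = 6 then 5 + lam.strict 2
    else if h = 8 then 6 + lam.strict 1 else if h = 10 then 7 + lam.strict 0 + lam.strict 2
    else 8 + lam.strict 0 + lam.strict 1
  else if a = 0 then
    if h = 12 + d then 15 + 2 * lam.strict 0 + lam.strict 1 + lam.strict 2 - cellHook lam 0 d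
    else if h = 10 - d then cellHook lam 0 d else if h = 8 - d then cellHook lam 1 (d + 1)
    else cellHook lam 2 (d + 2)
  else if a = 1 then
    if h = 3 then 2 else if h = 7 then 6 + lam.strict 2 else 7 + lam.strict 0 + lam.strict 1
  else if d = 1 then
    if h = 3 then 2 else if h = 5 then 4 else if h = 9 then 7 + lam.strict 1 + lam.strict 2
    else 8 + lam.strict 0 + lam.strict 2
  else if h = 4 then 3 else 8 + lam.strict 1 + lam.strict 2

/-- From column 4 on, the columns of the shifted diagram are those of λ, moved by 4. -/
theorem Par.lt_colLen_iff (lam : Par 3) {r c : ℕ} (hr : r < 3) (hc : 4 ≤ c) :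
    r < lam.1.colLen (c - 4) ↔ c ≤ r + lam.strict r := by
  rw [← YoungDiagram.mem_iff_lt_colLen, YoungDiagram.mem_iff_lt_rowLen, Par.strict]
  omega

/-- From column 4 on this is the ordinary hook length in λ. The additive form avoids truncated
subtraction. -/
theorem cellHook_spec (lam : Par 3) {r c : ℕ} (hr : r < 3) (h : c ≤ r + lam.strict r) :
    (c ≤ 3 → cellHook lam r c + c = lam.strict r + 7) ∧
      (4 ≤ c → cellHook lam r c + c = lam.strict r + lam.1.colLen (c - 4)) := by
  unfold cellHook
  constructor
  · intro hc
    rw [if_pos hc]; omega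
  · intro hc
    have := (lam.lt_colLen_iff hr hc).2 h
    rw [if_neg (by omega)]; omega

/-- Above the highest element of a colour there is at most one element of an adjacent colour. -/
theorem pumpShape_exists_above {l₀ l₁ l₂ a d : ℕ} {h : ℤ} {a₁ d₁ : ℕ} {h₁ : ℤ} {a₂ d₂ : ℕ} {h₂ : ℤ}
    (h₁₀ : l₁ < l₀) (h₂₁ : l₂ < l₁)
    (hw : PumpShape l₀ l₁ l₂ a d h) (hu : PumpShape l₀ l₁ l₂ a₁ d₁ h₁)
    (hv : PumpShape l₀ l₁ l₂ a₂ d₂ h₂) (h₁' : h < h₁) (h₂' : h < h₂)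
    (hne : ¬ (a₁ = a₂ ∧ d₁ = d₂ ∧ h₁ = h₂)) (hau : SpiderAdj (a, d) (a₁, d₁))
    (hav : SpiderAdj (a, d) (a₂, d₂)) : ∃ h', PumpShape l₀ l₁ l₂ a d h' ∧ h < h' := by
  by_contra! hcon
  rcases hw with ⟨rfl, rfl, hh⟩ | ⟨rfl, g₁, g₂, rfl⟩ |
    ⟨rfl, g₁, g₂, rfl⟩ | ⟨rfl, g₁, g₂, rfl⟩ | ⟨rfl, g₁, g₂, rfl⟩ |
    ⟨rfl, rfl, hh⟩ | ⟨rfl, rfl, hh⟩ | ⟨rfl, rfl, hh⟩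
  · have := hcon 12 (by simp [PumpShape])
    simp [PumpShape, SpiderAdj] at *
    omega
  · simp [PumpShape, SpiderAdj] at *
    omega
  · have := hcon (12 + d) (by simp [PumpShape]; omega)
    omega
  · have := hcon (12 + d) (by simp [PumpShape]; omega)
    omega
  · have := hcon (12 + d) (by simp [PumpShape]; omega)
    omega
  · have := hcon 11 (by simp [PumpShape])
    simp [PumpShape, SpiderAdj] at *
    omega
  · have := hcon 11 (by simp [PumpShape])
    simp [PumpShape, SpiderAdj] at *
    omega
  · have := hcon 10 (by simp [PumpShape])
    simp [PumpShape, SpiderAdj] at *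
    omega

section PumpHook

variable (lam : Par 3)

theorem pumpHookAt_top {d : ℕ} (hd : 1 ≤ d) : pumpHookAt lam 0 d (12 + d) =
    15 + 2 * lam.strict 0 + lam.strict 1 + lam.strict 2 - cellHook lam 0 d := by
  rw [pumpHookAt, if_neg (by omega), if_pos rfl, if_pos (by omega)]

theorem pumpHookAt_row_zero {d : ℕ} (hd : 1 ≤ d) :
    pumpHookAt lam 0 d (10 - d) = cellHook lam 0 d := by
  rw [pumpHookAt, if_neg (by omega), if_pos rfl, if_neg (by omega), if_pos (by omega)]

theorem pumpHookAt_row_one {d : ℕ} (hd : 1 ≤ d) :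
    pumpHookAt lam 0 d (8 - d) = cellHook lam 1 (d + 1) := by
  rw [pumpHookAt, if_neg (by omega), if_pos rfl, if_neg (by omega), if_neg (by omega),
    if_pos (by omega)]

theorem pumpHookAt_row_two {d : ℕ} (hd : 1 ≤ d) :
    pumpHookAt lam 0 d (6 - d) = cellHook lam 2 (d + 2) := by
  rw [pumpHookAt, if_neg (by omega), if_pos rfl, if_neg (by omega), if_neg (by omega),
    if_neg (by omega)]

theorem cellHook_le {r c : ℕ} (hr : r < 3) (h : c ≤ r + lam.strict r) :
    cellHook lam r c ≤ lam.strict r + 7 := by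
  have h₁ := cellHook_spec lam hr h
  have h₂ : 4 ≤ c → lam.1.colLen (c - 4) ≤ 3 := fun _ =>
    (lam.1.colLen_anti 0 (c - 4) (Nat.zero_le _)).trans lam.2
  rcases le_or_gt c 3 with h | h
  · have := h₁.1 h
    omega
  · have := h₁.2 h
    have := h₂ h
    omega

/-- One relation for each pair of consecutive elements at the centre or on one of the two short
arms. Each determines the hook length of its upper element from smaller ones. -/
theorem pumpHookAt_center :
    let F := pumpHookAt lam
    F 0 0 4 + F 0 0 2 = F 1 1 3 + F 2 1 3 ∧ F 0 0 6 + F 0 0 4 = F 0 1 5 + F 2 1 5 ∧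
      F 0 0 8 + F 0 0 6 = F 1 1 7 + F 0 1 7 ∧ F 0 0 10 + F 0 0 8 = F 0 1 9 + F 2 1 9 ∧
      F 0 0 12 + F 0 0 10 = F 1 1 11 + F 2 1 11 ∧ F 1 1 7 + F 1 1 3 = F 0 0 4 + F 0 0 6 ∧
      F 1 1 11 + F 1 1 7 = F 0 0 8 + F 0 0 10 ∧ F 2 1 5 + F 2 1 3 = F 0 0 4 + F 2 2 4 ∧
      F 2 1 9 + F 2 1 5 = F 0 0 6 + F 0 0 8 ∧ F 2 1 11 + F 2 1 9 = F 0 0 10 + F 2 2 10 ∧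
      F 2 2 10 + F 2 2 4 = F 2 1 5 + F 2 1 9 := by
  have e₀ : pumpHookAt lam 0 1 9 = cellHook lam 0 1 := pumpHookAt_row_zero lam (d := 1) le_rfl
  have e₁ : pumpHookAt lam 0 1 7 = cellHook lam 1 2 := pumpHookAt_row_one lam (d := 1) le_rfl
  have e₂ : pumpHookAt lam 0 1 5 = cellHook lam 2 3 := pumpHookAt_row_two lam (d := 1) le_rfl
  simp only [e₀, e₁, e₂]
  simp [pumpHookAt, cellHook]
  omega

/-- The hook lengths at the heights 12 + d and 10 - d add up to 15 + 2 l₀ + l₁ + l₂ for every depth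
d, including depth 0, where l_r is `lam.strict r`. -/
theorem pumpHookAt_arm_zero {d : ℕ} (h₁ : 1 ≤ d) (h₂ : d ≤ lam.strict 0) :
    pumpHookAt lam 0 d (12 + d) + pumpHookAt lam 0 d (10 - d) =
      pumpHookAt lam 0 (d - 1) (11 - d) + pumpHookAt lam 0 (d - 1) (11 + d) := by
  have b := cellHook_le lam (r := 0) (c := d) (by omega) (by omega)
  have b' := cellHook_le lam (r := 0) (c := d - 1) (by omega) (by omega)
  rw [pumpHookAt_top lam h₁, pumpHookAt_row_zero lam h₁]
  obtain ⟨e, rfl⟩ : ∃ e, d = e + 1 := ⟨d - 1, by omega⟩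
  have a₁ : (11 - ((e + 1 : ℕ) : ℤ)) = 10 - e := by push_cast; ring
  have a₂ : (11 + ((e + 1 : ℕ) : ℤ)) = 12 + e := by push_cast; ring
  rw [a₁, a₂, Nat.add_sub_cancel]
  rw [Nat.add_sub_cancel] at b'
  rcases Nat.eq_zero_or_pos e with rfl | he
  · rw [zero_add] at *
    simp [pumpHookAt]
    omega
  · rw [pumpHookAt_top lam he, pumpHookAt_row_zero lam he]
    omega

/-- The four cells form a 2 × 2 square of the diagram, and `cellHook` is a function of the row plus
a function of the column. For d = 1 one of the cells is diagonal, and its hook length 6 + l₁ fits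
the same formula. The case of `pumpHookAt_arm_two` is similar. -/
theorem pumpHookAt_arm_one {d : ℕ} (h₁ : 1 ≤ d) (h₂ : d ≤ lam.strict 1) :
    pumpHookAt lam 0 d (10 - d) + pumpHookAt lam 0 d (8 - d) =
      pumpHookAt lam 0 (d - 1) (9 - d) + pumpHookAt lam 0 (d + 1) (9 - d) := by
  have hs := lam.strict_lt
  have a₂ : (9 - (d : ℤ)) = 10 - ((d + 1 : ℕ) : ℤ) := by push_cast; ring
  have b₁ := cellHook_spec lam (r := 0) (c := d) (by omega) (by omega)
  have b₂ := cellHook_spec lam (r := 1) (c := d + 1) (by omega) (by omega)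
  have b₃ := cellHook_spec lam (r := 0) (c := d + 1) (by omega) (by omega)
  rw [pumpHookAt_row_zero lam h₁, pumpHookAt_row_one lam h₁]
  nth_rw 2 [a₂]
  rw [pumpHookAt_row_zero lam (d := d + 1) (by omega)]
  obtain ⟨e, rfl⟩ : ∃ e, d = e + 1 := ⟨d - 1, by omega⟩
  have a₁ : (9 - ((e + 1 : ℕ) : ℤ)) = 8 - e := by push_cast; ring
  rw [a₁, Nat.add_sub_cancel]
  rcases Nat.eq_zero_or_pos e with rfl | he
  · simp [pumpHookAt, cellHook]
    omega
  · rw [pumpHookAt_row_one lam he]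
    have b₄ := cellHook_spec lam (r := 1) (c := e + 1) (by omega) (by omega)
    omega

theorem pumpHookAt_arm_two {d : ℕ} (h₁ : 1 ≤ d) (h₂ : d ≤ lam.strict 2) :
    pumpHookAt lam 0 d (8 - d) + pumpHookAt lam 0 d (6 - d) =
      pumpHookAt lam 0 (d - 1) (7 - d) + pumpHookAt lam 0 (d + 1) (7 - d) := by
  have hs := lam.strict_lt
  have a₂ : (7 - (d : ℤ)) = 8 - ((d + 1 : ℕ) : ℤ) := by push_cast; ring
  have b₁ := cellHook_spec lam (r := 1) (c := d + 1) (by omega) (by omega)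
  have b₂ := cellHook_spec lam (r := 2) (c := d + 2) (by omega) (by omega)
  have b₃ := cellHook_spec lam (r := 1) (c := d + 2) (by omega) (by omega)
  rw [pumpHookAt_row_one lam h₁, pumpHookAt_row_two lam h₁]
  nth_rw 2 [a₂]
  rw [pumpHookAt_row_one lam (d := d + 1) (by omega)]
  obtain ⟨e, rfl⟩ : ∃ e, d = e + 1 := ⟨d - 1, by omega⟩
  have a₁ : (7 - ((e + 1 : ℕ) : ℤ)) = 6 - e := by push_cast; ring
  rw [a₁, Nat.add_sub_cancel]
  rcases Nat.eq_zero_or_pos e with rfl | he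
  · simp [pumpHookAt, cellHook]
    omega
  · rw [pumpHookAt_row_two lam he]
    have b₄ := cellHook_spec lam (r := 2) (c := e + 2) (by omega) (by omega)
    have a₃ : e + 1 + 2 = e + 1 + 1 + 1 := rfl
    have a₄ : e + 2 = e + 1 + 1 := rfl
    rw [a₃] at *
    rw [a₄] at *
    omega

end PumpHook

/-! ### The heap conditions for the pump, and products over its elements -/

section PumpHeap

variable {lam : Par 3}

/-- The hook length of an element of the pump. -/
def pumpHook (x : Pump lam) : ℕ :=
  pumpHookAt lam (pumpColor x).1 (pumpColor x).2 (pumpHeight x)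

theorem pump_ext {x y : Pump lam} (h : pumpColor x = pumpColor y)
    (h' : pumpHeight x = pumpHeight y) : x = y := by
  apply le_antisymm <;> rw [pump_le_iff, h, h'] <;> unfold PumpLe <;> omega

theorem pumpHeight_lt {x y : Pump lam} (h : x < y) : pumpHeight x < pumpHeight y := by
  have h₁ := (pump_le_iff x y).1 h.le
  by_contra hc
  have h₂ : pumpHeight x = pumpHeight y ∧ pumpColor x = pumpColor y := by
    have hs : ∀ z : Pump lam, (pumpColor z).2 = 0 → (pumpColor z).1 = 0 := fun z hz => by
      have := pump_mem_shape z
      unfold PumpShape at this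
      omega
    have hx := hs x
    have hy := hs y
    rw [Prod.ext_iff]
    unfold PumpLe at h₁
    omega
  exact h.ne (pump_ext h₂.2 h₂.1)

/-- For equal or adjacent colours the height alone decides. The exception in `PumpLe` does not
interfere, because no element of depth one on the long arm has height 3. -/
theorem pump_lt_of_height {x y : Pump lam}
    (h : pumpColor x = pumpColor y ∨ SpiderAdj (pumpColor x) (pumpColor y))
    (h' : pumpHeight x < pumpHeight y) : x < y := by
  refine lt_of_le_of_ne ((pump_le_iff x y).2 ?_) (by rintro rfl; exact lt_irrefl _ h')
  have hx := pump_mem_shape x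
  have hy := pump_mem_shape y
  rw [Prod.ext_iff] at h
  unfold SpiderAdj at h
  unfold PumpShape at hx hy
  unfold PumpLe
  omega

/-- The heap condition and the relation of the hook lengths are carried together, since both come
from the same list of cases. -/
theorem pump_neighbors {w z : Pump lam} (h : Consec pumpColor w z) :
    ∃ u v, u ≠ v ∧ w < u ∧ u < z ∧ w < v ∧ v < z ∧
      SpiderAdj (pumpColor w) (pumpColor u) ∧ SpiderAdj (pumpColor w) (pumpColor v) ∧
      (∀ t, w < t → t < z → SpiderAdj (pumpColor w) (pumpColor t) → t = u ∨ t = v) ∧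
      (pumpColor u = pumpColor v ∨ (¬ u ≤ v ∧ ¬ v ≤ u)) ∧
      pumpHook z + pumpHook w = pumpHook u + pumpHook v := by
  obtain ⟨hwz, hc, hb⟩ := h
  have hst := lam.strict_lt
  have sw := pump_mem_shape w
  have sz := pump_mem_shape z
  rw [← hc] at sz
  obtain ⟨a₁, d₁, h₁, a₂, d₂, h₂, s₁, s₂, t₁, t₂, b₁, b₂, b₃, b₄, hF, hne, hall⟩ :=
    pumpShape_neighbors (F := pumpHookAt lam) hst.1 hst.2.1 hst.2.2 (pumpHookAt_center lam)
      (fun d => pumpHookAt_arm_zero lam) (fun d => pumpHookAt_arm_one lam)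
      (fun d => pumpHookAt_arm_two lam) sw sz (pumpHeight_lt hwz) (by
        intro t st h₁ h₂
        obtain ⟨x, hx, rfl⟩ := pump_exists_of_shape st
        have hx : pumpColor x = pumpColor w := hx
        exact hb x (pump_lt_of_height (Or.inl hx.symm) h₁)
          (pump_lt_of_height (Or.inl (hx.trans hc)) h₂) hx)
  obtain ⟨u, hu, rfl⟩ := pump_exists_of_shape s₁
  obtain ⟨v, hv, rfl⟩ := pump_exists_of_shape s₂
  have hadj : ∀ x : Pump lam, SpiderAdj (pumpColor w) (pumpColor x) →
      SpiderAdj (pumpColor x) (pumpColor z) := fun x hx => by rw [← hc]; exact hx.symm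
  change SpiderAdj (pumpColor w) _ at t₁ t₂
  rw [← hu] at t₁
  rw [← hv] at t₂
  refine ⟨u, v, ?_, pump_lt_of_height (Or.inr t₁) b₁, pump_lt_of_height (Or.inr (hadj _ t₁)) b₂,
    pump_lt_of_height (Or.inr t₂) b₃, pump_lt_of_height (Or.inr (hadj _ t₂)) b₄, t₁, t₂, ?_, ?_, ?_⟩
  · rintro rfl
    rw [hu, Prod.ext_iff] at hv
    rcases hne with h | h
    · exact h.2.2 rfl
    · exact h.1 hv
  · intro t g₁ g₂ g₃
    rcases hall _ _ _ (pump_mem_shape t) g₃ (pumpHeight_lt g₁) (pumpHeight_lt g₂) with h | h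
    · exact Or.inl (pump_ext (Prod.ext (by rw [hu]; exact h.1) (by rw [hu]; exact h.2.1)) h.2.2)
    · exact Or.inr (pump_ext (Prod.ext (by rw [hv]; exact h.1) (by rw [hv]; exact h.2.1)) h.2.2)
  · rcases hne with h | h
    · left; rw [hu, hv, h.1, h.2.1]
    · right
      have huv : u ≠ v := by
        rintro rfl
        rw [hu, Prod.ext_iff] at hv
        exact h.1 hv
      constructor <;> intro g
      · exact (pumpHeight_lt (lt_of_le_of_ne g huv)).ne h.2
      · exact (pumpHeight_lt (lt_of_le_of_ne g huv.symm)).ne h.2.symm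
  · have ez : pumpHook z = pumpHookAt lam (pumpColor w).1 (pumpColor w).2 (pumpHeight z) := by
      rw [hc]; rfl
    rw [ez]
    simp only [pumpHook, hu, hv]
    exact hF

theorem pump_spiderHeap : SpiderHeap (pumpColor : Pump lam → ℕ × ℕ) where
  arm_lt x := by
    have := pump_mem_shape x
    unfold PumpShape at this
    omega
  arm_center x := by
    have := pump_mem_shape x
    unfold PumpShape at this
    omega
  exists_adj x y h := by
    have hst := lam.strict_lt
    have hlt := pumpHeight_lt h
    obtain ⟨a, d, hs, ha, hle⟩ := pumpShape_exists_adj hst.1 hst.2.1 hst.2.2 (pump_mem_shape x)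
      (pump_mem_shape y) ((pump_le_iff x y).1 h.le) (fun h => hlt.ne h.2.2)
    obtain ⟨x', hx, hx'⟩ := pump_exists_of_shape hs
    change SpiderAdj (pumpColor x) _ at ha
    rw [← hx] at ha
    refine ⟨x', pump_lt_of_height (Or.inr ha) (by omega), (pump_le_iff _ _).2 ?_, ha⟩
    rw [hx, hx']
    exact hle
  comparable x y h := by
    rcases lt_trichotomy (pumpHeight x) (pumpHeight y) with g | g | g
    · exact Or.inl (pump_lt_of_height h g).le
    · left
      have hx := pump_mem_shape x
      have hy := pump_mem_shape y
      rcases h with h | h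
      · exact (pump_ext h g).le
      · unfold SpiderAdj at h
        unfold PumpShape at hx hy
        omega
    · exact Or.inr (pump_lt_of_height (h.imp Eq.symm SpiderAdj.symm) g).le
  neighbors w z h := by
    obtain ⟨u, v, h₁, h₂, h₃, h₄, h₅, h₆, h₇, h₈, h₉, -⟩ := pump_neighbors h
    exact ⟨u, v, h₁, h₂, h₃, h₄, h₅, h₆, h₇, h₈, h₉⟩
  exists_above w u v hu hv hne au av := by
    have hst := lam.strict_lt
    obtain ⟨h', hs, hlt⟩ := pumpShape_exists_above hst.1 hst.2.1 (pump_mem_shape w)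
      (pump_mem_shape u) (pump_mem_shape v) (pumpHeight_lt hu) (pumpHeight_lt hv)
      (fun h => hne (pump_ext (Prod.ext h.1 h.2.1) h.2.2)) au av
    obtain ⟨z, hz, rfl⟩ := pump_exists_of_shape hs
    exact ⟨z, pump_lt_of_height (Or.inl hz.symm) hlt, hz⟩

theorem pumpHook_add {w z u v : Pump lam} (h : Consec pumpColor w z) (huv : u ≠ v) (hwu : w < u)
    (huz : u < z) (hwv : w < v) (hvz : v < z) (au : SpiderAdj (pumpColor w) (pumpColor u))
    (av : SpiderAdj (pumpColor w) (pumpColor v)) :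
    pumpHook z + pumpHook w = pumpHook u + pumpHook v := by
  obtain ⟨u', v', -, -, -, -, -, -, -, hall, -, hF⟩ := pump_neighbors h
  rcases hall u hwu huz au with rfl | rfl <;> rcases hall v hwv hvz av with rfl | rfl
  · exact absurd rfl huv
  · exact hF
  · rw [hF, add_comm]
  · exact absurd rfl huv

/-- Groups the elements by colour as in `PumpShape`: fifteen single elements whose positions do not
depend on λ, and four families on the long arm. It is applied to the hook lengths, to the
cardinality and, in additive form, to the counts below an element. -/
theorem prod_pump {M : Type*} [CommMonoid M] (F : ℕ → ℕ → ℤ → M) :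
    ∏ x : Pump lam, F (pumpColor x).1 (pumpColor x).2 (pumpHeight x) =
      (F 0 0 2 * F 0 0 4 * F 0 0 6 * F 0 0 8 * F 0 0 10 * F 0 0 12) *
      (∏ d ∈ Finset.Icc 1 (lam.strict 0), F 0 d (12 + d)) *
      (∏ d ∈ Finset.Icc 1 (lam.strict 0), F 0 d (10 - d)) *
      (∏ d ∈ Finset.Icc 1 (lam.strict 1), F 0 d (8 - d)) *
      (∏ d ∈ Finset.Icc 1 (lam.strict 2), F 0 d (6 - d)) *
      (F 1 1 3 * F 1 1 7 * F 1 1 11) *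
      (F 2 1 3 * F 2 1 5 * F 2 1 9 * F 2 1 11 * F 2 2 4 * F 2 2 10) := by
  -- Passes from the column c to the content c - r.
  have shift : ∀ (f : ℕ → M) r l, ∏ c ∈ Finset.Icc (r + 1) (r + l), f c =
      ∏ d ∈ Finset.Icc 1 l, f (d + r) := fun f r l => by
    refine Finset.prod_nbij' (· - r) (· + r) ?_ ?_ ?_ ?_ ?_ <;> intro a ha <;>
      rw [Finset.mem_Icc] at ha
    · rw [Finset.mem_Icc]; omega
    · rw [Finset.mem_Icc]; omega
    · omega
    · omega
    · rw [Nat.sub_add_cancel (by omega)]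
  have hchain : ∏ x : Fin (6 + (lam.1.rowLen 0 + 3)), F (pumpColor (lam := lam) (.inl x)).1
      (pumpColor (lam := lam) (.inl x)).2 (pumpHeight (lam := lam) (.inl x)) =
      (F 0 0 2 * F 0 0 4 * F 0 0 6 * F 0 0 8 * F 0 0 10 * F 0 0 12) *
      (∏ d ∈ Finset.Icc 1 (lam.strict 0), F 0 d (12 + d)) := by
    rw [Fin.prod_univ_add]
    congr 1
    · rw [Fin.prod_univ_six]
      rfl
    · have e : ∀ i : Fin (lam.1.rowLen 0 + 3),
          F (pumpColor (lam := lam) (.inl (Fin.natAdd 6 i))).1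
            (pumpColor (lam := lam) (.inl (Fin.natAdd 6 i))).2
            (pumpHeight (lam := lam) (.inl (Fin.natAdd 6 i))) =
          (fun j : ℕ => F 0 (j + 1) (12 + (j + 1 : ℕ))) i := fun i => by
        simp only [pumpColor, pumpHeight, Fin.val_natAdd]
        rw [if_neg (by omega), show 6 + (i : ℕ) - 5 = i + 1 by omega]
        congr 1
        push_cast; ring
      rw [Finset.prod_congr rfl fun i _ => e i,
        Fin.prod_univ_eq_prod_range (fun j : ℕ => F 0 (j + 1) (12 + (j + 1 : ℕ)))]
      refine Finset.prod_nbij' (· + 1) (· - 1) ?_ ?_ ?_ ?_ ?_ <;> intro a ha <;>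
        simp [Par.strict] at * <;> omega
  have hcell : ∀ i, ∏ p : (pumpData lam i).offDiagCells, F (pumpColor (lam := lam) (.inr ⟨i, p⟩)).1
      (pumpColor (lam := lam) (.inr ⟨i, p⟩)).2 (pumpHeight (lam := lam) (.inr ⟨i, p⟩)) =
      ∏ p ∈ (pumpData lam i).offDiagCells, F (pumpArm i) (p.2 - p.1)
        (2 * (((((![2, 1, 4, 3, 5, 5] : Fin 6 → ℕ) i - p.1 : ℕ)) : ℤ)) + 2 - ((p.2 : ℤ) - p.1)) := by
    intro i
    rw [← Finset.prod_coe_sort (pumpData lam i).offDiagCells fun p => F (pumpArm i) (p.2 - p.1)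
        (2 * (((((![2, 1, 4, 3, 5, 5] : Fin 6 → ℕ) i - p.1 : ℕ)) : ℤ)) + 2 - ((p.2 : ℤ) - p.1))]
    refine Finset.prod_congr rfl fun p _ => ?_
    simp only [pumpColor, pumpHeight, pumpData_diagPos]
  have hrow : ∀ i (s : Finset ℕ) (t : ℕ → Finset ℕ), (∀ p : ℕ × ℕ, (p.1 < p.2 ∧
      p.1 < (![3, 2, 4, 2, 3, 2] : Fin 6 → ℕ) i ∧
      p.2 < (if i = 2 then lam.1.rowLen p.1 else 0) + (![3, 2, 4, 2, 3, 2] : Fin 6 → ℕ) i) ↔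
      p.1 ∈ s ∧ p.2 ∈ t p.1) →
      ∏ p : (pumpData lam i).offDiagCells, F (pumpColor (lam := lam) (.inr ⟨i, p⟩)).1
      (pumpColor (lam := lam) (.inr ⟨i, p⟩)).2 (pumpHeight (lam := lam) (.inr ⟨i, p⟩)) =
      ∏ r ∈ s, ∏ c ∈ t r, F (pumpArm i) (c - r)
        (2 * (((((![2, 1, 4, 3, 5, 5] : Fin 6 → ℕ) i - r : ℕ)) : ℤ)) + 2 - ((c : ℤ) - r)) := by
    intro i s t h
    rw [hcell, Finset.prod_finset_product _ s t fun p => by rw [mem_pumpData_cells, h]]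
  have hdelta : ∀ i, (i = 1 ∨ i = 3 ∨ i = 5) →
      ∏ p : (pumpData lam i).offDiagCells, F (pumpColor (lam := lam) (.inr ⟨i, p⟩)).1
      (pumpColor (lam := lam) (.inr ⟨i, p⟩)).2 (pumpHeight (lam := lam) (.inr ⟨i, p⟩)) =
      F 1 1 (2 * (((![2, 1, 4, 3, 5, 5] : Fin 6 → ℕ) i : ℕ) : ℤ) + 1) := by
    intro i hi
    rw [hrow i {0} (fun _ => {1})]
    · rcases hi with rfl | rfl | rfl <;> simp [pumpArm]
    · intro p
      rw [Finset.mem_singleton, Finset.mem_singleton]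
      rcases hi with rfl | rfl | rfl <;> simp <;> omega
  have heps : ∀ i, (i = 0 ∨ i = 4) →
      ∏ p : (pumpData lam i).offDiagCells, F (pumpColor (lam := lam) (.inr ⟨i, p⟩)).1
      (pumpColor (lam := lam) (.inr ⟨i, p⟩)).2 (pumpHeight (lam := lam) (.inr ⟨i, p⟩)) =
      F 2 1 (2 * (((![2, 1, 4, 3, 5, 5] : Fin 6 → ℕ) i : ℕ) : ℤ) + 1) *
      F 2 2 (2 * (((![2, 1, 4, 3, 5, 5] : Fin 6 → ℕ) i : ℕ) : ℤ)) *
      F 2 1 (2 * (((![2, 1, 4, 3, 5, 5] : Fin 6 → ℕ) i : ℕ) : ℤ) - 1) := by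
    intro i hi
    rw [hrow i {0, 1} (fun r => Finset.Icc (r + 1) 2)]
    · have e : Finset.Icc 1 2 = {1, 2} := rfl
      rcases hi with rfl | rfl <;> simp [pumpArm, e]
    · intro p
      rw [Finset.mem_insert, Finset.mem_singleton, Finset.mem_Icc]
      rcases hi with rfl | rfl <;> simp <;> omega
  have htwo : ∏ p : (pumpData lam 2).offDiagCells, F (pumpColor (lam := lam) (.inr ⟨2, p⟩)).1
      (pumpColor (lam := lam) (.inr ⟨2, p⟩)).2 (pumpHeight (lam := lam) (.inr ⟨2, p⟩)) =
      (∏ d ∈ Finset.Icc 1 (lam.strict 0), F 0 d (10 - d)) *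
      (∏ d ∈ Finset.Icc 1 (lam.strict 1), F 0 d (8 - d)) *
      (∏ d ∈ Finset.Icc 1 (lam.strict 2), F 0 d (6 - d)) := by
    rw [hrow 2 (Finset.range 3) (fun r => Finset.Icc (r + 1) (r + lam.strict r))]
    · rw [Finset.prod_range_succ, Finset.prod_range_succ, Finset.prod_range_one, shift, shift, shift]
      simp [pumpArm]
    · intro p
      rw [Finset.mem_range, Finset.mem_Icc, ← mem_pumpData_cells, mem_pumpData_two]
      omega
  have key := Fintype.prod_sum_type fun x : Pump lam =>
    F (pumpColor x).1 (pumpColor x).2 (pumpHeight x)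
  refine key.trans ?_
  rw [hchain, Fintype.prod_sigma, Fin.prod_univ_six, htwo, heps 0 (by simp), heps 4 (by simp),
    hdelta 1 (by simp), hdelta 3 (by simp), hdelta 5 (by simp)]
  have v₀ : (![2, 1, 4, 3, 5, 5] : Fin 6 → ℕ) 0 = 2 := rfl
  have v₁ : (![2, 1, 4, 3, 5, 5] : Fin 6 → ℕ) 1 = 1 := rfl
  have v₃ : (![2, 1, 4, 3, 5, 5] : Fin 6 → ℕ) 3 = 3 := rfl
  have v₄ : (![2, 1, 4, 3, 5, 5] : Fin 6 → ℕ) 4 = 5 := rfl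
  have v₅ : (![2, 1, 4, 3, 5, 5] : Fin 6 → ℕ) 5 = 5 := rfl
  rw [v₀, v₁, v₃, v₄, v₅]
  norm_num only
  generalize ∏ d ∈ Finset.Icc 1 (lam.strict 0), F 0 d (12 + d) = A
  generalize ∏ d ∈ Finset.Icc 1 (lam.strict 0), F 0 d (10 - d) = B
  generalize ∏ d ∈ Finset.Icc 1 (lam.strict 1), F 0 d (8 - d) = C
  generalize ∏ d ∈ Finset.Icc 1 (lam.strict 2), F 0 d (6 - d) = D
  generalize F 1 1 3 = a₁
  generalize F 1 1 7 = a₂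
  generalize F 1 1 11 = a₃
  generalize F 2 1 3 = b₁
  generalize F 2 1 5 = b₂
  generalize F 2 1 9 = b₃
  generalize F 2 1 11 = b₄
  generalize F 2 2 4 = b₅
  generalize F 2 2 10 = b₆
  generalize F 0 0 2 * F 0 0 4 * F 0 0 6 * F 0 0 8 * F 0 0 10 * F 0 0 12 = E
  clear * - a₁
  simp only [mul_assoc, mul_comm, mul_left_comm]

theorem sum_pump {M : Type*} [AddCommMonoid M] (F : ℕ → ℕ → ℤ → M) :
    ∑ x : Pump lam, F (pumpColor x).1 (pumpColor x).2 (pumpHeight x) =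
      (F 0 0 2 + F 0 0 4 + F 0 0 6 + F 0 0 8 + F 0 0 10 + F 0 0 12) +
      (∑ d ∈ Finset.Icc 1 (lam.strict 0), F 0 d (12 + d)) +
      (∑ d ∈ Finset.Icc 1 (lam.strict 0), F 0 d (10 - d)) +
      (∑ d ∈ Finset.Icc 1 (lam.strict 1), F 0 d (8 - d)) +
      (∑ d ∈ Finset.Icc 1 (lam.strict 2), F 0 d (6 - d)) +
      (F 1 1 3 + F 1 1 7 + F 1 1 11) +
      (F 2 1 3 + F 2 1 5 + F 2 1 9 + F 2 1 11 + F 2 2 4 + F 2 2 10) :=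
  prod_pump (M := Multiplicative M) F

end PumpHeap

/-! ### Hook lengths of the lowest elements of the colours -/

section PumpHook

variable {lam : Par 3}

-- In each family on the long arm the depths of the elements below a given one form an interval. The
-- choice a = b = 1 is used when there are none.
open Classical in
theorem sum_Icc_ite {l a b : ℕ} {p : ℕ → Prop} (ha : 1 ≤ a) (hb : b ≤ l + 1)
    (hp : ∀ d, 1 ≤ d → d ≤ l → (p d ↔ a ≤ d ∧ d < b)) :
    ∑ d ∈ Finset.Icc 1 l, (if p d then 1 else 0) = b - a := by
  rw [← Finset.card_filter, ← Nat.card_Ico]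
  congr 1
  ext d
  rw [Finset.mem_filter, Finset.mem_Icc, Finset.mem_Ico]
  constructor
  · rintro ⟨h, h'⟩
    exact (hp d h.1 h.2).1 h'
  · intro h
    exact ⟨by omega, (hp d (by omega) (by omega)).2 h⟩

-- These elements start the recursion: the lowest element of the centre, the lowest ones of the
-- colours on the short arms, and on the long arm the lowest cell of each content. What lies below
-- them is counted family by family with `sum_pump`.
open Classical in
set_option linter.unusedSimpArgs false in
set_option maxHeartbeats 4000000 in
theorem pumpHook_eq_card (z : Pump lam) (hz : ∀ w, w < z → pumpColor w ≠ pumpColor z) :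
    pumpHook z = Nat.card (Set.Iic z) := by
  have hst := lam.strict_lt
  -- Minimality within the colour, expressed by heights.
  have hlow : ∀ t, PumpShape (lam.strict 0) (lam.strict 1) (lam.strict 2)
      (pumpColor z).1 (pumpColor z).2 t → pumpHeight z ≤ t := by
    intro t ht
    obtain ⟨w, hw, rfl⟩ := pump_exists_of_shape ht
    by_contra hc
    exact hz w (pump_lt_of_height (Or.inl hw) (by omega)) hw
  have hcard : Nat.card (Set.Iic z) = ∑ x : Pump lam, if PumpLe ((pumpColor x).1, (pumpColor x).2)
      (pumpHeight x) ((pumpColor z).1, (pumpColor z).2) (pumpHeight z) then 1 else 0 := by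
    rw [← Finset.card_filter, Nat.card_eq_fintype_card, Fintype.card_ofFinset]
    congr 1
    ext x
    simp [pump_le_iff]
  rw [hcard, sum_pump fun a d h => if PumpLe (a, d) h ((pumpColor z).1, (pumpColor z).2)
    (pumpHeight z) then 1 else 0, pumpHook]
  have hs := pump_mem_shape z
  clear hcard hz
  generalize pumpHeight z = h at *
  generalize (pumpColor z).1 = a at *
  generalize (pumpColor z).2 = d at *
  rcases hs with ⟨rfl, rfl, hh⟩ | ⟨rfl, g₁, g₂, rfl⟩ |
    ⟨rfl, g₁, g₂, rfl⟩ | ⟨rfl, g₁, g₂, rfl⟩ | ⟨rfl, g₁, g₂, rfl⟩ |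
    ⟨rfl, rfl, hh⟩ | ⟨rfl, rfl, hh⟩ | ⟨rfl, rfl, hh⟩
  · obtain rfl : h = 2 := by
      have := hlow 2 (by simp [PumpShape])
      omega
    rw [sum_Icc_ite (a := 1) (b := 1), sum_Icc_ite (a := 1) (b := 1), sum_Icc_ite (a := 1) (b := 1),
      sum_Icc_ite (a := 1) (b := 1)]
    -- One round for each of the fifteen fixed elements: six at the centre, three on arm 1, six on
    -- arm 2.
    · iterate 15
        first
        | (rw [if_neg]; on_goal 2 => (simp only [PumpLe, true_and, and_true, true_or, or_true, true_implies, ne_eq,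
            not_true_eq_false, false_implies] <;> omega))
        | (rw [if_pos]; on_goal 2 => (simp only [PumpLe, true_and, and_true, true_or, or_true, true_implies, ne_eq,
            not_true_eq_false, false_implies] <;> omega))
      simp [pumpHookAt]
    all_goals
      first
      | omega
      | intro e h₁ h₂
        simp only [PumpLe, true_and, and_true, true_or, or_true, true_implies, ne_eq,
          not_true_eq_false, false_implies] <;> omega
  · have := hlow (10 - d) (by simp [PumpShape]; omega)
    omega
  · rw [pumpHookAt_row_zero lam g₁]
    have h₀ : lam.strict 2 < d := by
      by_contra hc
      have := hlow (6 - d) (by simp [PumpShape]; omega)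
      omega
    have h₁ : lam.strict 1 < d := by
      by_contra hc
      have := hlow (8 - d) (by simp [PumpShape]; omega)
      omega
    clear hlow
    have c₀ := cellHook_spec lam (r := 0) (c := d) (by omega) (by omega)
    have c₁ := fun h => lam.lt_colLen_iff (r := 1) (c := d) (by omega) h
    have c₂ := fun h => lam.lt_colLen_iff (r := 2) (c := d) (by omega) h
    have c₃ := (lam.1.colLen_anti 0 (d - 4) (Nat.zero_le _)).trans lam.2
    have c₄ := fun h => lam.lt_colLen_iff (r := 0) (c := d) (by omega) h
    rw [sum_Icc_ite (a := 1) (b := 1), sum_Icc_ite (a := d) (b := lam.strict 0 + 1), sum_Icc_ite (a := d - 1) (b := lam.strict 1 + 1), sum_Icc_ite (a := d - 2) (b := lam.strict 2 + 1)]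
    -- Which of the fifteen fixed elements lie below depends on d only while d is small; from d = 5
    -- on, none does.
    · obtain rfl | rfl | rfl | rfl | hd : d = 1 ∨ d = 2 ∨ d = 3 ∨ d = 4 ∨ 5 ≤ d := by omega
      all_goals
        first
        | omega
        | iterate 15
            first
            | (rw [if_neg]; on_goal 2 => (simp only [PumpLe, true_and, and_true, true_or, or_true, true_implies, ne_eq,
            not_true_eq_false, false_implies] <;> omega))
            | (rw [if_pos]; on_goal 2 => (simp only [PumpLe, true_and, and_true, true_or, or_true, true_implies, ne_eq,
            not_true_eq_false, false_implies] <;> omega))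
          omega
    all_goals
      first
      | omega
      | intro e h₁ h₂
        simp only [PumpLe, true_and, and_true, true_or, or_true, true_implies, ne_eq,
          not_true_eq_false, false_implies] <;> omega
  · rw [pumpHookAt_row_one lam g₁]
    have h₀ : lam.strict 2 < d := by
      by_contra hc
      have := hlow (6 - d) (by simp [PumpShape]; omega)
      omega
    clear hlow
    have c₀ := cellHook_spec lam (r := 1) (c := d + 1) (by omega) (by omega)
    have c₁ := fun h => lam.lt_colLen_iff (r := 1) (c := d + 1) (by omega) h
    have c₂ := fun h => lam.lt_colLen_iff (r := 2) (c := d + 1) (by omega) h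
    have c₃ := (lam.1.colLen_anti 0 (d + 1 - 4) (Nat.zero_le _)).trans lam.2
    have c₄ := fun h => lam.lt_colLen_iff (r := 0) (c := d + 1) (by omega) h
    rw [sum_Icc_ite (a := 1) (b := 1), sum_Icc_ite (a := 1) (b := 1), sum_Icc_ite (a := d) (b := lam.strict 1 + 1), sum_Icc_ite (a := d - 1) (b := lam.strict 2 + 1)]
    · obtain rfl | rfl | rfl | rfl | hd : d = 1 ∨ d = 2 ∨ d = 3 ∨ d = 4 ∨ 5 ≤ d := by omega
      all_goals
        first
        | omega
        | iterate 15
            first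
            | (rw [if_neg]; on_goal 2 => (simp only [PumpLe, true_and, and_true, true_or, or_true, true_implies, ne_eq,
            not_true_eq_false, false_implies] <;> omega))
            | (rw [if_pos]; on_goal 2 => (simp only [PumpLe, true_and, and_true, true_or, or_true, true_implies, ne_eq,
            not_true_eq_false, false_implies] <;> omega))
          omega
    all_goals
      first
      | omega
      | intro e h₁ h₂
        simp only [PumpLe, true_and, and_true, true_or, or_true, true_implies, ne_eq,
          not_true_eq_false, false_implies] <;> omega
  · rw [pumpHookAt_row_two lam g₁]
    clear hlow
    have c₀ := cellHook_spec lam (r := 2) (c := d + 2) (by omega) (by omega)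
    have c₁ := fun h => lam.lt_colLen_iff (r := 1) (c := d + 2) (by omega) h
    have c₂ := fun h => lam.lt_colLen_iff (r := 2) (c := d + 2) (by omega) h
    have c₃ := (lam.1.colLen_anti 0 (d + 2 - 4) (Nat.zero_le _)).trans lam.2
    have c₄ := fun h => lam.lt_colLen_iff (r := 0) (c := d + 2) (by omega) h
    rw [sum_Icc_ite (a := 1) (b := 1), sum_Icc_ite (a := 1) (b := 1), sum_Icc_ite (a := 1) (b := 1), sum_Icc_ite (a := d) (b := lam.strict 2 + 1)]
    · obtain rfl | rfl | rfl | rfl | hd : d = 1 ∨ d = 2 ∨ d = 3 ∨ d = 4 ∨ 5 ≤ d := by omega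
      all_goals
        first
        | omega
        | iterate 15
            first
            | (rw [if_neg]; on_goal 2 => (simp only [PumpLe, true_and, and_true, true_or, or_true, true_implies, ne_eq,
            not_true_eq_false, false_implies] <;> omega))
            | (rw [if_pos]; on_goal 2 => (simp only [PumpLe, true_and, and_true, true_or, or_true, true_implies, ne_eq,
            not_true_eq_false, false_implies] <;> omega))
          omega
    all_goals
      first
      | omega
      | intro e h₁ h₂
        simp only [PumpLe, true_and, and_true, true_or, or_true, true_implies, ne_eq,
          not_true_eq_false, false_implies] <;> omega
  · obtain rfl : h = 3 := by
      have := hlow 3 (by simp [PumpShape])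
      omega
    rw [sum_Icc_ite (a := 1) (b := 1), sum_Icc_ite (a := 1) (b := 1), sum_Icc_ite (a := 1) (b := 1),
      sum_Icc_ite (a := 1) (b := 1)]
    · iterate 15
        first
        | (rw [if_neg]; on_goal 2 => (simp only [PumpLe, true_and, and_true, true_or, or_true, true_implies, ne_eq,
            not_true_eq_false, false_implies] <;> omega))
        | (rw [if_pos]; on_goal 2 => (simp only [PumpLe, true_and, and_true, true_or, or_true, true_implies, ne_eq,
            not_true_eq_false, false_implies] <;> omega))
      simp [pumpHookAt]
    all_goals
      first
      | omega
      | intro e h₁ h₂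
        simp only [PumpLe, true_and, and_true, true_or, or_true, true_implies, ne_eq,
          not_true_eq_false, false_implies] <;> omega
  · obtain rfl : h = 3 := by
      have := hlow 3 (by simp [PumpShape])
      omega
    rw [sum_Icc_ite (a := 1) (b := 1), sum_Icc_ite (a := 1) (b := 1), sum_Icc_ite (a := 1) (b := 1),
      sum_Icc_ite (a := 1) (b := 1)]
    · iterate 15
        first
        | (rw [if_neg]; on_goal 2 => (simp only [PumpLe, true_and, and_true, true_or, or_true, true_implies, ne_eq,
            not_true_eq_false, false_implies] <;> omega))
        | (rw [if_pos]; on_goal 2 => (simp only [PumpLe, true_and, and_true, true_or, or_true, true_implies, ne_eq,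
            not_true_eq_false, false_implies] <;> omega))
      simp [pumpHookAt]
    all_goals
      first
      | omega
      | intro e h₁ h₂
        simp only [PumpLe, true_and, and_true, true_or, or_true, true_implies, ne_eq,
          not_true_eq_false, false_implies] <;> omega
  · obtain rfl : h = 4 := by
      have := hlow 4 (by simp [PumpShape])
      omega
    rw [sum_Icc_ite (a := 1) (b := 1), sum_Icc_ite (a := 1) (b := 1), sum_Icc_ite (a := 1) (b := 1),
      sum_Icc_ite (a := 1) (b := 1)]
    · iterate 15
        first
        | (rw [if_neg]; on_goal 2 => (simp only [PumpLe, true_and, and_true, true_or, or_true, true_implies, ne_eq,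
            not_true_eq_false, false_implies] <;> omega))
        | (rw [if_pos]; on_goal 2 => (simp only [PumpLe, true_and, and_true, true_or, or_true, true_implies, ne_eq,
            not_true_eq_false, false_implies] <;> omega))
      simp [pumpHookAt]
    all_goals
      first
      | omega
      | intro e h₁ h₂
        simp only [PumpLe, true_and, and_true, true_or, or_true, true_implies, ne_eq,
          not_true_eq_false, false_implies] <;> omega

end PumpHook

/-! ### Summation of power series -/

section Weights

open scoped PowerSeries.WithPiTopology

variable {α β : Type*}

/-- There are finitely many elements up to each weight. -/
def FiniteWeights (w : α → ℕ) : Prop := ∀ N, {a | w a ≤ N}.Finite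

theorem FiniteWeights.mono {w w' : α → ℕ} (h : FiniteWeights w) (h' : ∀ a, w a ≤ w' a) :
    FiniteWeights w' := fun N => (h N).subset fun a ha => (h' a).trans ha

theorem FiniteWeights.comp {w : α → ℕ} (h : FiniteWeights w) {f : β → α}
    (hf : Function.Injective f) : FiniteWeights (w ∘ f) :=
  fun N => (h N).preimage hf.injOn

theorem FiniteWeights.prod {w : α → ℕ} {w' : β → ℕ} (h : FiniteWeights w)
    (h' : FiniteWeights w') : FiniteWeights fun x : α × β => w x.1 + w' x.2 := fun N =>
  ((h N).prod (h' N)).subset fun x hx => by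
    have hx : w x.1 + w' x.2 ≤ N := hx
    exact ⟨(by omega : w x.1 ≤ N), (by omega : w' x.2 ≤ N)⟩

theorem FiniteWeights.pi {ι : Type*} [Fintype ι] {α : ι → Type*} {w : ∀ i, α i → ℕ}
    (h : ∀ i, FiniteWeights (w i)) : FiniteWeights fun x : ∀ i, α i => ∑ i, w i (x i) := fun N =>
  (Set.Finite.pi' fun i => h i N).subset fun x hx i =>
    (Finset.single_le_sum (f := fun i => w i (x i)) (fun _ _ => Nat.zero_le _)
      (Finset.mem_univ i)).trans hx

theorem finiteWeights_id : FiniteWeights (fun n : ℕ => n) := fun N => Set.finite_Iic N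

/-- Each coefficient receives contributions from finitely many terms only, so the coefficientwise
sum exists. -/
theorem summable_of_X_pow_dvd {w : α → ℕ} (hw : FiniteWeights w) {f : α → ℚ⟦X⟧}
    (h : ∀ a, X ^ w a ∣ f a) : Summable f := by
  rw [WithPiTopology.summable_iff_summable_coeff]
  intro d
  apply summable_of_hasFiniteSupport
  refine (hw d).subset fun a ha => ?_
  by_contra hc
  exact ha (X_pow_dvd_iff.1 (h a) d (not_le.1 hc))

theorem FiniteWeights.summable {w : α → ℕ} (hw : FiniteWeights w) :
    Summable fun a => (X : ℚ⟦X⟧) ^ w a := summable_of_X_pow_dvd hw fun _ => dvd_rfl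

/-- The sum of the family over a finite product. -/
theorem hasSum_X_pow_pi : ∀ {k : ℕ} {α : Fin k → Type*} {w : ∀ i, α i → ℕ} {S : Fin k → ℚ⟦X⟧},
    (∀ i, FiniteWeights (w i)) → (∀ i, HasSum (fun a => (X : ℚ⟦X⟧) ^ w i a) (S i)) →
    HasSum (fun x : ∀ i, α i => (X : ℚ⟦X⟧) ^ ∑ i, w i (x i)) (∏ i, S i)
  | 0, α, w, S, _, _ => by
    simp
  | k + 1, α, w, S, hw, hS => by
    have ih := hasSum_X_pow_pi (fun i : Fin k => hw i.succ) fun i => hS i.succ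
    have h := (hS 0).mul ih (((hw 0).prod (FiniteWeights.pi fun i => hw i.succ)).summable.congr
      fun x => by rw [pow_add])
    rw [Fin.prod_univ_succ, ← (Fin.consEquiv α).hasSum_iff]
    refine h.congr_fun fun x => ?_
    rw [← pow_add, Function.comp_apply, Fin.sum_univ_succ]
    rfl

/-- The geometric series `(1 - X ^ e)⁻¹`. -/
noncomputable def geom (e : ℕ) : ℚ⟦X⟧ := (1 - X ^ e)⁻¹

theorem geom_mul {e : ℕ} (he : 1 ≤ e) : (1 - X ^ e) * geom e = 1 := by
  apply PowerSeries.mul_inv_cancel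
  simp [show e ≠ 0 by omega]

theorem finiteWeights_mul {e : ℕ} (he : 1 ≤ e) : FiniteWeights (fun n : ℕ => n * e) :=
  finiteWeights_id.mono fun n => Nat.le_mul_of_pos_right n he

theorem hasSum_geom {e : ℕ} (he : 1 ≤ e) : HasSum (fun n : ℕ => (X : ℚ⟦X⟧) ^ (n * e)) (geom e) := by
  have hs := (finiteWeights_mul he).summable
  have h := hs.hasSum
  -- Dropping the first term of the series has the same effect as multiplying it by X ^ e; this
  -- determines the sum.
  have h₁ := (hasSum_nat_add_iff' 1).2 h
  have h₂ := h.mul_left (X ^ e)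
  have e₁ : ∀ n, (X : ℚ⟦X⟧) ^ e * X ^ (n * e) = X ^ ((n + 1) * e) := fun n => by ring
  simp only [e₁] at h₂
  have h₃ := h₁.unique h₂
  simp only [Finset.range_one, Finset.sum_singleton, zero_mul, pow_zero] at h₃
  have h₄ : (1 - X ^ e) * (∑' n : ℕ, (X : ℚ⟦X⟧) ^ (n * e)) = 1 := by linear_combination h₃
  have h₅ : (∑' n : ℕ, (X : ℚ⟦X⟧) ^ (n * e)) = geom e := by
    linear_combination (geom e) * h₄ - (∑' n : ℕ, (X : ℚ⟦X⟧) ^ (n * e)) * geom_mul he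
  rwa [h₅] at h

/-- The shape of all sums over the chain: z belongs to the next larger element, and n is the
difference of the two values. -/
theorem hasSum_mul_X_pow (z : ℚ⟦X⟧) {e : ℕ} (he : 1 ≤ e) :
    HasSum (fun n : ℕ => (z * X ^ n) ^ e) (z ^ e * geom e) := by
  have h := (hasSum_geom he).mul_left (z ^ e)
  refine h.congr_fun fun n => ?_
  ring

end Weights

/-! ### Generating functions of order-reversing maps -/

section PartitionGF

open scoped PowerSeries.WithPiTopology

variable {P Q : Type*} [PartialOrder P] [Fintype P] [PartialOrder Q] [Fintype Q]

theorem finiteWeights_sum (P : Type*) [Fintype P] :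
    FiniteWeights fun σ : P → ℕ => ∑ x, σ x :=
  FiniteWeights.pi fun _ => finiteWeights_id

-- Turns the coefficientwise count into an infinite sum, to which equivalences and iterated
-- summation apply.
variable (P) in
theorem hasSum_partitionGF :
    HasSum (fun σ : {σ : P → ℕ // Antitone σ} => (X : ℚ⟦X⟧) ^ ∑ x, σ.1 x) (partitionGF P) := by
  rw [WithPiTopology.hasSum_iff_hasSum_coeff]
  intro N
  have hfin : Set.Finite {σ : {σ : P → ℕ // Antitone σ} | ∑ x, σ.1 x = N} :=
    (((finiteWeights_sum P).comp Subtype.val_injective) N).subset fun σ h => le_of_eq h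
  have h := hasSum_sum_of_ne_finset_zero (s := hfin.toFinset) (L := .unconditional _)
    (f := fun σ : {σ : P → ℕ // Antitone σ} => coeff N ((X : ℚ⟦X⟧) ^ ∑ x, σ.1 x)) (by
      intro σ hσ
      rw [Set.Finite.mem_toFinset] at hσ
      rw [coeff_X_pow, if_neg fun h => hσ h.symm])
  suffices e : coeff N (partitionGF P) = ∑ b ∈ hfin.toFinset, coeff N ((X : ℚ⟦X⟧) ^ ∑ x, b.1 x) by
    rw [e]
    exact h
  rw [show coeff N (partitionGF P) = _ from coeff_mk _ _, Finset.sum_congr rfl fun σ hσ => by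
    rw [coeff_X_pow, if_pos ((Set.Finite.mem_toFinset _).1 hσ).symm], Finset.sum_const,
    nsmul_eq_mul, mul_one, ← Nat.card_eq_card_finite_toFinset hfin]
  congr 1
  exact Nat.card_congr (Equiv.subtypeSubtypeEquivSubtypeInter _ _).symm

theorem partitionGF_eq_of_hasSum {α : Type*} (e : α ≃ {σ : P → ℕ // Antitone σ}) {S : ℚ⟦X⟧}
    (h : HasSum (fun a => (X : ℚ⟦X⟧) ^ ∑ x, (e a).1 x) S) : partitionGF P = S :=
  ((e.hasSum_iff.2 (hasSum_partitionGF P)).unique h)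

theorem partitionGF_congr (e : P ≃o Q) : partitionGF P = partitionGF Q := by
  let f : {σ : Q → ℕ // Antitone σ} ≃ {σ : P → ℕ // Antitone σ} :=
    { toFun := fun σ => ⟨σ.1 ∘ e, σ.2.comp_monotone e.monotone⟩
      invFun := fun σ => ⟨σ.1 ∘ e.symm, σ.2.comp_monotone e.symm.monotone⟩
      left_inv := fun σ => Subtype.ext (funext fun x => by simp)
      right_inv := fun σ => Subtype.ext (funext fun x => by simp) }
  apply partitionGF_eq_of_hasSum f
  refine (hasSum_partitionGF Q).congr_fun fun σ => ?_
  congr 1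
  exact Equiv.sum_comp e.toEquiv σ.1

/-- An order-reversing map on a poset with a top element. -/
def antitoneWithTopEquiv : ℕ × {σ : P → ℕ // Antitone σ} ≃ {σ : WithTop P → ℕ // Antitone σ} where
  toFun x := ⟨fun p => WithTop.recTopCoe x.1 (fun p => x.2.1 p + x.1) p, by
    intro p q h
    induction q using WithTop.recTopCoe with
    | top => induction p using WithTop.recTopCoe with
      | top => exact le_rfl
      | coe p => exact Nat.le_add_left _ _
    | coe q => induction p using WithTop.recTopCoe with
      | top => exact absurd h (WithTop.not_top_le_coe q)
      | coe p => exact Nat.add_le_add_right (x.2.2 (WithTop.coe_le_coe.1 h)) _⟩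
  invFun σ := (σ.1 ⊤, ⟨fun p => σ.1 p - σ.1 ⊤, fun p q h =>
    Nat.sub_le_sub_right (σ.2 (WithTop.coe_le_coe.2 h)) _⟩)
  left_inv x := by
    refine Prod.ext rfl (Subtype.ext (funext fun p => ?_))
    exact Nat.add_sub_cancel _ _
  right_inv σ := by
    refine Subtype.ext (funext fun p => ?_)
    induction p using WithTop.recTopCoe with
    | top => rfl
    | coe p => exact Nat.sub_add_cancel (σ.2 le_top)

/-- The value at the top is the smallest one. Subtracting it from all |P| + 1 entries leaves an
arbitrary order-reversing map on P. -/
theorem partitionGF_withTop [I : Fintype (WithTop P)] :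
    partitionGF (WithTop P) = geom (Fintype.card P + 1) * partitionGF P := by
  apply partitionGF_eq_of_hasSum antitoneWithTopEquiv
  have h := (hasSum_geom (e := Fintype.card P + 1) (by omega)).mul (hasSum_partitionGF P)
    (((finiteWeights_mul (e := Fintype.card P + 1) (by omega)).prod
      ((finiteWeights_sum P).comp Subtype.val_injective)).summable.congr fun x => by
        rw [pow_add]; rfl)
  refine h.congr_fun fun x => ?_
  rw [← pow_add]
  congr 1
  have e : ∀ f : WithTop P → ℕ, ∑ p, f p = f ⊤ + ∑ p : P, f p := fun f => by
    rw [Subsingleton.elim I (inferInstanceAs (Fintype (Option P)))]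
    exact Fintype.sum_option (α := P) f
  rw [e]
  change x.1 + ∑ p, (x.2.1 p + x.1) = _
  rw [Finset.sum_add_distrib, Finset.sum_const, Finset.card_univ, smul_eq_mul]
  ring

end PartitionGF

namespace AttachedPoset

variable {n k m : ℕ} {X : Fin k → Attachment n}

/-- The inclusion after attaching one more element above the chain. -/
def castSucc : AttachedPoset m X → AttachedPoset (m + 1) X
  | .inl a => .inl (Fin.castSucc a)
  | .inr p => .inr p

theorem castSucc_le_castSucc (x y : AttachedPoset m X) : castSucc x ≤ castSucc y ↔ x ≤ y := by
  rcases x with a | ⟨i, p⟩ <;> rcases y with b | ⟨j, q⟩ <;> exact Iff.rfl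

/-- The greatest element of the chain. -/
def last : AttachedPoset (m + 1) X := .inl (Fin.last (n + m))

theorem castSucc_lt_last (x : AttachedPoset m X) : castSucc x < last := by
  rw [lt_iff_le_not_ge]
  rcases x with a | ⟨i, p⟩
  · exact ⟨Fin.le_last _, (Fin.castSucc_lt_last a).not_ge⟩
  · have h₁ := (X i).le_bound
    have h₂ := (X i).one_le_start
    have h₃ := (X i).one_le_size
    constructor
    · change (X i).start + (X i).size - 2 - p.1.1 ≤ n + m
      omega
    · rintro ⟨-, h⟩
      change n + m ≤ (X i).start + (X i).size - 2 - p.1.2 at h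
      omega

theorem eq_last_or (x : AttachedPoset (m + 1) X) : last = x ∨ ∃ y, castSucc y = x := by
  rcases x with a | p
  · induction a using Fin.lastCases with
    | last => exact Or.inl rfl
    | cast b => exact Or.inr ⟨.inl b, rfl⟩
  · exact Or.inr ⟨.inr p, rfl⟩

/-- Attaching one more element above the chain. -/
noncomputable def withTopOrderIso : WithTop (AttachedPoset m X) ≃o AttachedPoset (m + 1) X :=
  RelIso.ofSurjective (OrderEmbedding.ofMapLEIff (WithTop.recTopCoe last castSucc) (by
    intro x y
    induction x using WithTop.recTopCoe with
    | top => induction y using WithTop.recTopCoe with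
      | top => exact ⟨fun _ => le_rfl, fun _ => le_rfl⟩
      | coe y =>
        exact ⟨fun h => absurd h (castSucc_lt_last y).not_ge,
          fun h => absurd h (WithTop.not_top_le_coe y)⟩
    | coe x => induction y using WithTop.recTopCoe with
      | top => exact ⟨fun _ => le_top, fun _ => (castSucc_lt_last x).le⟩
      | coe y => exact (castSucc_le_castSucc x y).trans WithTop.coe_le_coe.symm)) (by
    intro x
    rcases eq_last_or x with rfl | ⟨y, rfl⟩
    · exact ⟨⊤, rfl⟩
    · exact ⟨y, rfl⟩)

theorem partitionGF_succ : partitionGF (AttachedPoset (m + 1) X) =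
    geom (Fintype.card (AttachedPoset m X) + 1) * partitionGF (AttachedPoset m X) := by
  classical
  rw [← partitionGF_congr withTopOrderIso, partitionGF_withTop]

theorem card_succ : Fintype.card (AttachedPoset (m + 1) X) =
    Fintype.card (AttachedPoset m X) + 1 := by
  have h : ∀ m, Fintype.card (AttachedPoset m X) =
      n + m + Fintype.card (Σ i, (X i).offDiagCells) := fun m => by
    rw [← Fintype.card_fin (n + m), ← Fintype.card_sum]
    rfl
  rw [h, h]
  omega

/-- The elements of the upper chain are in turn the greatest of the poset. Each one contributes the
factor 1 / (1 - q ^ e), where e is the number of elements up to it. -/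
theorem partitionGF_chain : partitionGF (AttachedPoset m X) =
    (∏ j ∈ Finset.Icc 1 m, geom (Fintype.card (AttachedPoset 0 X) + j)) *
      partitionGF (AttachedPoset 0 X) := by
  have hc : ∀ m, Fintype.card (AttachedPoset m X) = Fintype.card (AttachedPoset 0 X) + m := by
    intro m
    induction m with
    | zero => rfl
    | succ m ih => rw [card_succ, ih, add_assoc]
  induction m with
  | zero => simp
  | succ m ih =>
    rw [partitionGF_succ, ih, hc, Finset.prod_Icc_succ_top (by omega), add_assoc]
    ring

end AttachedPoset

/-! ### Generating functions of fillings of shifted diagrams -/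

section Determinant

/-- Row operations that leave the last row unchanged. The order of the rows is reversed first,
because `Matrix.det_eq_of_forall_row_eq_smul_add_pred` works with the preceding row. -/
theorem Matrix.det_sub_succ_row {R : Type*} [CommRing R] {K : ℕ} (V : ℕ → Fin (K + 1) → R) :
    (Matrix.of fun r s : Fin (K + 1) => V r s - if (r : ℕ) + 1 < K + 1 then V (r + 1) s else 0).det =
      (Matrix.of fun r s : Fin (K + 1) => V r s).det := by
  set B := Matrix.of fun r s : Fin (K + 1) => V r s - if (r : ℕ) + 1 < K + 1 then V (r + 1) s else 0
  set A := Matrix.of fun r s : Fin (K + 1) => V r s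
  have h : (A.submatrix Fin.revPerm id).det = (B.submatrix Fin.revPerm id).det := by
    apply Matrix.det_eq_of_forall_row_eq_smul_add_pred (fun _ => 1)
    · intro j
      simp [A, B]
    · intro i j
      have h₁ : K - (i.val + 1) + 1 = K - i.val := by omega
      have h₂ : i.val < K := i.2
      simp [A, B, Fin.val_rev, h₁]
      rw [if_pos (by omega)]
      ring
  rw [Matrix.det_permute, Matrix.det_permute] at h
  have hs : ((Equiv.Perm.sign (Fin.revPerm (n := K + 1)) : ℤ) : R) *
      ((Equiv.Perm.sign (Fin.revPerm (n := K + 1)) : ℤ) : R) = 1 := by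
    rw [← Int.cast_mul, ← Units.val_mul, Int.units_mul_self]
    simp
  linear_combination (-((Equiv.Perm.sign (Fin.revPerm (n := K + 1)) : ℤ) : R)) * h +
    (A.det - B.det) * hs

/-- After the subtraction of successive rows only the last entry of the last column survives, and it
equals 1. -/
theorem Matrix.det_eq_det_sub_of_last_eq_one {R : Type*} [CommRing R] {K : ℕ}
    (V : ℕ → Fin (K + 1) → R) (hV : ∀ r, V r (Fin.last K) = 1) :
    (Matrix.of fun r s : Fin (K + 1) => V r s).det =
      (Matrix.of fun r s : Fin K => V r s.castSucc - V (r + 1) s.castSucc).det := by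
  rw [← Matrix.det_sub_succ_row, Matrix.det_succ_column _ (Fin.last K), Fin.sum_univ_castSucc]
  rw [Finset.sum_eq_zero]
  · simp [hV, ← two_mul]
    congr 1
    ext r s
    simp
  · intro i _
    simp [hV]

-- Row r involves only the component b r. So each product in the expansion over permutations can be
-- summed factor by factor.
open scoped PowerSeries.WithPiTopology in
theorem hasSum_det {k : ℕ} {β : Fin k → Type*} {w : ∀ r, Fin k → β r → ℕ}
    {S : Matrix (Fin k) (Fin k) ℚ⟦X⟧} (hw : ∀ r s, FiniteWeights (w r s))
    (hS : ∀ r s, HasSum (fun b => (X : ℚ⟦X⟧) ^ w r s b) (S r s)) :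
    HasSum (fun b : ∀ r, β r => (Matrix.of fun r s => (X : ℚ⟦X⟧) ^ w r s (b r)).det) S.det := by
  simp_rw [← Matrix.det_transpose (M := Matrix.of _), ← Matrix.det_transpose (M := S),
    Matrix.det_apply']
  apply hasSum_sum
  intro σ _
  apply HasSum.mul_left
  have h := hasSum_X_pow_pi (fun r => hw r (σ r)) (fun r => hS r (σ r))
  refine h.congr_fun fun b => ?_
  rw [← Finset.prod_pow_eq_pow_sum]
  rfl

end Determinant

section RowSum

open scoped PowerSeries.WithPiTopology

theorem hasSum_Ici {e : ℕ} (he : 1 ≤ e) (a r : ℕ) :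
    HasSum ((Set.Ici a).indicator fun b => (X : ℚ⟦X⟧) ^ ((b + r) * e))
      (geom e * X ^ ((a + r) * e)) := by
  rw [← hasSum_subtype_iff_indicator]
  let f : ℕ ≃ Set.Ici a :=
    { toFun := fun n => ⟨a + n, Nat.le_add_right _ _⟩
      invFun := fun b => b.1 - a
      left_inv := fun n => Nat.add_sub_cancel_left _ _
      right_inv := fun b => Subtype.ext (Nat.add_sub_of_le b.2) }
  rw [← f.hasSum_iff]
  refine ((hasSum_geom he).mul_right (X ^ ((a + r) * e))).congr_fun fun n => ?_
  change (X : ℚ⟦X⟧) ^ ((a + n + r) * e) = _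
  ring

/-- A geometric series, cut off after a' when `p` holds. The first omitted term b = a' + 1 has the
exponent (a' + (r + 1)) * e, which is the exponent that a' produces in the next row. For this reason
the differences telescope under row operations. -/
theorem hasSum_row {e : ℕ} (he : 1 ≤ e) (a r a' : ℕ) (p : Prop) [Decidable p] (h : p → a ≤ a') :
    HasSum (fun b : {b : ℕ // a ≤ b ∧ (p → b ≤ a')} => (X : ℚ⟦X⟧) ^ ((b.1 + r) * e))
      (geom e * (X ^ ((a + r) * e) - if p then X ^ ((a' + (r + 1)) * e) else 0)) := by
  change HasSum ((fun b => (X : ℚ⟦X⟧) ^ ((b + r) * e)) ∘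
    ((↑) : {b : ℕ | a ≤ b ∧ (p → b ≤ a')} → ℕ)) _
  rw [hasSum_subtype_iff_indicator]
  by_cases hp : p
  · have h₁ := (hasSum_Ici he a r).sub (hasSum_Ici he (a' + 1) r)
    rw [← mul_sub, add_assoc a', add_comm 1 r] at h₁
    rw [if_pos hp]
    refine h₁.congr_fun fun b => ?_
    have := h hp
    simp only [Set.indicator, Set.mem_Ici, Set.mem_ofPred_eq, hp, true_implies]
    split_ifs <;> first | omega | simp
  · rw [if_neg hp, sub_zero]
    refine (hasSum_Ici he a r).congr_fun fun b => ?_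
    simp only [Set.indicator, Set.mem_Ici, Set.mem_ofPred_eq, hp, false_implies, and_true]

end RowSum

/-! ### Fillings, and the removal of their entries of content one -/

section Filling

/-- The entry to the left of the entry of content `d + 1` in row `r`: a diagonal entry if
`d = 0`. -/
def prevDiag (a : ℕ → ℕ) (τ : ℕ → ℕ → ℕ) : ℕ → ℕ → ℕ
  | 0, r => a r
  | d + 1, r => τ d r

/-- `τ d r` is the entry of content `d + 1` in row `r < k` of a shifted diagram with `l r`
off-diagonal cells in row `r` and the diagonal entries `a`. -/
def IsFilling (k : ℕ) (l a : ℕ → ℕ) (τ : ℕ → ℕ → ℕ) : Prop :=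
  ∀ d r, (r < k → d < l r → prevDiag a τ d r ≤ τ d r ∧
    (r + 1 < k → d ≤ l (r + 1) → τ d r ≤ prevDiag a τ d (r + 1))) ∧
    (¬ (r < k ∧ d < l r) → τ d r = 0)

/-- The fillings of a shifted diagram with given diagonal entries. -/
def Filling (k : ℕ) (l a : ℕ → ℕ) : Type := {τ : ℕ → ℕ → ℕ // IsFilling k l a τ}

variable {k k' : ℕ} {l a : ℕ → ℕ}

/-- The sum of the entries off the diagonal. -/
def Filling.weight (τ : Filling k l a) : ℕ := ∑ r ∈ Finset.range k, ∑ d ∈ Finset.range (l r), τ.1 d r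

theorem Filling.finiteWeights : FiniteWeights (Filling.weight : Filling k l a → ℕ) := by
  have h := (finiteWeights_sum (Σ r : Fin k, Fin (l r))).comp
    (f := fun (τ : Filling k l a) p => τ.1 p.2 p.1) (by
      intro τ τ' h
      refine Subtype.ext (funext fun d => funext fun r => ?_)
      by_cases hc : r < k ∧ d < l r
      · exact congrFun h ⟨⟨r, hc.1⟩, ⟨d, hc.2⟩⟩
      · rw [(τ.2 d r).2 hc, (τ'.2 d r).2 hc])
  refine h.mono fun τ => le_of_eq ?_
  rw [Function.comp_apply, Fintype.sum_sigma, Filling.weight, ← Fin.sum_univ_eq_sum_range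
    (fun r => ∑ d ∈ Finset.range (l r), τ.1 d r)]
  refine Finset.sum_congr rfl fun r _ => ?_
  exact Fin.sum_univ_eq_sum_range (fun d => τ.1 d r) (l r)

/-- The possible entries of content one of a filling, row by row. -/
abbrev FirstEntries (k k' : ℕ) (a : ℕ → ℕ) : Type :=
  ∀ r : Fin k', {b : ℕ // a r ≤ b ∧ ((r : ℕ) + 1 < k → b ≤ a (r + 1))}

/-- The entries of content one, extended by zero. -/
def FirstEntries.ext (b : FirstEntries k k' a) (r : ℕ) : ℕ :=
  if h : r < k' then (b ⟨r, h⟩).1 else 0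

theorem FirstEntries.ext_fin (b : FirstEntries k k' a) (r : Fin k') : b.ext r = (b r).1 := by
  rw [FirstEntries.ext, dif_pos r.2]

theorem FirstEntries.ext_injective :
    Function.Injective (FirstEntries.ext : FirstEntries k k' a → ℕ → ℕ) := fun b b' h => by
  funext r
  apply Subtype.ext
  rw [← b.ext_fin, ← b'.ext_fin, h]

/-- The entries of content one of a filling. -/
def Filling.first (hk : ∀ r, r < k' ↔ r < k ∧ 0 < l r) (τ : Filling k l a) : FirstEntries k k' a :=
  fun r => ⟨τ.1 0 r, by
    have h := (hk r).1 r.2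
    have := (τ.2 0 r).1 h.1 h.2
    exact ⟨this.1, fun g => this.2 g (Nat.zero_le _)⟩⟩

theorem Filling.ext_first (hk : ∀ r, r < k' ↔ r < k ∧ 0 < l r) (τ : Filling k l a) :
    (τ.first hk).ext = τ.1 0 := by
  funext r
  by_cases h : r < k'
  · exact FirstEntries.ext_fin _ (⟨r, h⟩ : Fin k')
  · exact (dif_neg h).trans ((τ.2 0 r).2 fun h' => h ((hk r).2 h')).symm

/-- The entries of content one interlace with the diagonal entries and take over the role of the
diagonal for the smaller diagram that remains. The number k' counts the rows that have an
off-diagonal cell. -/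
theorem isFilling_iff (hk : ∀ r, r < k' ↔ r < k ∧ 0 < l r) (τ : ℕ → ℕ → ℕ) :
    IsFilling k l a τ ↔ (∃ b : FirstEntries k k' a, b.ext = τ 0) ∧
      IsFilling k' (fun r => l r - 1) (τ 0) fun d => τ (d + 1) := by
  have e : ∀ d r, prevDiag (τ 0) (fun d => τ (d + 1)) d r = τ d r := by
    rintro (_ | d) r <;> rfl
  constructor
  · intro h
    refine ⟨⟨_, Filling.ext_first hk ⟨τ, h⟩⟩, fun d r => ?_⟩
    have hx := h (d + 1) r
    have h₁ := hk r
    have h₂ := hk (r + 1)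
    simp only [e]
    constructor
    · intro g₁ g₂
      have := hx.1 (by omega) (by omega)
      exact ⟨this.1, fun g₃ g₄ => this.2 (by omega) (by omega)⟩
    · intro g
      exact hx.2 (by omega)
  · rintro ⟨⟨b, hb⟩, h⟩ d r
    have h₁ := hk r
    have h₂ := hk (r + 1)
    rcases d with _ | d
    · change (_ → _ → a r ≤ τ 0 r ∧ (_ → _ → τ 0 r ≤ a (r + 1))) ∧ (_ → τ 0 r = 0)
      rw [← hb]
      constructor
      · intro g₁ g₂
        have g := (hk r).2 ⟨g₁, g₂⟩
        rw [show b.ext r = _ from b.ext_fin ⟨r, g⟩]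
        exact ⟨(b ⟨r, g⟩).2.1, fun g' _ => (b ⟨r, g⟩).2.2 g'⟩
      · intro g
        rw [FirstEntries.ext, dif_neg fun h' => g ((hk r).1 h')]
    · have hx := h d r
      simp only [e] at hx
      change (_ → _ → τ d r ≤ τ (d + 1) r ∧ (_ → _ → τ (d + 1) r ≤ τ d (r + 1))) ∧ _
      constructor
      · intro g₁ g₂
        have := hx.1 (by omega) (by omega)
        exact ⟨this.1, fun g₃ g₄ => this.2 (by omega) (by omega)⟩
      · intro g
        exact hx.2 (by omega)

/-- Removing the entries of content one of a filling. -/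
noncomputable def peelEquiv (hk : ∀ r, r < k' ↔ r < k ∧ 0 < l r) :
    (Σ b : FirstEntries k k' a, Filling k' (fun r => l r - 1) b.ext) ≃ Filling k l a :=
  Equiv.ofBijective (fun x => ⟨fun d => prevDiag x.1.ext x.2.1 d,
    (isFilling_iff hk _).2 ⟨⟨x.1, rfl⟩, x.2.2⟩⟩) (by
    constructor
    · rintro ⟨b, τ⟩ ⟨b', τ'⟩ h
      have h := congrArg Subtype.val h
      obtain rfl : b = b' := FirstEntries.ext_injective (congrFun h 0)
      obtain rfl : τ = τ' := Subtype.ext (funext fun d => congrFun h (d + 1))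
      rfl
    · intro τ
      refine ⟨⟨τ.first hk, ⟨fun d => τ.1 (d + 1), ?_⟩⟩, ?_⟩
      · rw [τ.ext_first hk]
        exact ((isFilling_iff hk _).1 τ.2).2
      · refine Subtype.ext (funext fun d => ?_)
        rcases d with _ | d
        · exact τ.ext_first hk
        · rfl)

theorem weight_peelEquiv (hk : ∀ r, r < k' ↔ r < k ∧ 0 < l r)
    (x : Σ b : FirstEntries k k' a, Filling k' (fun r => l r - 1) b.ext) :
    (peelEquiv hk x).weight = ∑ r, (x.1 r).1 + x.2.weight := by
  have hkk : k' ≤ k := by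
    by_contra h
    have := (hk k).1 (by omega)
    omega
  have e : (peelEquiv hk x).weight = ∑ r ∈ Finset.range k, ∑ d ∈ Finset.range (l r),
    prevDiag x.1.ext x.2.1 d r := rfl
  rw [e, ← Finset.sum_subset (Finset.range_mono hkk) fun r h₁ h₂ => by
    have : ¬ 0 < l r := fun h => h₂ (Finset.mem_range.2 ((hk r).2 ⟨Finset.mem_range.1 h₁, h⟩))
    rw [show l r = 0 by omega, Finset.sum_range_zero]]
  rw [Finset.sum_congr rfl fun r hr => by
    have := ((hk r).1 (Finset.mem_range.1 hr)).2
    rw [show l r = l r - 1 + 1 by omega, Finset.sum_range_succ'], Finset.sum_add_distrib, add_comm]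
  congr 1
  rw [← Fin.sum_univ_eq_sum_range]
  exact Finset.sum_congr rfl fun r _ => x.1.ext_fin r

end Filling

section FillingGF

open scoped PowerSeries.WithPiTopology

variable {k k' : ℕ} {l a : ℕ → ℕ}

theorem firstEntries_monotone (hk : ∀ r, r < k' ↔ r < k ∧ 0 < l r) (b : FirstEntries k k' a) (r : ℕ)
    (hr : r + 1 < k') : b.ext r ≤ b.ext (r + 1) := by
  have h := ((hk (r + 1)).1 hr).1
  rw [show b.ext r = _ from b.ext_fin ⟨r, by omega⟩, show b.ext (r + 1) = _ from b.ext_fin ⟨r + 1, hr⟩]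
  exact ((b ⟨r, by omega⟩).2.2 h).trans (b ⟨r + 1, hr⟩).2.1

/-- The generating function of the fillings with given diagonal entries. -/
noncomputable def fillingGF (k : ℕ) (l a : ℕ → ℕ) : ℚ⟦X⟧ := ∑' τ : Filling k l a, X ^ τ.weight

theorem hasSum_fillingGF : HasSum (fun τ : Filling k l a => (X : ℚ⟦X⟧) ^ τ.weight) (fillingGF k l a) :=
  Filling.finiteWeights.summable.hasSum

theorem hasSum_firstEntries (hk : ∀ r, r < k' ↔ r < k ∧ 0 < l r) :
    HasSum (fun b : FirstEntries k k' a => (X : ℚ⟦X⟧) ^ (∑ r, (b r).1) *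
      fillingGF k' (fun r => l r - 1) b.ext) (fillingGF k l a) := by
  refine HasSum.sigma ((peelEquiv hk).hasSum_iff.2 hasSum_fillingGF) fun b => ?_
  refine (hasSum_fillingGF.mul_left ((X : ℚ⟦X⟧) ^ (∑ r, (b r).1))).congr_fun fun τ => ?_
  rw [Function.comp_apply, weight_peelEquiv, pow_add]

/-- The determinant that counts fillings. -/
noncomputable def fillingDet (k : ℕ) (l a : ℕ → ℕ) : ℚ⟦X⟧ :=
  (Matrix.of fun r s : Fin k => (X : ℚ⟦X⟧) ^ ((a r + r) * l s)).det

/-- The factor X ^ (b_r + r) raises the exponents (b_r + r)(l_s - 1) of row r to (b_r + r) l_s. By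
multilinearity each row is then summed separately with `hasSum_row`. -/
theorem hasSum_fillingDet (hk : ∀ r, r < k' ↔ r < k ∧ 0 < l r)
    (ha : ∀ r, r + 1 < k → a r ≤ a (r + 1)) :
    HasSum (fun b : FirstEntries k k' a => (X : ℚ⟦X⟧) ^ (∑ r : Fin k', ((b r).1 + r)) *
      fillingDet k' (fun r => l r - 1) b.ext)
      ((∏ r ∈ Finset.range k', geom (l r)) * (Matrix.of fun r s : Fin k' =>
        (X : ℚ⟦X⟧) ^ ((a r + r) * l s) - if (r : ℕ) + 1 < k then X ^ ((a (r + 1) + (r + 1)) * l s)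
          else 0).det) := by
  have hl : ∀ s : Fin k', 1 ≤ l s := fun s => ((hk s).1 s.2).2
  rw [← Fin.prod_univ_eq_prod_range, ← Matrix.det_mul_row]
  have h := hasSum_det (k := k')
    (β := fun r : Fin k' => {b : ℕ // a r ≤ b ∧ ((r : ℕ) + 1 < k → b ≤ a (r + 1))})
    (w := fun r s b => (b.1 + r) * l s) (S := Matrix.of fun r s : Fin k' =>
      geom (l s) * (X ^ ((a r + r) * l s) - if (r : ℕ) + 1 < k then
        X ^ ((a (r + 1) + (r + 1)) * l s) else 0)) (fun r s => ?_) fun r s => by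
    rw [Matrix.of_apply]
    exact hasSum_row (hl s) (a r) r (a (r + 1)) ((r : ℕ) + 1 < k) (ha r)
  refine h.congr_fun fun b => ?_
  rotate_left
  · refine (finiteWeights_id.comp Subtype.val_injective).mono fun b => ?_
    exact (Nat.le_add_right _ _).trans (Nat.le_mul_of_pos_right _ (hl s))
  · rw [fillingDet, ← Finset.prod_pow_eq_pow_sum, ← Matrix.det_mul_column]
    congr 1
    ext1 r s
    rw [Matrix.of_apply, Matrix.of_apply, Matrix.of_apply, FirstEntries.ext_fin, ← pow_add]
    congr 1
    obtain ⟨e, he⟩ := Nat.exists_eq_add_of_le (hl s)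
    rw [he, Nat.add_sub_cancel_left]
    ring

/-- Induction on the row lengths: both sides obey the recursion of removing the entries of content
one (`hasSum_firstEntries`, `hasSum_fillingDet`), the determinant after row operations. The power of
X on the left compensates for the shift by r in the exponents (a_r + r) l_s, which makes these row
operations possible. -/
theorem X_pow_mul_fillingGF : ∀ (D k : ℕ) (l a : ℕ → ℕ), (∀ r, r + 1 < k → l (r + 1) < l r) →
    (∀ r, r < k → l r ≤ D) → (∀ r, r + 1 < k → a r ≤ a (r + 1)) →
    (X : ℚ⟦X⟧) ^ (∑ r ∈ Finset.range k, r * l r) * fillingGF k l a =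
      (∏ r ∈ Finset.range k, ∏ i ∈ Finset.Icc 1 (l r), geom i) * fillingDet k l a := by
  have base : ∀ (k : ℕ) (l a : ℕ → ℕ), k ≤ 1 → (∀ r, r < k → l r = 0) →
      (X : ℚ⟦X⟧) ^ (∑ r ∈ Finset.range k, r * l r) * fillingGF k l a =
      (∏ r ∈ Finset.range k, ∏ i ∈ Finset.Icc 1 (l r), geom i) * fillingDet k l a := by
    intro k l a hk hl
    have hs : ∀ τ : Filling k l a, τ.1 = fun _ _ => 0 := fun τ => by
      funext d r
      exact (τ.2 d r).2 fun h => by rw [hl r h.1] at h; omega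
    have hf : IsFilling k l a fun _ _ => 0 := fun d r =>
      ⟨fun h₁ h₂ => by rw [hl r h₁] at h₂; omega, fun _ => rfl⟩
    let τ₀ : Filling k l a := ⟨_, hf⟩
    have : Unique (Filling k l a) := ⟨⟨τ₀⟩, fun τ => Subtype.ext (hs τ)⟩
    have hw : ∀ τ : Filling k l a, τ.weight = 0 := fun τ => by
      rw [Filling.weight, hs τ]
      simp
    have hG : fillingGF k l a = 1 := by
      rw [fillingGF, tsum_fintype]
      simp [hw]
    rw [hG, Finset.sum_eq_zero fun r hr => by rw [hl r (Finset.mem_range.1 hr), mul_zero],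
      Finset.prod_eq_one fun r hr => by rw [hl r (Finset.mem_range.1 hr)]; rfl]
    obtain rfl | rfl : k = 0 ∨ k = 1 := by omega
    · simp [fillingDet]
    · simp [fillingDet, hl 0 (by omega)]
  intro D
  induction D with
  | zero =>
    intro k l a hl hD ha
    refine base k l a ?_ fun r hr => Nat.le_zero.1 (hD r hr)
    by_contra hk
    have := hl 0 (by omega)
    have := hD 0 (by omega)
    omega
  | succ D ih =>
    intro k l a hl hD ha
    have hmono : ∀ s r, r + s < k → l (r + s) + s ≤ l r := by
      intro s
      induction s with
      | zero => intro r h; exact le_rfl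
      | succ s ihs =>
        intro r h
        have h₁ := ihs r (by omega)
        have h₂ := hl (r + s) h
        change l (r + s + 1) + (s + 1) ≤ l r
        omega
    -- The row lengths decrease strictly, so only the last row can be without cells.
    obtain ⟨k', hkk, hk⟩ : ∃ k', (k' = k ∨ (k = k' + 1 ∧ l k' = 0)) ∧ ∀ r, r < k' ↔ r < k ∧ 0 < l r := by
      rcases k with _ | k
      · exact ⟨0, Or.inl rfl, fun r => by omega⟩
      · by_cases h0 : l k = 0
        · refine ⟨k, Or.inr ⟨rfl, h0⟩, fun r => ⟨fun h => ⟨by omega, ?_⟩, fun h => ?_⟩⟩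
          · have := hmono (k - r) r (by omega)
            omega
          · obtain ⟨h₁, h₂⟩ := h
            rcases Nat.lt_succ_iff_lt_or_eq.1 h₁ with h | rfl
            · exact h
            · omega
        · refine ⟨k + 1, Or.inl rfl, fun r => ⟨fun h => ⟨h, ?_⟩, fun h => h.1⟩⟩
          have := hmono (k - r) r (by omega)
          rw [Nat.add_sub_of_le (by omega)] at this
          omega
    have hsub : ∀ f : ℕ → ℕ, (∀ r, r < k → l r = 0 → f r = 0) →
        ∑ r ∈ Finset.range k, f r = ∑ r ∈ Finset.range k', f r := fun f hf => by
      rcases hkk with rfl | ⟨rfl, h0⟩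
      · rfl
      · rw [Finset.sum_range_succ, hf _ (by omega) h0, add_zero]
    have hprod : ∏ r ∈ Finset.range k, ∏ i ∈ Finset.Icc 1 (l r), geom i =
        (∏ r ∈ Finset.range k', ∏ i ∈ Finset.Icc 1 (l r - 1), geom i) *
          ∏ r ∈ Finset.range k', geom (l r) := by
      have e : ∏ r ∈ Finset.range k, ∏ i ∈ Finset.Icc 1 (l r), geom i =
          ∏ r ∈ Finset.range k', ∏ i ∈ Finset.Icc 1 (l r), geom i := by
        rcases hkk with rfl | ⟨rfl, h0⟩
        · rfl
        · rw [Finset.prod_range_succ, h0]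
          simp
      rw [e, ← Finset.prod_mul_distrib]
      refine Finset.prod_congr rfl fun r hr => ?_
      have := ((hk r).1 (Finset.mem_range.1 hr)).2
      obtain ⟨j, hj⟩ : ∃ j, l r = j + 1 := ⟨l r - 1, by omega⟩
      rw [hj, Finset.prod_Icc_succ_top (by omega), Nat.add_sub_cancel]
    -- If the last row has no cells, the last column of the determinant consists of ones, and its
    -- size drops by one. Otherwise successive rows are merely subtracted.
    have hdet : fillingDet k l a = (Matrix.of fun r s : Fin k' =>
        (X : ℚ⟦X⟧) ^ ((a r + r) * l s) - if (r : ℕ) + 1 < k then X ^ ((a (r + 1) + (r + 1)) * l s)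
          else 0).det := by
      rcases hkk with rfl | ⟨rfl, h0⟩
      · rcases k' with _ | K
        · simp [fillingDet]
        · exact (Matrix.det_sub_succ_row fun r (s : Fin (K + 1)) =>
            (X : ℚ⟦X⟧) ^ ((a r + r) * l s)).symm
      · rw [fillingDet, Matrix.det_eq_det_sub_of_last_eq_one (fun r (s : Fin (k' + 1)) =>
            (X : ℚ⟦X⟧) ^ ((a r + r) * l s)) (by simp [h0])]
        congr 1
        ext1 r s
        have := r.2
        simp only [Matrix.of_apply]
        rw [if_pos (by omega)]
        rfl
    rw [hprod, hdet, mul_assoc]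
    have h₁ := (hasSum_fillingDet hk ha).mul_left
      (∏ r ∈ Finset.range k', ∏ i ∈ Finset.Icc 1 (l r - 1), geom i)
    have h₂ := (hasSum_firstEntries (a := a) hk).mul_left ((X : ℚ⟦X⟧) ^ (∑ r ∈ Finset.range k, r * l r))
    refine h₂.unique (h₁.congr_fun fun b => ?_)
    have ih' := ih k' (fun r => l r - 1) b.ext (fun r hr => by
      have := (hk (r + 1)).1 hr
      have := hl r this.1
      change l (r + 1) - 1 < l r - 1
      omega) (fun r hr => by
      have := (hk r).1 hr
      have := hD r this.1
      change l r - 1 ≤ D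
      omega) (firstEntries_monotone hk b)
    rw [hsub _ fun r _ h => by rw [h, mul_zero]]
    -- Shortening all rows by one changes the exponent by ∑ r, which is supplied by the factors X ^
    -- (b_r + r).
    have e : ∑ r ∈ Finset.range k', r * l r =
        ∑ r ∈ Finset.range k', r * (l r - 1) + ∑ r : Fin k', (r : ℕ) := by
      rw [Fin.sum_univ_eq_sum_range (fun r => r), ← Finset.sum_add_distrib]
      refine Finset.sum_congr rfl fun r hr => ?_
      have := ((hk r).1 (Finset.mem_range.1 hr)).2
      obtain ⟨j, hj⟩ : ∃ j, l r = j + 1 := ⟨l r - 1, by omega⟩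
      rw [hj, Nat.add_sub_cancel]
      ring
    rw [e, Finset.sum_add_distrib, pow_add, pow_add]
    linear_combination ((X : ℚ⟦X⟧) ^ (∑ r, (b r).1) * X ^ (∑ r : Fin k', (r : ℕ))) * ih'

end FillingGF

/-- Go along row r' to column c and then down this column to row r. As the row lengths decrease
strictly, the path stays inside the diagram. -/
theorem Filling.prevDiag_le {k : ℕ} {l a : ℕ → ℕ} (hl : ∀ r, r + 1 < k → l (r + 1) < l r)
    (τ : Filling k l a) {r c r' c' : ℕ} (h₁ : r' ≤ r) (h₂ : c' ≤ c) (h₃ : r' ≤ c') (h₄ : r ≤ c)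
    (hr : r < k) (hc : c ≤ r + l r) :
    prevDiag a τ.1 (c' - r') r' ≤ prevDiag a τ.1 (c - r) r := by
  have row : ∀ e d r, r < k → d + e ≤ l r → prevDiag a τ.1 d r ≤ prevDiag a τ.1 (d + e) r := by
    intro e
    induction e with
    | zero => intro d r _ _; exact le_rfl
    | succ e ih =>
      intro d r h h'
      exact (ih d r h (by omega)).trans ((τ.2 (d + e) r).1 h (by omega)).1
  have hls : ∀ s r, r + s < k → l (r + s) + s ≤ l r := by
    intro s
    induction s with
    | zero => intro r _; exact le_rfl
    | succ s ih =>
      intro r h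
      have h₁ := ih r (by omega)
      have h₂ := hl (r + s) h
      change l (r + s + 1) + (s + 1) ≤ l r
      omega
  have col : ∀ s d r, r + s < k → d ≤ l (r + s) →
      prevDiag a τ.1 (d + s) r ≤ prevDiag a τ.1 d (r + s) := by
    intro s
    induction s with
    | zero => intro d r _ _; exact le_rfl
    | succ s ih =>
      intro d r h h'
      have g := hl (r + s) h
      have g' : l (r + s + 1) < l (r + s) := g
      have h'' : d ≤ l (r + s + 1) := h'
      refine le_trans ?_ (((τ.2 d (r + s)).1 (by omega) (by omega)).2 h h')
      have := ih (d + 1) r (by omega) (by omega)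
      rwa [add_assoc, add_comm 1 s] at this
  obtain ⟨s, rfl⟩ := Nat.exists_eq_add_of_le h₁
  have := hls s r' hr
  refine (row (c - c') (c' - r') r' (by omega) (by omega)).trans ?_
  have := col s (c - (r' + s)) r' hr (by omega)
  rwa [show c - (r' + s) + s = c' - r' + (c - c') by omega] at this

/-! ### Order-reversing maps as fillings over a chain -/

namespace AttachedPoset

variable {n k : ℕ} {X : Fin k → Attachment n}

/-- The number of cells off the diagonal in row `r` of a shifted diagram. -/
def _root_.Attachment.offLen (A : Attachment n) (r : ℕ) : ℕ := A.shape.rowLen r + A.size - 1 - r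

theorem _root_.Attachment.mem_offDiagCells' (A : Attachment n) (p : ℕ × ℕ) :
    p ∈ A.offDiagCells ↔ p.1 < A.size ∧ p.1 < p.2 ∧ p.2 ≤ p.1 + A.offLen p.1 := by
  rw [A.mem_offDiagCells, Attachment.offLen]
  omega

theorem _root_.Attachment.offLen_lt (A : Attachment n) (r : ℕ) (h : r + 1 < A.size) :
    A.offLen (r + 1) < A.offLen r := by
  have := A.shape.rowLen_anti r (r + 1) (by omega)
  rw [Attachment.offLen, Attachment.offLen]
  omega

theorem _root_.Attachment.diagPos_lt (A : Attachment n) (r : ℕ) : A.diagPos r < n := by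
  have := A.le_bound
  have := A.one_le_start
  have := A.one_le_size
  unfold Attachment.diagPos
  omega

/-- The diagonal entries of an attachment. -/
def diagVal (y : Fin n → ℕ) (A : Attachment n) (r : ℕ) : ℕ := y ⟨A.diagPos r, A.diagPos_lt r⟩

/-- The entries of the chain and of the attachments. -/
def ofFillings (x : Σ y : {y : Fin n → ℕ // Antitone y}, ∀ i,
    Filling (X i).size (X i).offLen (diagVal y.1 (X i))) : AttachedPoset 0 X → ℕ
  | .inl a => x.1.1 a
  | .inr ⟨i, p⟩ => prevDiag (diagVal x.1.1 (X i)) (x.2 i).1 (p.1.2 - p.1.1) p.1.1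

theorem antitone_ofFillings (x : Σ y : {y : Fin n → ℕ // Antitone y}, ∀ i,
    Filling (X i).size (X i).offLen (diagVal y.1 (X i))) : Antitone (ofFillings x) := by
  have diag : ∀ i r, prevDiag (diagVal x.1.1 (X i)) (x.2 i).1 (r - r) r =
      x.1.1 ⟨_, (X i).diagPos_lt r⟩ := fun i r => by
    rw [Nat.sub_self]; rfl
  have toDiag : ∀ i (p : (X i).offDiagCells),
      x.1.1 ⟨_, (X i).diagPos_lt p.1.1⟩ ≤ ofFillings x (.inr ⟨i, p⟩) := fun i p => by
    obtain ⟨h₁, h₂, h₃⟩ := ((X i).mem_offDiagCells' _).1 p.2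
    rw [← diag]
    exact (x.2 i).prevDiag_le (X i).offLen_lt le_rfl h₂.le le_rfl h₂.le h₁ h₃
  have ofDiag : ∀ i (p : (X i).offDiagCells), p.1.2 < (X i).size →
      ofFillings x (.inr ⟨i, p⟩) ≤ x.1.1 ⟨_, (X i).diagPos_lt p.1.2⟩ := fun i p h => by
    obtain ⟨h₁, h₂, h₃⟩ := ((X i).mem_offDiagCells' _).1 p.2
    rw [← diag]
    exact (x.2 i).prevDiag_le (X i).offLen_lt h₂.le le_rfl h₂.le le_rfl h (Nat.le_add_right _ _)
  rintro (a | ⟨i, p⟩) (b | ⟨j, q⟩) h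
  · exact x.1.2 h
  · exact (ofDiag j q h.1).trans (x.1.2 h.2)
  · exact (x.1.2 (a := ⟨_, (X i).diagPos_lt p.1.1⟩) h).trans (toDiag i p)
  · rcases h with ⟨rfl, h₁, h₂⟩ | ⟨h₁, h₂⟩
    · obtain ⟨h₃, h₄, h₅⟩ := ((X i).mem_offDiagCells' _).1 p.2
      obtain ⟨h₆, h₇, h₈⟩ := ((X i).mem_offDiagCells' _).1 q.2
      exact (x.2 i).prevDiag_le (X i).offLen_lt h₁ h₂ h₇.le h₄.le h₃ h₅
    · exact ((ofDiag j q h₁).trans (x.1.2 (a := ⟨_, (X i).diagPos_lt p.1.1⟩) h₂)).trans (toDiag i p)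

theorem ofFillings_injective : Function.Injective (ofFillings (X := X)) := by
  rintro ⟨y, τ⟩ ⟨y', τ'⟩ h
  obtain rfl : y = y' := Subtype.ext (funext fun a => congrFun h (.inl a))
  obtain rfl : τ = τ' := by
    funext i
    refine Subtype.ext (funext fun d => funext fun r => ?_)
    by_cases hc : r < (X i).size ∧ d < (X i).offLen r
    · have hm : (r, r + (d + 1)) ∈ (X i).offDiagCells :=
        ((X i).mem_offDiagCells' _).2 ⟨hc.1, by simp, by simp; omega⟩
      have := congrFun h (.inr ⟨i, ⟨_, hm⟩⟩)
      simp only [ofFillings, Nat.add_sub_cancel_left] at this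
      exact this
    · rw [((τ i).2 d r).2 hc, ((τ' i).2 d r).2 hc]
  rfl

theorem exists_ofFillings {σ : AttachedPoset 0 X → ℕ} (hσ : Antitone σ) :
    ∃ x, ofFillings x = σ := by
  let y : {y : Fin n → ℕ // Antitone y} := ⟨fun a => σ (.inl a), fun a b h => hσ h⟩
  let τ : Fin k → ℕ → ℕ → ℕ := fun i d r =>
    if h : (r, r + (d + 1)) ∈ (X i).offDiagCells then σ (.inr ⟨i, ⟨_, h⟩⟩) else 0
  have mem : ∀ i d r, (r, r + (d + 1)) ∈ (X i).offDiagCells ↔ r < (X i).size ∧ d < (X i).offLen r :=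
    fun i d r => by
      rw [(X i).mem_offDiagCells']
      simp only
      omega
  have hτ : ∀ i, IsFilling (X i).size (X i).offLen (diagVal y.1 (X i)) (τ i) := by
    intro i d r
    refine ⟨fun h₁ h₂ => ?_, fun h => dif_neg fun h' => h ((mem i d r).1 h')⟩
    have hm := (mem i d r).2 ⟨h₁, h₂⟩
    have e : τ i d r = _ := dif_pos hm
    rw [e]
    rcases d with _ | d
    · constructor
      · exact hσ (a := .inr ⟨i, ⟨_, hm⟩⟩) (b := .inl ⟨_, (X i).diagPos_lt r⟩)
          (show (X i).diagPos r ≤ (X i).diagPos r from le_rfl)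
      · intro h₃ _
        exact hσ (a := .inl ⟨_, (X i).diagPos_lt (r + 1)⟩) (b := .inr ⟨i, ⟨_, hm⟩⟩)
          ⟨h₃, le_refl ((X i).diagPos (r + 1))⟩
    · constructor
      · have hm' := (mem i d r).2 ⟨h₁, by omega⟩
        have e' : τ i d r = _ := dif_pos hm'
        change τ i d r ≤ _
        rw [e']
        exact hσ (Or.inl ⟨rfl, le_rfl, by simp⟩)
      · intro h₃ h₄
        have hm' := (mem i d (r + 1)).2 ⟨h₃, by omega⟩
        have e' : τ i d (r + 1) = _ := dif_pos hm'
        change _ ≤ τ i d (r + 1)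
        rw [e']
        exact hσ (Or.inl ⟨rfl, by simp, by simp; omega⟩)
  refine ⟨⟨y, fun i => ⟨τ i, hτ i⟩⟩, ?_⟩
  funext x
  rcases x with a | ⟨i, ⟨r, c⟩, hp⟩
  · rfl
  · obtain ⟨h₁, h₂, h₃⟩ := ((X i).mem_offDiagCells' _).1 hp
    simp only at h₁ h₂ h₃
    obtain ⟨d, rfl⟩ : ∃ d, c = r + (d + 1) := ⟨c - r - 1, by omega⟩
    simp only [ofFillings, Nat.add_sub_cancel_left]
    exact dif_pos hp

/-- The order-reversing maps as fillings. -/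
noncomputable def fillingsEquiv : (Σ y : {y : Fin n → ℕ // Antitone y}, ∀ i,
    Filling (X i).size (X i).offLen (diagVal y.1 (X i))) ≃
      {σ : AttachedPoset 0 X → ℕ // Antitone σ} :=
  Equiv.ofBijective (fun x => ⟨ofFillings x, antitone_ofFillings x⟩)
    ⟨fun _ _ h => ofFillings_injective (congrArg Subtype.val h), fun σ => by
      obtain ⟨x, hx⟩ := exists_ofFillings σ.2
      exact ⟨x, Subtype.ext hx⟩⟩

theorem sum_ofFillings (x : Σ y : {y : Fin n → ℕ // Antitone y}, ∀ i,
    Filling (X i).size (X i).offLen (diagVal y.1 (X i))) :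
    ∑ p, ofFillings x p = ∑ a, x.1.1 a + ∑ i, (x.2 i).weight := by
  have h := Fintype.sum_sum_type (α₁ := Fin n) (α₂ := Σ i, (X i).offDiagCells) fun p : AttachedPoset 0 X => ofFillings x p
  refine h.trans ?_
  congr 1
  rw [Fintype.sum_sigma]
  refine Finset.sum_congr rfl fun i _ => ?_
  have h₁ := Finset.sum_coe_sort (X i).offDiagCells fun p : ℕ × ℕ =>
    prevDiag (diagVal x.1.1 (X i)) (x.2 i).1 (p.2 - p.1) p.1
  refine h₁.trans ?_
  rw [Finset.sum_finset_product _ (Finset.range (X i).size)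
    (fun r => Finset.Icc (r + 1) (r + (X i).offLen r)) fun p => by
      rw [(X i).mem_offDiagCells', Finset.mem_range, Finset.mem_Icc]
      omega, Filling.weight]
  refine Finset.sum_congr rfl fun r _ => ?_
  refine Finset.sum_nbij' (fun c => c - r - 1) (fun d => r + (d + 1)) ?_ ?_ ?_ ?_ ?_ <;>
    simp only [Finset.mem_Icc, Finset.mem_range]
  · intro c h; omega
  · intro c h; omega
  · intro c h; omega
  · intro c h; omega
  · intro c h
    obtain ⟨d, rfl⟩ : ∃ d, c = r + (d + 1) := ⟨c - r - 1, by omega⟩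
    simp only [Nat.add_sub_cancel_left]
    rfl

-- Once the values on the chain are fixed, the attachments do not interact, and their generating
-- functions multiply.
open scoped PowerSeries.WithPiTopology in
variable (X) in
theorem hasSum_prod_fillingGF :
    HasSum (fun y : {y : Fin n → ℕ // Antitone y} => (PowerSeries.X : ℚ⟦X⟧) ^ (∑ a, y.1 a) *
      ∏ i, fillingGF (X i).size (X i).offLen (diagVal y.1 (X i)))
      (partitionGF (AttachedPoset 0 X)) := by
  refine HasSum.sigma (fillingsEquiv.hasSum_iff.2 (hasSum_partitionGF (AttachedPoset 0 X))) fun y => ?_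
  refine ((hasSum_X_pow_pi (fun i => Filling.finiteWeights (a := diagVal y.1 (X i)))
    fun i => hasSum_fillingGF).mul_left ((PowerSeries.X : ℚ⟦X⟧) ^ (∑ a, y.1 a))).congr_fun fun τ => ?_
  rw [← pow_add, ← sum_ofFillings ⟨y, τ⟩]
  rfl

end AttachedPoset

/-! ### Summation over the chain -/

section Alternating

variable {M : Type*} [AddCommGroup M]

/-- The alternating sum over the permutations of three arguments. -/
def alt₃ (f : ℕ → ℕ → ℕ → M) (a b c : ℕ) : M :=
  f a b c - f a c b - f b a c + f b c a + f c a b - f c b a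

/-- The alternating sum over the permutations of four arguments. -/
def alt₄ (f : ℕ → ℕ → ℕ → ℕ → M) (a b c d : ℕ) : M :=
  alt₃ (f a) b c d - alt₃ (f b) a c d + alt₃ (f c) a b d - alt₃ (f d) a b c

theorem hasSum_alt₄ [TopologicalSpace M] [IsTopologicalAddGroup M] {ι : Type*}
    {f : ι → ℕ → ℕ → ℕ → ℕ → M} {F : ℕ → ℕ → ℕ → ℕ → M}
    (h : ∀ a b c d, HasSum (fun i => f i a b c d) (F a b c d)) (a b c d : ℕ) :
    HasSum (fun i => alt₄ (f i) a b c d) (alt₄ F a b c d) := by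
  have h₃ : ∀ a b c d, HasSum (fun i => alt₃ (f i a) b c d) (alt₃ (F a) b c d) := fun a b c d =>
    (((((h a b c d).sub (h a b d c)).sub (h a c b d)).add (h a c d b)).add (h a d b c)).sub
      (h a d c b)
  exact (((h₃ a b c d).sub (h₃ b a c d)).add (h₃ c a b d)).sub (h₃ d a b c)

/-- Expansion along the first row. Grouping by the exponent of v 0 leaves alternating sums over
three arguments, which are evaluated first later on. -/
theorem det_fin_four_pow {R : Type*} [CommRing R] (v : ℕ → R) (l : ℕ → ℕ) :
    (Matrix.of fun r s : Fin 4 => v r ^ l s).det =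
      alt₄ (fun a b c d => v 0 ^ a * v 1 ^ b * v 2 ^ c * v 3 ^ d) (l 0) (l 1) (l 2) (l 3) := by
  rw [Matrix.det_succ_row_zero, Fin.sum_univ_four]
  simp only [Matrix.det_fin_three, Matrix.submatrix_apply, Matrix.of_apply, alt₄, alt₃]
  simp [Fin.succAbove, Fin.lt_def]
  ring

end Alternating

section ChainSum

open scoped PowerSeries.WithPiTopology

theorem HasSum.of_eq {M ι : Type*} [AddCommMonoid M] [TopologicalSpace M] {f g : ι → M} {a b : M}
    (h : HasSum f a) (hf : ∀ i, g i = f i) (hb : a = b) : HasSum g b := by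
  rw [funext hf, ← hb]
  exact h

/-- The coefficients in the sum over the least element of the chain. -/
noncomputable def chainAlpha : ℚ⟦X⟧ := X * (geom 1 - 2 * X * geom 2 + X ^ 2 * geom 3)
noncomputable def chainBeta : ℚ⟦X⟧ := X ^ 3 * (geom 2 - 2 * X * geom 3 + X ^ 2 * geom 4)

/-- The coefficient in the sum over the second element of the chain. -/
noncomputable def chainRho (d : ℕ) : ℚ⟦X⟧ :=
  chainAlpha * geom (4 + d) - (chainAlpha * X + chainBeta) * geom (5 + d) +
    chainBeta * X * geom (6 + d)

/-- The coefficient in the sums over a linear factor. -/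
noncomputable def chainKappa (e : ℕ) : ℚ⟦X⟧ := geom e - X * geom (e + 1)

/-- The coefficient in the sums over a square. -/
noncomputable def chainSq (e : ℕ) : ℚ⟦X⟧ := geom e - 2 * X * geom (e + 1) + X ^ 2 * geom (e + 2)

/-- This lemma and the next four sum out z₁, …, z₅ in turn; the remaining sum over z₆ is a plain
geometric series. The summed variable runs through the next one times X ^ n, and expanding the other
factors leaves finitely many geometric series. -/
theorem hasSum_chain_one (z₂ z₃ : ℚ⟦X⟧) :
    HasSum (fun n : ℕ => (z₂ * X ^ n) * (z₃ - X ^ 2 * (z₂ * X ^ n)) *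
      (X * z₂ - X ^ 2 * (z₂ * X ^ n)) * (z₂ - X * (z₂ * X ^ n)))
      (z₂ ^ 3 * (chainAlpha * z₃ - chainBeta * z₂)) := by
  have h := fun e (he : 1 ≤ e) => hasSum_mul_X_pow z₂ he
  have h' := ((((h 1 (by omega)).mul_left (X * z₂ ^ 2 * z₃)).add
    ((h 2 (by omega)).mul_left (-(2 * X ^ 2 * z₂ * z₃) - X ^ 3 * z₂ ^ 2))).add
    ((h 3 (by omega)).mul_left (X ^ 3 * z₃ + 2 * X ^ 4 * z₂))).add
    ((h 4 (by omega)).mul_left (-X ^ 5))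
  refine h'.of_eq (fun n => ?_) ?_
  · ring
  · rw [chainAlpha, chainBeta]; ring

theorem hasSum_chain_two (z₃ : ℚ⟦X⟧) (d : ℕ) :
    HasSum (fun n : ℕ => (z₃ * X ^ n) ^ (4 + d) * (chainAlpha * z₃ - chainBeta * (z₃ * X ^ n)) *
      (z₃ - X * (z₃ * X ^ n))) (z₃ ^ (6 + d) * chainRho d) := by
  have h := fun e (he : 1 ≤ e) => hasSum_mul_X_pow z₃ he
  have h' := (((h (4 + d) (by omega)).mul_left (chainAlpha * z₃ ^ 2)).sub
    ((h (5 + d) (by omega)).mul_left ((chainAlpha * X + chainBeta) * z₃))).add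
    ((h (6 + d) (by omega)).mul_left (chainBeta * X))
  refine h'.of_eq (fun n => ?_) ?_
  · generalize z₃ * X ^ n = t
    ring
  · rw [chainRho]; ring

theorem hasSum_chain_three (z₄ : ℚ⟦X⟧) {e : ℕ} (he : 1 ≤ e) :
    HasSum (fun n : ℕ => (z₄ * X ^ n) ^ e * (z₄ - X * (z₄ * X ^ n)))
      (z₄ ^ (e + 1) * chainKappa e) := by
  have h := fun e (he : 1 ≤ e) => hasSum_mul_X_pow z₄ he
  have h' := ((h e (by omega)).mul_left z₄).sub ((h (e + 1) (by omega)).mul_left X)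
  refine h'.of_eq (fun n => ?_) ?_
  · generalize z₄ * X ^ n = t
    ring
  · rw [chainKappa]; ring

theorem hasSum_chain_four (z₅ z₆ : ℚ⟦X⟧) {e : ℕ} (he : 1 ≤ e) :
    HasSum (fun n : ℕ => (z₅ * X ^ n) ^ e * (z₆ - X ^ 2 * (z₅ * X ^ n)) *
      (X * z₅ - X ^ 2 * (z₅ * X ^ n)))
      (X * z₅ ^ (e + 1) * (z₆ * chainKappa e - X ^ 2 * z₅ * chainKappa (e + 1))) := by
  have h := fun e (he : 1 ≤ e) => hasSum_mul_X_pow z₅ he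
  have h' := (((h e (by omega)).mul_left (X * z₅ * z₆)).sub
    ((h (e + 1) (by omega)).mul_left (X ^ 2 * z₆ + X ^ 3 * z₅))).add
    ((h (e + 2) (by omega)).mul_left (X ^ 4))
  refine h'.of_eq (fun n => ?_) ?_
  · generalize z₅ * X ^ n = t
    ring
  · rw [chainKappa, chainKappa]; ring

theorem hasSum_chain_five (z₆ c₁ c₂ : ℚ⟦X⟧) {e : ℕ} (he : 1 ≤ e) :
    HasSum (fun n : ℕ => (z₆ * X ^ n) ^ e * (z₆ * c₁ - X ^ 2 * (z₆ * X ^ n) * c₂) *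
      (z₆ - X * (z₆ * X ^ n)) ^ 2)
      (z₆ ^ (e + 3) * (c₁ * chainSq e - X ^ 2 * c₂ * chainSq (e + 1))) := by
  have h := fun e (he : 1 ≤ e) => hasSum_mul_X_pow z₆ he
  have h' := ((((h e (by omega)).mul_left (z₆ ^ 3 * c₁)).add
    ((h (e + 1) (by omega)).mul_left (z₆ ^ 2 * (-(2 * X * c₁) - X ^ 2 * c₂)))).add
    ((h (e + 2) (by omega)).mul_left (z₆ * (X ^ 2 * c₁ + 2 * X ^ 3 * c₂)))).sub
    ((h (e + 3) (by omega)).mul_left (X ^ 4 * c₂))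
  refine h'.of_eq (fun n => ?_) ?_
  · generalize z₆ * X ^ n = t
    ring
  · rw [chainSq, chainSq]; ring

/-- The factors of the summand that do not depend on the partition. -/
noncomputable def chainFactor (z₁ z₂ z₃ z₄ z₅ z₆ : ℚ⟦X⟧) : ℚ⟦X⟧ :=
  z₁ * z₂ * z₃ * z₄ * z₅ * z₆ * ((z₃ - X * z₂) * (z₃ - X ^ 2 * z₁) * (X * z₂ - X ^ 2 * z₁)) *
    (z₂ - X * z₁) * (z₄ - X * z₃) * ((z₆ - X * z₅) * (z₆ - X ^ 2 * z₄) * (X * z₅ - X ^ 2 * z₄)) *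
    (z₆ - X * z₅)

/-- As z₁ is X to the largest value on the chain, i.e. to the sum of all differences, this gives
summability over all six differences at once. -/
theorem dvd_chainFactor (z₁ z₂ z₃ z₄ z₅ z₆ : ℚ⟦X⟧) : z₁ ∣ chainFactor z₁ z₂ z₃ z₄ z₅ z₆ := by
  simp only [chainFactor, mul_assoc]
  exact dvd_mul_right _ _

/-- The sum over the chain of the term with the exponents `a, b, c, d`. -/
noncomputable def chainTotal (a b c d : ℕ) : ℚ⟦X⟧ :=
  X ^ (b + 2 * c + 3 * d) * chainRho d * chainKappa (7 + c + d) *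
    (X * (chainKappa (9 + b + c + d) * chainSq (11 + a + b + c + d) -
      X ^ 2 * chainKappa (10 + b + c + d) * chainSq (12 + a + b + c + d))) *
    geom (15 + a + b + c + d)

/-- The summand, as a function of the differences of consecutive elements of the chain. -/
noncomputable def chainTerm (a b c d : ℕ) (n : ((((ℕ × ℕ) × ℕ) × ℕ) × ℕ) × ℕ) : ℚ⟦X⟧ :=
  let z₆ : ℚ⟦X⟧ := X ^ n.1.1.1.1.1
  let z₅ : ℚ⟦X⟧ := z₆ * X ^ n.1.1.1.1.2
  let z₄ : ℚ⟦X⟧ := z₅ * X ^ n.1.1.1.2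
  let z₃ : ℚ⟦X⟧ := z₄ * X ^ n.1.1.2
  let z₂ : ℚ⟦X⟧ := z₃ * X ^ n.1.2
  let z₁ : ℚ⟦X⟧ := z₂ * X ^ n.2
  chainFactor z₁ z₂ z₃ z₄ z₅ z₆ *
    (z₅ ^ a * (X * z₄) ^ b * (X ^ 2 * z₃) ^ c * (X ^ 3 * z₂) ^ d)

theorem summable_chainTerm (a b c d : ℕ) : Summable (chainTerm a b c d) := by
  have hw : FiniteWeights fun n : ((((ℕ × ℕ) × ℕ) × ℕ) × ℕ) × ℕ =>
      n.1.1.1.1.1 + n.1.1.1.1.2 + n.1.1.1.2 + n.1.1.2 + n.1.2 + n.2 :=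
    ((((finiteWeights_id.prod finiteWeights_id).prod finiteWeights_id).prod finiteWeights_id).prod
      finiteWeights_id).prod finiteWeights_id
  refine summable_of_X_pow_dvd hw fun n => ?_
  simp only [pow_add, chainTerm]
  exact (dvd_chainFactor _ _ _ _ _ _).mul_right _

/-- The exponents 7 + c + d, 9 + b + c + d, 11 + a + b + c + d and 15 + a + b + c + d arise because
each summation leaves a power of the next variable, which joins the powers already present. For the
exponents of λ the last number is the cardinality of the poset, see `card_pump`. -/
theorem hasSum_chainTerm (a b c d : ℕ) : HasSum (chainTerm a b c d) (chainTotal a b c d) := by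
  have h := (summable_chainTerm a b c d).hasSum
  -- The last component of the index is the difference that defines z₁, so z₁ is summed first.
  have h₁ := h.prod_fiberwise (g := fun n =>
    let z₆ : ℚ⟦X⟧ := X ^ n.1.1.1.1
    let z₅ : ℚ⟦X⟧ := z₆ * X ^ n.1.1.1.2
    let z₄ : ℚ⟦X⟧ := z₅ * X ^ n.1.1.2
    let z₃ : ℚ⟦X⟧ := z₄ * X ^ n.1.2
    let z₂ : ℚ⟦X⟧ := z₃ * X ^ n.2
    (z₃ * z₄ * z₅ * z₆ * (z₄ - X * z₃) * ((z₆ - X * z₅) * (z₆ - X ^ 2 * z₄) *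
      (X * z₅ - X ^ 2 * z₄)) * (z₆ - X * z₅) * (z₅ ^ a * (X * z₄) ^ b * (X ^ 2 * z₃) ^ c) *
      X ^ (3 * d)) * (z₂ ^ (4 + d) * (chainAlpha * z₃ - chainBeta * z₂) * (z₃ - X * z₂))) (by
    intro n
    simp only [chainTerm, chainFactor]
    generalize (X : ℚ⟦X⟧) ^ n.1.1.1.1 * X ^ n.1.1.1.2 * X ^ n.1.1.2 * X ^ n.1.2 = z₃
    generalize (X : ℚ⟦X⟧) ^ n.1.1.1.1 * X ^ n.1.1.1.2 * X ^ n.1.1.2 = z₄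
    generalize (X : ℚ⟦X⟧) ^ n.1.1.1.1 * X ^ n.1.1.1.2 = z₅
    generalize (X : ℚ⟦X⟧) ^ n.1.1.1.1 = z₆
    generalize z₃ * X ^ n.2 = z₂
    refine ((hasSum_chain_one z₂ z₃).mul_left (z₂ * z₃ * z₄ * z₅ * z₆ * (z₃ - X * z₂) *
      (z₄ - X * z₃) * ((z₆ - X * z₅) * (z₆ - X ^ 2 * z₄) *
      (X * z₅ - X ^ 2 * z₄)) * (z₆ - X * z₅) * (z₅ ^ a * (X * z₄) ^ b * (X ^ 2 * z₃) ^ c *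
        (X ^ 3 * z₂) ^ d))).of_eq (fun n => ?_) ?_
    · ring
    · ring)
  have h₂ := h₁.prod_fiberwise (g := fun n =>
    let z₆ : ℚ⟦X⟧ := X ^ n.1.1.1
    let z₅ : ℚ⟦X⟧ := z₆ * X ^ n.1.1.2
    let z₄ : ℚ⟦X⟧ := z₅ * X ^ n.1.2
    let z₃ : ℚ⟦X⟧ := z₄ * X ^ n.2
    (z₄ * z₅ * z₆ * ((z₆ - X * z₅) * (z₆ - X ^ 2 * z₄) *
      (X * z₅ - X ^ 2 * z₄)) * (z₆ - X * z₅) * (z₅ ^ a * (X * z₄) ^ b) *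
      X ^ (2 * c + 3 * d) * chainRho d) * (z₃ ^ (7 + c + d) * (z₄ - X * z₃))) (by
    intro n
    simp only
    generalize (X : ℚ⟦X⟧) ^ n.1.1.1 * X ^ n.1.1.2 * X ^ n.1.2 * X ^ n.2 = z₃
    generalize (X : ℚ⟦X⟧) ^ n.1.1.1 * X ^ n.1.1.2 * X ^ n.1.2 = z₄
    generalize (X : ℚ⟦X⟧) ^ n.1.1.1 * X ^ n.1.1.2 = z₅
    generalize (X : ℚ⟦X⟧) ^ n.1.1.1 = z₆
    refine HasSum.of_eq ((hasSum_chain_two z₃ d).mul_left _) (fun n => rfl) ?_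
    ring)
  have h₃ := h₂.prod_fiberwise (g := fun n =>
    let z₆ : ℚ⟦X⟧ := X ^ n.1.1
    let z₅ : ℚ⟦X⟧ := z₆ * X ^ n.1.2
    let z₄ : ℚ⟦X⟧ := z₅ * X ^ n.2
    (z₅ * z₆ * (z₆ - X * z₅) ^ 2 * z₅ ^ a * X ^ (b + 2 * c + 3 * d) * chainRho d *
      chainKappa (7 + c + d)) * (z₄ ^ (9 + b + c + d) * (z₆ - X ^ 2 * z₄) *
      (X * z₅ - X ^ 2 * z₄))) (by
    intro n
    simp only
    generalize (X : ℚ⟦X⟧) ^ n.1.1 * X ^ n.1.2 * X ^ n.2 = z₄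
    generalize (X : ℚ⟦X⟧) ^ n.1.1 * X ^ n.1.2 = z₅
    generalize (X : ℚ⟦X⟧) ^ n.1.1 = z₆
    refine HasSum.of_eq ((hasSum_chain_three z₄ (e := 7 + c + d) (by omega)).mul_left _) (fun n => rfl) ?_
    ring)
  have h₄ := h₃.prod_fiberwise (g := fun n =>
    let z₆ : ℚ⟦X⟧ := X ^ n.1
    let z₅ : ℚ⟦X⟧ := z₆ * X ^ n.2
    (z₆ * X ^ (b + 2 * c + 3 * d) * chainRho d * chainKappa (7 + c + d) * X) *
      (z₅ ^ (11 + a + b + c + d) * (z₆ * chainKappa (9 + b + c + d) -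
        X ^ 2 * z₅ * chainKappa (10 + b + c + d)) * (z₆ - X * z₅) ^ 2)) (by
    intro n
    simp only
    generalize (X : ℚ⟦X⟧) ^ n.1 * X ^ n.2 = z₅
    generalize (X : ℚ⟦X⟧) ^ n.1 = z₆
    refine HasSum.of_eq ((hasSum_chain_four z₅ z₆ (e := 9 + b + c + d) (by omega)).mul_left _) (fun n => rfl) ?_
    rw [show 9 + b + c + d + 1 = 10 + b + c + d by ring]
    ring)
  have h₅ := h₄.prod_fiberwise (g := fun n =>
    (X ^ (b + 2 * c + 3 * d) * chainRho d * chainKappa (7 + c + d) *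
    (X * (chainKappa (9 + b + c + d) * chainSq (11 + a + b + c + d) -
      X ^ 2 * chainKappa (10 + b + c + d) * chainSq (12 + a + b + c + d)))) *
      (X ^ (n * (15 + a + b + c + d)))) (by
    intro n
    simp only
    rw [pow_mul]
    generalize (X : ℚ⟦X⟧) ^ n = z₆
    refine HasSum.of_eq ((hasSum_chain_five z₆ (chainKappa (9 + b + c + d)) (chainKappa (10 + b + c + d))
      (e := 11 + a + b + c + d) (by omega)).mul_left _) (fun n => rfl) ?_
    rw [show 11 + a + b + c + d + 1 = 12 + a + b + c + d by ring]
    ring)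
  have h₆ := h₅.unique ((hasSum_geom (e := 15 + a + b + c + d) (by omega)).mul_left _)
  rw [h₆] at h
  exact h

end ChainSum

/-! ### The generating function of the pump without its upper chain -/

section PumpChain

open scoped PowerSeries.WithPiTopology
open AttachedPoset

/-- The order-reversing maps on a chain with six elements, through the differences of consecutive
values. -/
def antitoneFinSixEquiv :
    ((((ℕ × ℕ) × ℕ) × ℕ) × ℕ) × ℕ ≃ {y : Fin 6 → ℕ // Antitone y} where
  toFun n :=
    ⟨![n.1.1.1.1.1 + n.1.1.1.1.2 + n.1.1.1.2 + n.1.1.2 + n.1.2 + n.2,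
      n.1.1.1.1.1 + n.1.1.1.1.2 + n.1.1.1.2 + n.1.1.2 + n.1.2,
      n.1.1.1.1.1 + n.1.1.1.1.2 + n.1.1.1.2 + n.1.1.2,
      n.1.1.1.1.1 + n.1.1.1.1.2 + n.1.1.1.2,
      n.1.1.1.1.1 + n.1.1.1.1.2, n.1.1.1.1.1], by
      rw [Fin.antitone_iff_succ_le]
      intro i
      fin_cases i <;> simp [Fin.succ, Fin.castSucc]⟩
  invFun y := (((((y.1 5, y.1 4 - y.1 5), y.1 3 - y.1 4), y.1 2 - y.1 3), y.1 1 - y.1 2),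
    y.1 0 - y.1 1)
  left_inv n := by
    simp
  right_inv y := by
    have h₅ : y.1 5 ≤ y.1 4 := y.2 (by decide)
    have h₄ : y.1 4 ≤ y.1 3 := y.2 (by decide)
    have h₃ : y.1 3 ≤ y.1 2 := y.2 (by decide)
    have h₂ : y.1 2 ≤ y.1 1 := y.2 (by decide)
    have h₁ : y.1 1 ≤ y.1 0 := y.2 (by decide)
    refine Subtype.ext (funext fun i => ?_)
    fin_cases i <;> simp <;> omega

theorem X_pow_mul_fillingGF_diagVal {n : ℕ} (A : Attachment n) {y : Fin n → ℕ} (hy : Antitone y) :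
    (X : ℚ⟦X⟧) ^ (∑ r ∈ Finset.range A.size, r * A.offLen r) *
        fillingGF A.size A.offLen (diagVal y A) =
      (∏ r ∈ Finset.range A.size, ∏ i ∈ Finset.Icc 1 (A.offLen r), geom i) *
        fillingDet A.size A.offLen (diagVal y A) := by
  refine X_pow_mul_fillingGF (A.offLen 0) _ _ _ A.offLen_lt (fun r hr => ?_) fun r hr => ?_
  · induction r with
    | zero => exact le_rfl
    | succ r ih => exact (A.offLen_lt r hr).le.trans (ih (by omega))
  · exact hy (Fin.le_def.2 (A.diagPos_le_diagPos (Nat.le_succ r)))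

theorem fillingDet_two {l a : ℕ → ℕ} (h₀ : l 0 = 1) (h₁ : l 1 = 0) :
    fillingDet 2 l a = X ^ a 0 - X * X ^ a 1 := by
  rw [fillingDet, Matrix.det_fin_two]
  simp [h₀, h₁]
  ring

theorem fillingDet_three {l a : ℕ → ℕ} (h₀ : l 0 = 2) (h₁ : l 1 = 1) (h₂ : l 2 = 0) :
    fillingDet 3 l a = (X ^ a 0 - X * X ^ a 1) * (X ^ a 0 - X ^ 2 * X ^ a 2) *
      (X * X ^ a 1 - X ^ 2 * X ^ a 2) := by
  rw [fillingDet, Matrix.det_fin_three]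
  simp [h₀, h₁, h₂]
  ring

theorem fillingDet_four (l a : ℕ → ℕ) :
    fillingDet 4 l a = alt₄ (fun b c d e => (X ^ a 0) ^ b * (X * X ^ a 1) ^ c *
      (X ^ 2 * X ^ a 2) ^ d * (X ^ 3 * X ^ a 3) ^ e) (l 0) (l 1) (l 2) (l 3) := by
  rw [fillingDet]
  simp_rw [pow_mul]
  rw [det_fin_four_pow fun r => (X : ℚ⟦X⟧) ^ (a r + r)]
  refine congrArg (fun f => alt₄ f (l 0) (l 1) (l 2) (l 3)) ?_
  funext b c d e
  ring

variable (lam : Par 3)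

theorem pumpData_offLen (i : Fin 6) (r : ℕ) : (pumpData lam i).offLen r =
    (if i = 2 then lam.1.rowLen r else 0) + (![3, 2, 4, 2, 3, 2] : Fin 6 → ℕ) i - 1 - r := by
  rw [Attachment.offLen, pumpData_rowLen, pumpData_size]

theorem diagVal_pumpData (y : Fin 6 → ℕ) (i : Fin 6) (r : ℕ) (j : Fin 6)
    (h : (![2, 1, 4, 3, 5, 5] : Fin 6 → ℕ) i - r = j) :
    diagVal y (pumpData lam i) r = y j := by
  rw [diagVal]
  congr 1
  rw [Fin.ext_iff]
  simp only
  rw [pumpData_diagPos, h]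

theorem pump_fillingGF_two {y : Fin 6 → ℕ} (hy : Antitone y) (i : Fin 6) (j j' : Fin 6)
    (hi : i ≠ 2) (hs : (![3, 2, 4, 2, 3, 2] : Fin 6 → ℕ) i = 2)
    (hj : (![2, 1, 4, 3, 5, 5] : Fin 6 → ℕ) i = j) (hj' : (j : ℕ) - 1 = j') :
    fillingGF (pumpData lam i).size (pumpData lam i).offLen (diagVal y (pumpData lam i)) =
      geom 1 * (X ^ y j - X * X ^ y j') := by
  have h := X_pow_mul_fillingGF_diagVal (pumpData lam i) hy
  have hl : ∀ r, (pumpData lam i).offLen r = 1 - r := fun r => by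
    rw [pumpData_offLen, if_neg hi, hs]
  have hs' : (pumpData lam i).size = 2 := by rw [pumpData_size, hs]
  rw [hs'] at h ⊢
  rw [fillingDet_two (hl 0) (hl 1), diagVal_pumpData lam y i 0 j (by simp [hj]),
    diagVal_pumpData lam y i 1 j' (by rw [hj, hj'])] at h
  simp only [Finset.sum_range_succ, Finset.prod_range_succ, hl] at h
  simpa using h

/-- A Vandermonde determinant in the three values X ^ (a_r + r); `j`, `j'`, `j''` are the positions
of the diagonal cells on the chain. The factor X on the left comes from the row lengths 2, 1, 0: the
exponent is 0 · 2 + 1 · 1 + 2 · 0. -/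
theorem pump_fillingGF_three {y : Fin 6 → ℕ} (hy : Antitone y) (i : Fin 6) (j j' j'' : Fin 6)
    (hi : i ≠ 2) (hs : (![3, 2, 4, 2, 3, 2] : Fin 6 → ℕ) i = 3)
    (hj : (![2, 1, 4, 3, 5, 5] : Fin 6 → ℕ) i = j) (hj' : (j : ℕ) - 1 = j') (hj'' : (j : ℕ) - 2 = j'') :
    X * fillingGF (pumpData lam i).size (pumpData lam i).offLen (diagVal y (pumpData lam i)) =
      geom 1 ^ 2 * geom 2 * ((X ^ y j - X * X ^ y j') * (X ^ y j - X ^ 2 * X ^ y j'') *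
      (X * X ^ y j' - X ^ 2 * X ^ y j'')) := by
  have h := X_pow_mul_fillingGF_diagVal (pumpData lam i) hy
  have hl : ∀ r, (pumpData lam i).offLen r = 2 - r := fun r => by
    rw [pumpData_offLen, if_neg hi, hs]
  have hs' : (pumpData lam i).size = 3 := by rw [pumpData_size, hs]
  rw [hs'] at h ⊢
  rw [fillingDet_three (hl 0) (hl 1) (hl 2), diagVal_pumpData lam y i 0 j (by simp [hj]),
    diagVal_pumpData lam y i 1 j' (by rw [hj, hj']), diagVal_pumpData lam y i 2 j''
      (by rw [hj, hj''])] at h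
  have e₂ : Finset.Icc 1 2 = {1, 2} := rfl
  have e₁ : Finset.Icc 1 1 = {1} := rfl
  have e₀ : Finset.Icc 1 0 = ∅ := rfl
  simp only [Finset.sum_range_succ, Finset.prod_range_succ, hl, Finset.prod_range_zero,
    Finset.sum_range_zero, zero_mul, zero_add, tsub_zero, Nat.sub_self, mul_zero,
    add_zero, one_mul, Nat.add_one_sub_one, pow_one, e₂, e₁, e₀] at h
  rw [h, Finset.prod_pair (by decide), Finset.prod_singleton, Finset.prod_empty]
  ring

/-- The last exponent is 0 because λ has at most three parts, so the fourth row consists of its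
diagonal cell. -/
theorem pump_fillingGF_four {y : Fin 6 → ℕ} (hy : Antitone y) :
    X ^ (lam.strict 1 + 2 * lam.strict 2) * fillingGF (pumpData lam 2).size (pumpData lam 2).offLen
      (diagVal y (pumpData lam 2)) =
      (∏ r ∈ Finset.range 3, ∏ i ∈ Finset.Icc 1 (lam.strict r), geom i) *
        alt₄ (fun b c d e => (X ^ y 4) ^ b * (X * X ^ y 3) ^ c *
          (X ^ 2 * X ^ y 2) ^ d * (X ^ 3 * X ^ y 1) ^ e) (lam.strict 0) (lam.strict 1)
          (lam.strict 2) 0 := by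
  have h := X_pow_mul_fillingGF_diagVal (pumpData lam 2) hy
  have hl : ∀ r, (pumpData lam 2).offLen r = lam.strict r := fun r => by
    rw [pumpData_offLen, if_pos rfl, Par.strict]; rfl
  have hl₃ : lam.strict 3 = 0 := by
    rw [Par.strict, lam.rowLen_three]
  have hs' : (pumpData lam 2).size = 4 := by rw [pumpData_size]; rfl
  rw [hs'] at h ⊢
  rw [fillingDet_four, diagVal_pumpData lam y 2 0 4 rfl, diagVal_pumpData lam y 2 1 3 rfl,
    diagVal_pumpData lam y 2 2 2 rfl, diagVal_pumpData lam y 2 3 1 rfl] at h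
  simp only [hl, hl₃] at h
  rw [Finset.prod_range_succ, hl₃] at h
  simpa [Finset.sum_range_succ, hl₃] using h

/-- The generating function of the pump without the chain attached above it. -/
theorem X_pow_mul_partitionGF_pump :
    X ^ (2 + lam.strict 1 + 2 * lam.strict 2) * partitionGF (AttachedPoset 0 (pumpData lam)) =
      geom 1 ^ 7 * geom 2 ^ 2 *
        (∏ r ∈ Finset.range 3, ∏ i ∈ Finset.Icc 1 (lam.strict r), geom i) *
        alt₄ chainTotal (lam.strict 0) (lam.strict 1) (lam.strict 2) 0 := by
  have h₁ := ((antitoneFinSixEquiv.hasSum_iff.2 (hasSum_prod_fillingGF (pumpData lam)))).mul_left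
    ((X : ℚ⟦X⟧) ^ (2 + lam.strict 1 + 2 * lam.strict 2))
  have h₂ := (hasSum_alt₄ (f := fun n a b c d => chainTerm a b c d n) (F := chainTotal)
    hasSum_chainTerm (lam.strict 0) (lam.strict 1) (lam.strict 2) 0).mul_left
    (geom 1 ^ 7 * geom 2 ^ 2 *
        (∏ r ∈ Finset.range 3, ∏ i ∈ Finset.Icc 1 (lam.strict r), geom i))
  refine (h₂.of_eq (fun n => ?_) rfl).unique h₁ |>.symm
  have hy := (antitoneFinSixEquiv n).2
  simp only [Function.comp_apply]
  rw [Fin.prod_univ_six, Fin.sum_univ_six,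
    pump_fillingGF_two lam hy 1 1 0 (by decide) rfl rfl rfl,
    pump_fillingGF_two lam hy 3 3 2 (by decide) rfl rfl rfl,
    pump_fillingGF_two lam hy 5 5 4 (by decide) rfl rfl rfl]
  have g₀ := pump_fillingGF_three lam hy 0 2 1 0 (by decide) rfl rfl rfl rfl
  have g₂ := pump_fillingGF_four lam hy
  have g₄ := pump_fillingGF_three lam hy 4 5 4 3 (by decide) rfl rfl rfl rfl
  generalize fillingGF (pumpData lam 0).size (pumpData lam 0).offLen
    (diagVal (antitoneFinSixEquiv n).1 (pumpData lam 0)) = f₀ at g₀ ⊢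
  generalize fillingGF (pumpData lam 2).size (pumpData lam 2).offLen
    (diagVal (antitoneFinSixEquiv n).1 (pumpData lam 2)) = f₂ at g₂ ⊢
  generalize fillingGF (pumpData lam 4).size (pumpData lam 4).offLen
    (diagVal (antitoneFinSixEquiv n).1 (pumpData lam 4)) = f₄ at g₄ ⊢
  have e₅ : (X : ℚ⟦X⟧) ^ (antitoneFinSixEquiv n).1 5 = X ^ n.1.1.1.1.1 := rfl
  have e₄ : (X : ℚ⟦X⟧) ^ (antitoneFinSixEquiv n).1 4 =
    X ^ (antitoneFinSixEquiv n).1 5 * X ^ n.1.1.1.1.2 := pow_add _ _ _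
  have e₃ : (X : ℚ⟦X⟧) ^ (antitoneFinSixEquiv n).1 3 =
    X ^ (antitoneFinSixEquiv n).1 4 * X ^ n.1.1.1.2 := pow_add _ _ _
  have e₂ : (X : ℚ⟦X⟧) ^ (antitoneFinSixEquiv n).1 2 =
    X ^ (antitoneFinSixEquiv n).1 3 * X ^ n.1.1.2 := pow_add _ _ _
  have e₁ : (X : ℚ⟦X⟧) ^ (antitoneFinSixEquiv n).1 1 =
    X ^ (antitoneFinSixEquiv n).1 2 * X ^ n.1.2 := pow_add _ _ _
  have e₀ : (X : ℚ⟦X⟧) ^ (antitoneFinSixEquiv n).1 0 =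
    X ^ (antitoneFinSixEquiv n).1 1 * X ^ n.2 := pow_add _ _ _
  simp only [chainTerm]
  rw [← e₅, ← e₄, ← e₃, ← e₂, ← e₁, ← e₀]
  simp only [pow_add (X : ℚ⟦X⟧)]
  generalize (X : ℚ⟦X⟧) ^ (antitoneFinSixEquiv n).1 5 = z₆ at *
  generalize (X : ℚ⟦X⟧) ^ (antitoneFinSixEquiv n).1 4 = z₅ at *
  generalize (X : ℚ⟦X⟧) ^ (antitoneFinSixEquiv n).1 3 = z₄ at *
  generalize (X : ℚ⟦X⟧) ^ (antitoneFinSixEquiv n).1 2 = z₃ at *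
  generalize (X : ℚ⟦X⟧) ^ (antitoneFinSixEquiv n).1 1 = z₂ at *
  generalize (X : ℚ⟦X⟧) ^ (antitoneFinSixEquiv n).1 0 = z₁ at *
  rw [pow_add] at g₂
  have e : ∀ (u : ℚ⟦X⟧) a b c d, alt₄ (fun a b c d => u * (z₅ ^ a * (X * z₄) ^ b *
      (X ^ 2 * z₃) ^ c * (X ^ 3 * z₂) ^ d)) a b c d = u * alt₄ (fun a b c d => z₅ ^ a *
      (X * z₄) ^ b * (X ^ 2 * z₃) ^ c * (X ^ 3 * z₂) ^ d) a b c d := fun u a b c d => by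
    simp only [alt₄, alt₃]
    ring
  rw [e]
  generalize alt₄ (fun a b c d => z₅ ^ a *
      (X * z₄) ^ b * (X ^ 2 * z₃) ^ c * (X ^ 3 * z₂) ^ d) _ _ _ _ = D at *
  generalize (∏ r ∈ Finset.range 3, ∏ i ∈ Finset.Icc 1 (lam.strict r), geom i) = p at *
  rw [chainFactor]
  -- The product of the three relations `g₀`, `g₂`, `g₄`, with one factor exchanged at a time.
  linear_combination z₁ * z₂ * z₃ * z₄ * z₅ * z₆ * ((geom 1 * (z₂ - X * z₁)) *
    (geom 1 * (z₄ - X * z₃)) * (geom 1 * (z₆ - X * z₅))) * (X * f₀ * (X * f₄) * g₂ +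
    X * f₀ * p * D * g₄ + p * D * (geom 1 ^ 2 * geom 2 * ((z₆ - X * z₅) * (z₆ - X ^ 2 * z₄) *
      (X * z₅ - X ^ 2 * z₄))) * g₀)

end PumpChain

/-! ### Polynomial identities by evaluation at one point -/

namespace MvPolynomial

variable {σ : Type*}

/-- The sum of the absolute values of the coefficients. -/
noncomputable def coeffSum (p : MvPolynomial σ ℤ) : ℕ := ∑ m ∈ p.support, (p.coeff m).natAbs

theorem coeffSum_eq_sum {p : MvPolynomial σ ℤ} {s : Finset (σ →₀ ℕ)} (h : p.support ⊆ s) :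
    p.coeffSum = ∑ m ∈ s, (p.coeff m).natAbs :=
  Finset.sum_subset h fun m _ hm => by rw [notMem_support_iff.1 hm, Int.natAbs_zero]

theorem coeffSum_add_le (p q : MvPolynomial σ ℤ) : (p + q).coeffSum ≤ p.coeffSum + q.coeffSum := by
  classical
  rw [coeffSum_eq_sum (p := p + q) (s := p.support ∪ q.support) (support_add),
    coeffSum_eq_sum (p := p) Finset.subset_union_left,
    coeffSum_eq_sum (p := q) Finset.subset_union_right, ← Finset.sum_add_distrib]
  exact Finset.sum_le_sum fun m _ => by rw [coeff_add]; exact Int.natAbs_add_le _ _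

theorem coeffSum_neg (p : MvPolynomial σ ℤ) : (-p).coeffSum = p.coeffSum := by
  simp [coeffSum]

theorem coeffSum_sub_le (p q : MvPolynomial σ ℤ) : (p - q).coeffSum ≤ p.coeffSum + q.coeffSum := by
  rw [sub_eq_add_neg, ← coeffSum_neg q]
  exact coeffSum_add_le _ _

theorem coeffSum_monomial (m : σ →₀ ℕ) (c : ℤ) : (monomial m c).coeffSum = c.natAbs := by
  classical
  rw [coeffSum_eq_sum (s := {m}) support_monomial_subset]
  simp

theorem coeffSum_sum_le {ι : Type*} (s : Finset ι) (f : ι → MvPolynomial σ ℤ) :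
    (∑ i ∈ s, f i).coeffSum ≤ ∑ i ∈ s, (f i).coeffSum := by
  classical
  induction s using Finset.induction_on with
  | empty => simp [coeffSum]
  | insert a s ha ih =>
    rw [Finset.sum_insert ha, Finset.sum_insert ha]
    exact (coeffSum_add_le _ _).trans (Nat.add_le_add_left ih _)

theorem coeffSum_mul_le (p q : MvPolynomial σ ℤ) : (p * q).coeffSum ≤ p.coeffSum * q.coeffSum := by
  have h : p * q = ∑ m ∈ p.support, ∑ n ∈ q.support, monomial (m + n) (p.coeff m * q.coeff n) := by
    conv_lhs => rw [p.as_sum, q.as_sum, Finset.sum_mul_sum]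
    simp [monomial_mul]
  rw [h]
  refine (coeffSum_sum_le _ _).trans ?_
  rw [coeffSum, coeffSum, Finset.sum_mul_sum]
  refine Finset.sum_le_sum fun m _ => (coeffSum_sum_le _ _).trans (Finset.sum_le_sum fun n _ => ?_)
  rw [coeffSum_monomial, Int.natAbs_mul]

/-- A polynomial vanishes if it vanishes at a point whose coordinates are suitable powers of an
upper bound for its coefficients. -/
theorem eq_zero_of_eval_pow [Fintype σ] {p : MvPolynomial σ ℤ} {M : ℕ} (hM : p.coeffSum ≤ M)
    (hM₀ : 0 < M) (k : σ → ℕ)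
    (hk : Set.InjOn (fun m : σ →₀ ℕ => ∑ i, k i * m i) p.support)
    (h : eval (fun i => (M : ℤ) ^ k i) p = 0) : p = 0 := by
  classical
  by_contra hp
  -- The term with the largest power of M would have to cancel against the others. Their powers of M
  -- are strictly smaller and the absolute values of their coefficients add up to less than M.
  obtain ⟨m, hm, hmax⟩ := p.support.exists_max_image (fun m => ∑ i, k i * m i)
    (support_nonempty.2 hp)
  have hev : ∀ n : σ →₀ ℕ, ∏ i, ((M : ℤ) ^ k i) ^ n i = (M : ℤ) ^ ∑ i, k i * n i := fun n => by
    rw [← Finset.prod_pow_eq_pow_sum]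
    exact Finset.prod_congr rfl fun i _ => (pow_mul _ _ _).symm
  rw [eval_eq', ← Finset.add_sum_erase _ _ hm] at h
  simp only [hev] at h
  have hc : 1 ≤ (p.coeff m).natAbs := Int.natAbs_pos.2 (mem_support_iff.1 hm)
  have hS := Finset.add_sum_erase p.support (fun n => (p.coeff n).natAbs) hm
  rcases Finset.eq_empty_or_nonempty (p.support.erase m) with he | ⟨n, hn⟩
  · rw [he, Finset.sum_empty, add_zero, mul_eq_zero] at h
    rcases h with h | h
    · exact mem_support_iff.1 hm h
    · exact (pow_pos (by exact_mod_cast hM₀) _).ne' h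
  have hlt : ∀ n ∈ p.support.erase m, ∑ i, k i * n i < ∑ i, k i * m i := fun n hn =>
    lt_of_le_of_ne (hmax n (Finset.mem_of_mem_erase hn)) fun e =>
      Finset.ne_of_mem_erase hn (hk (Finset.mem_of_mem_erase hn) hm e)
  obtain ⟨E, hE⟩ : ∃ E, ∑ i, k i * m i = E + 1 := ⟨_, (Nat.sub_add_cancel
    (Nat.one_le_of_lt (hlt n hn))).symm⟩
  have h₁ : |∑ n ∈ p.support.erase m, p.coeff n * (M : ℤ) ^ ∑ i, k i * n i| ≤
      (∑ n ∈ p.support.erase m, ((p.coeff n).natAbs : ℤ)) * (M : ℤ) ^ E := by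
    rw [Finset.sum_mul]
    refine (Finset.abs_sum_le_sum_abs _ _).trans (Finset.sum_le_sum fun n hn => ?_)
    rw [abs_mul, Int.natCast_natAbs, abs_of_nonneg (pow_nonneg (Int.natCast_nonneg M) _)]
    refine mul_le_mul_of_nonneg_left (pow_le_pow_right₀ (by exact_mod_cast hM₀) ?_) (abs_nonneg _)
    have := hlt n hn
    omega
  have h₂ : |p.coeff m * (M : ℤ) ^ (E + 1)| = ((p.coeff m).natAbs : ℤ) * (M : ℤ) ^ (E + 1) := by
    rw [abs_mul, Int.natCast_natAbs, abs_of_nonneg (pow_nonneg (Int.natCast_nonneg M) _)]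
  rw [hE] at h
  rw [eq_neg_of_add_eq_zero_left h, abs_neg] at h₂
  rw [h₂, pow_succ', ← mul_assoc] at h₁
  have h₃ := le_of_mul_le_mul_right h₁ (pow_pos (by exact_mod_cast hM₀) _)
  have h₄ : (p.coeff m).natAbs + ∑ n ∈ p.support.erase m, (p.coeff n).natAbs ≤ M :=
    hS.le.trans hM
  have h₅ : (p.coeff m).natAbs * M ≤ ∑ n ∈ p.support.erase m, (p.coeff n).natAbs := by
    exact_mod_cast h₃
  -- With c for the absolute value of the leading coefficient and S for the sum of the others: c ≥
  -- 1, c + S ≤ M and c M ≤ S contradict each other.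
  nlinarith

end MvPolynomial

/-- Integral polynomial expressions in four variables. -/
inductive PolyExpr where
  | var (i : Fin 4)
  | const (c : ℤ)
  | add (e f : PolyExpr)
  | sub (e f : PolyExpr)
  | mul (e f : PolyExpr)

namespace PolyExpr

/-- The value of an expression. -/
def eval {R : Type*} [CommRing R] (v : Fin 4 → R) : PolyExpr → R
  | var i => v i
  | const c => c
  | add e f => e.eval v + f.eval v
  | sub e f => e.eval v - f.eval v
  | mul e f => e.eval v * f.eval v

/-- The value of an expression at integers. -/
def evalInt (v : Fin 4 → ℤ) : PolyExpr → ℤ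
  | var i => v i
  | const c => c
  | add e f => (e.evalInt v).add (f.evalInt v)
  | sub e f => (e.evalInt v).sub (f.evalInt v)
  | mul e f => (e.evalInt v).mul (f.evalInt v)

/-- An upper bound for the sum of the absolute values of the coefficients. -/
def norm : PolyExpr → ℕ
  | var _ => 1
  | const c => c.natAbs
  | add e f => e.norm + f.norm
  | sub e f => e.norm + f.norm
  | mul e f => e.norm * f.norm

/-- An upper bound for the degree in a variable. -/
def deg (i : Fin 4) : PolyExpr → ℕ
  | var j => if i = j then 1 else 0
  | const _ => 0
  | add e f => max (e.deg i) (f.deg i)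
  | sub e f => max (e.deg i) (f.deg i)
  | mul e f => e.deg i + f.deg i

noncomputable def toMvPolynomial (e : PolyExpr) : MvPolynomial (Fin 4) ℤ := e.eval MvPolynomial.X

theorem map_eval {R S : Type*} [CommRing R] [CommRing S] (f : R →+* S) (v : Fin 4 → R)
    (e : PolyExpr) : f (e.eval v) = e.eval fun i => f (v i) := by
  induction e with
  | var i => rfl
  | const c => exact map_intCast f c
  | add e f h₁ h₂ => rw [eval, eval, map_add, h₁, h₂]
  | sub e f h₁ h₂ => rw [eval, eval, map_sub, h₁, h₂]
  | mul e f h₁ h₂ => rw [eval, eval, map_mul, h₁, h₂]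

/-- `evalInt` names the integer operations directly, in the form in which the kernel evaluates it at
large numbers. -/
theorem evalInt_eq (v : Fin 4 → ℤ) (e : PolyExpr) : e.evalInt v = e.eval v := by
  induction e with
  | var i => rfl
  | const c => rfl
  | add e f h₁ h₂ => rw [eval, evalInt, h₁, h₂]; rfl
  | sub e f h₁ h₂ => rw [eval, evalInt, h₁, h₂]; rfl
  | mul e f h₁ h₂ => rw [eval, evalInt, h₁, h₂]; rfl

theorem coeffSum_toMvPolynomial_le (e : PolyExpr) : e.toMvPolynomial.coeffSum ≤ e.norm := by
  have hC : ∀ c : ℤ, (MvPolynomial.C c : MvPolynomial (Fin 4) ℤ).coeffSum = c.natAbs :=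
    MvPolynomial.coeffSum_monomial 0
  induction e with
  | var i => exact (MvPolynomial.coeffSum_monomial _ _).le
  | const c =>
    have h : (const c).toMvPolynomial = MvPolynomial.C c :=
      (map_intCast (MvPolynomial.C : ℤ →+* MvPolynomial (Fin 4) ℤ) c).symm
    rw [h, hC]
    exact le_rfl
  | add e f h₁ h₂ => exact (MvPolynomial.coeffSum_add_le _ _).trans (add_le_add h₁ h₂)
  | sub e f h₁ h₂ => exact (MvPolynomial.coeffSum_sub_le _ _).trans (add_le_add h₁ h₂)
  | mul e f h₁ h₂ => exact (MvPolynomial.coeffSum_mul_le _ _).trans (Nat.mul_le_mul h₁ h₂)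

theorem degreeOf_toMvPolynomial_le (i : Fin 4) (e : PolyExpr) :
    e.toMvPolynomial.degreeOf i ≤ e.deg i := by
  induction e with
  | var j =>
    rw [toMvPolynomial, eval, MvPolynomial.degreeOf_X]
    exact le_rfl
  | const c =>
    have h : (const c).toMvPolynomial = MvPolynomial.C c :=
      (map_intCast (MvPolynomial.C : ℤ →+* MvPolynomial (Fin 4) ℤ) c).symm
    rw [h, MvPolynomial.degreeOf_C]
    exact le_rfl
  | add e f h₁ h₂ => exact (MvPolynomial.degreeOf_add_le _ _ _).trans (max_le_max h₁ h₂)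
  | sub e f h₁ h₂ => exact (MvPolynomial.degreeOf_sub_le _ _ _).trans (max_le_max h₁ h₂)
  | mul e f h₁ h₂ => exact (MvPolynomial.degreeOf_mul_le _ _ _).trans (add_le_add h₁ h₂)

/-- An expression that vanishes at one suitable point vanishes everywhere. -/
theorem eval_eq_zero {R : Type*} [CommRing R] (e : PolyExpr) (M d₀ d₁ d₂ : ℕ)
    (hM : e.norm ≤ M) (hM₀ : 0 < M) (h₀ : e.deg 0 < d₀) (h₁ : e.deg 1 < d₁) (h₂ : e.deg 2 < d₂)
    (h : e.evalInt ![((M ^ 1 : ℕ) : ℤ), ((M ^ d₀ : ℕ) : ℤ), ((M ^ (d₀ * d₁) : ℕ) : ℤ),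
      ((M ^ (d₀ * d₁ * d₂) : ℕ) : ℤ)] = 0) (v : Fin 4 → R) : e.eval v = 0 := by
  have hp : e.toMvPolynomial = 0 := by
    refine MvPolynomial.eq_zero_of_eval_pow ((coeffSum_toMvPolynomial_le e).trans hM) hM₀
      ![1, d₀, d₀ * d₁, d₀ * d₁ * d₂] (fun m hm n hn hmn => ?_) ?_
    · have hd : ∀ m ∈ e.toMvPolynomial.support, ∀ i, m i ≤ e.deg i := fun m hm i =>
        (MvPolynomial.monomial_le_degreeOf i hm).trans (degreeOf_toMvPolynomial_le i e)
      simp only [Fin.sum_univ_four, Matrix.cons_val, one_mul] at hmn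
      -- Uniqueness of digits to the mixed radices d₀, d₁, d₂, which exceed the degrees. The last
      -- exponent is the leading digit and needs no bound.
      have step : ∀ {d a b s t : ℕ}, a < d → b < d → a + d * s = b + d * t → a = b ∧ s = t := by
        intro d a b s t ha hb e
        have hab : a = b := by
          have := congrArg (· % d) e
          simpa [Nat.add_mul_mod_self_left, Nat.mod_eq_of_lt ha, Nat.mod_eq_of_lt hb] using this
        exact ⟨hab, by
          rw [hab, add_right_inj] at e
          exact Nat.eq_of_mul_eq_mul_left (by omega) e⟩
      obtain ⟨e₀, e'⟩ := step (d := d₀) (s := m 1 + d₁ * (m 2 + d₂ * m 3))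
        (t := n 1 + d₁ * (n 2 + d₂ * n 3)) ((hd m hm 0).trans_lt h₀) ((hd n hn 0).trans_lt h₀)
        (by linarith)
      obtain ⟨e₁, e'⟩ := step ((hd m hm 1).trans_lt h₁) ((hd n hn 1).trans_lt h₁) e'
      obtain ⟨e₂, e₃⟩ := step ((hd m hm 2).trans_lt h₂) ((hd n hn 2).trans_lt h₂) e'
      refine Finsupp.ext fun i => ?_
      fin_cases i
      exacts [e₀, e₁, e₂, e₃]
    · rw [toMvPolynomial, map_eval]
      simp only [MvPolynomial.eval_X]
      rw [← h, evalInt_eq]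
      congr 1
      funext i
      fin_cases i <;> simp
  have := map_eval (MvPolynomial.eval₂Hom (Int.castRingHom R) v) MvPolynomial.X e
  simp only [MvPolynomial.coe_eval₂Hom, MvPolynomial.eval₂_X] at this
  rw [← this]
  change MvPolynomial.eval₂ _ _ e.toMvPolynomial = 0
  rw [hp, MvPolynomial.eval₂_zero]

end PolyExpr

/-! ### The polynomial identities for the sum over the chain -/

section PumpIdentity

section Definitions

variable {R : Type*} [CommRing R] (q : R)

/-- In the application the argument is a power of q, so that these are the factors 1 - q ^ e. The
variables x, y, z, u, v, w below stand for q ^ (l + 3), where l is one of the exponents in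
`chainTotal`. -/
def qFactor (k : ℕ) (x : R) : R := 1 - q ^ k * x

def qTriple (x : R) : R := qFactor q 1 x * qFactor q 2 x * qFactor q 3 x

def qPair (x y : R) : R := qFactor q 1 (x * y) * qFactor q 2 (x * y)

/-- The numerator of `chainRho`, up to a constant factor; see `map_chainRho`. -/
def qRho (z : R) : R := 1 + q ^ 2 + q ^ 3 - q ^ 4 * (1 + q + q ^ 3) * z

/-- The numerator of `qInner` over the common denominator of its six permutations; see `alt_qInner`.
-/
def qTerm (x y z : R) : R :=
  x * y ^ 2 * z ^ 3 * qRho q z * qTriple q x * qTriple q y * qPair q x y * qPair q x z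

def qAlt (x y z : R) : R :=
  qTerm q x y z - qTerm q x z y - qTerm q y x z + qTerm q y z x + qTerm q z x y - qTerm q z y x

def qVand (x y z : R) : R := (x - y) * (x - z) * (y - z)

/-- The numerator that results from the sums over z₄ and z₅. The argument l carries all four
exponents, s all but the first. -/
def qWeight (l s : R) : R :=
  (1 + q ^ 3 * l) * qFactor q 2 s * qFactor q 5 l -
    q ^ 2 * (1 + q ^ 4 * l) * qFactor q 0 s * qFactor q 2 l

/-- What remains of `qWeight q l l` after removal of the factor `qFactor q 2 l`. -/
def qWeight' (l : R) : R :=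
  (1 + q ^ 3 * l) * qFactor q 5 l - q ^ 2 * (1 + q ^ 4 * l) * qFactor q 0 l

/-- The numerator, up to a constant factor, of the term whose first exponent belongs to u and which
has the exponent 0 among the other three. It is taken after `qAlt_pair` over the denominator common
to all terms. -/
def qPart (u v w : R) : R :=
  v * w * (v - w) * (v - q ^ 3) * (w - q ^ 3) * qWeight q (u * v * w) (v * w * q ^ 3) *
    qTriple q u * qPair q u v * qPair q u w

end Definitions

namespace PolyExpr

instance : Add PolyExpr := ⟨add⟩
instance : Sub PolyExpr := ⟨sub⟩
instance : Mul PolyExpr := ⟨mul⟩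

/-- The powers of an expression. -/
def npow (e : PolyExpr) : ℕ → PolyExpr
  | 0 => const 1
  | n + 1 => e.npow n * e

instance : Pow PolyExpr ℕ := ⟨npow⟩

section Eval

variable {R : Type*} [CommRing R] (v : Fin 4 → R) (e f : PolyExpr)

theorem eval_var (i : Fin 4) : (var i).eval v = v i := rfl
theorem eval_one : (const 1).eval v = 1 := Int.cast_one
theorem eval_add : (e + f).eval v = e.eval v + f.eval v := rfl
theorem eval_sub : (e - f).eval v = e.eval v - f.eval v := rfl
theorem eval_mul : (e * f).eval v = e.eval v * f.eval v := rfl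
theorem eval_pow (n : ℕ) : (e ^ n).eval v = e.eval v ^ n := by
  induction n with
  | zero => rw [pow_zero]; exact eval_one v
  | succ n ih => rw [pow_succ, ← ih]; rfl

end Eval

/-- Here and below: syntactic copies of the definitions above, for which norms, degree bounds and
integral values can be computed. -/
def q : PolyExpr := var 0

def factor (k : ℕ) (x : PolyExpr) : PolyExpr := const 1 - q ^ k * x

def triple (x : PolyExpr) : PolyExpr := factor 1 x * factor 2 x * factor 3 x

def pair (x y : PolyExpr) : PolyExpr := factor 1 (x * y) * factor 2 (x * y)

def rho (z : PolyExpr) : PolyExpr :=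
  const 1 + q ^ 2 + q ^ 3 - q ^ 4 * (const 1 + q + q ^ 3) * z

def term (x y z : PolyExpr) : PolyExpr :=
  x * y ^ 2 * z ^ 3 * rho z * triple x * triple y * pair x y * pair x z

def altTerm (x y z : PolyExpr) : PolyExpr :=
  term x y z - term x z y - term y x z + term y z x + term z x y - term z y x

def vand (x y z : PolyExpr) : PolyExpr := (x - y) * (x - z) * (y - z)

def weight (l s : PolyExpr) : PolyExpr :=
  (const 1 + q ^ 3 * l) * factor 2 s * factor 5 l -
    q ^ 2 * (const 1 + q ^ 4 * l) * factor 0 s * factor 2 l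

def weight' (l : PolyExpr) : PolyExpr :=
  (const 1 + q ^ 3 * l) * factor 5 l - q ^ 2 * (const 1 + q ^ 4 * l) * factor 0 l

def part (u v w : PolyExpr) : PolyExpr :=
  v * w * (v - w) * (v - q ^ 3) * (w - q ^ 3) * weight (u * v * w) (v * w * q ^ 3) *
    triple u * pair u v * pair u w

section EvalDefs

variable {R : Type*} [CommRing R] (a : Fin 4 → R) (u v w : PolyExpr)

theorem eval_q : q.eval a = a 0 := rfl

theorem eval_factor (k : ℕ) : (factor k u).eval a = qFactor (a 0) k (u.eval a) := by
  simp only [factor, eval_sub, eval_one, eval_mul, eval_pow, eval_q, qFactor]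

theorem eval_triple : (triple u).eval a = qTriple (a 0) (u.eval a) := by
  simp only [triple, eval_mul, eval_factor, qTriple]

theorem eval_pair : (pair u v).eval a = qPair (a 0) (u.eval a) (v.eval a) := by
  simp only [pair, eval_mul, eval_factor, qPair]

theorem eval_term : (term u v w).eval a = qTerm (a 0) (u.eval a) (v.eval a) (w.eval a) := by
  simp only [term, rho, eval_add, eval_sub, eval_mul, eval_pow, eval_q, eval_one, eval_triple,
    eval_pair, qTerm, qRho]

theorem eval_altTerm : (altTerm u v w).eval a = qAlt (a 0) (u.eval a) (v.eval a) (w.eval a) := by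
  simp only [altTerm, eval_add, eval_sub, eval_term, qAlt]

theorem eval_vand : (vand u v w).eval a = qVand (u.eval a) (v.eval a) (w.eval a) := by
  simp only [vand, eval_sub, eval_mul, qVand]

theorem eval_weight' : (weight' u).eval a = qWeight' (a 0) (u.eval a) := by
  simp only [weight', eval_add, eval_sub, eval_mul, eval_pow, eval_q, eval_one, eval_factor,
    qWeight']

theorem eval_part : (part u v w).eval a = qPart (a 0) (u.eval a) (v.eval a) (w.eval a) := by
  simp only [part, weight, eval_add, eval_sub, eval_mul, eval_pow, eval_q, eval_one, eval_factor,
    eval_triple, eval_pair, qPart, qWeight]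

end EvalDefs

/-- The variables 0, 1, 2 are q, u, v. The third argument q ^ 3 corresponds to the exponent 0. -/
def pairIdentity : PolyExpr :=
  let u := var 1
  let v := var 2
  factor 2 (const 1) * factor 3 (const 1) * altTerm u v (q ^ 3) +
    q ^ 3 * triple (q ^ 3) * (u * v) * vand u v (q ^ 3) *
      (factor 3 (u * v) * factor 4 (u * v) * factor 5 (u * v)) * pair u (q ^ 3) * pair v (q ^ 3)

def chainIdentity : PolyExpr :=
  let u := var 1
  let v := var 2
  let w := var 3
  let l := u * v * w
  q ^ 3 * (factor 0 l * factor 1 l) * (part u v w - part v u w + part w u v) +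
    factor 2 (const 1) * factor 3 (const 1) * (altTerm u v w * weight' l) +
    factor 2 (const 1) * (factor 3 l * factor 4 l * factor 5 l * factor 6 l) *
      (vand u v w * ((u - q ^ 3) * (v - q ^ 3) * (w - q ^ 3))) *
      (factor 3 (l * u) * factor 3 (l * v) * factor 3 (l * w))

end PolyExpr

section PumpIdentity

namespace PolyExpr

theorem eval_pairIdentity {R : Type*} [CommRing R] (a : Fin 4 → R) : pairIdentity.eval a = 0 :=
  -- The number 2 ^ 18 bounds the coefficient sum, and 55, 9, 9 exceed the degrees in q, u, v. What
  -- remains is one computation with integers.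
  pairIdentity.eval_eq_zero (2 ^ 18) 55 9 9 (by decide +kernel) (by decide) (by decide +kernel)
    (by decide +kernel) (by decide +kernel) (by decide +kernel) a

theorem eval_chainIdentity {R : Type*} [CommRing R] (a : Fin 4 → R) : chainIdentity.eval a = 0 :=
  chainIdentity.eval_eq_zero (2 ^ 21) 39 12 12 (by decide +kernel) (by decide) (by decide +kernel)
    (by decide +kernel) (by decide +kernel) (by decide +kernel) a

end PolyExpr

/-- With one argument equal to q ^ 3, i.e. with one exponent 0, the alternating sum splits into
simple factors. This settles the three terms of `alt₄` whose first exponent is not the 0. -/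
theorem qAlt_pair {R : Type*} [CommRing R] (q u v : R) :
    qFactor q 2 1 * qFactor q 3 1 * qAlt q u v (q ^ 3) =
      -(q ^ 3 * qTriple q (q ^ 3) * (u * v) * qVand u v (q ^ 3) *
        (qFactor q 3 (u * v) * qFactor q 4 (u * v) * qFactor q 5 (u * v)) *
        qPair q u (q ^ 3) * qPair q v (q ^ 3)) := by
  have h := PolyExpr.eval_pairIdentity ![q, u, v, 0]
  simp only [PolyExpr.pairIdentity, PolyExpr.eval_add, PolyExpr.eval_mul, PolyExpr.eval_pow,
    PolyExpr.eval_factor, PolyExpr.eval_q, PolyExpr.eval_one, PolyExpr.eval_altTerm,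
    PolyExpr.eval_triple, PolyExpr.eval_vand, PolyExpr.eval_pair, PolyExpr.eval_var,
    Matrix.cons_val] at h
  exact eq_neg_of_add_eq_zero_left h

/-- Joins the term of `alt₄` with first exponent 0 to the other three. The product on the right is
the source of the factorisation of the generating function. -/
theorem qAlt_chain {R : Type*} [CommRing R] (q u v w : R) :
    q ^ 3 * (qFactor q 0 (u * v * w) * qFactor q 1 (u * v * w)) *
      (qPart q u v w - qPart q v u w + qPart q w u v) +
    qFactor q 2 1 * qFactor q 3 1 * (qAlt q u v w * qWeight' q (u * v * w)) =
    -(qFactor q 2 1 * (qFactor q 3 (u * v * w) * qFactor q 4 (u * v * w) *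
      qFactor q 5 (u * v * w) * qFactor q 6 (u * v * w)) *
      (qVand u v w * ((u - q ^ 3) * (v - q ^ 3) * (w - q ^ 3))) *
      (qFactor q 3 (u * v * w * u) * qFactor q 3 (u * v * w * v) *
        qFactor q 3 (u * v * w * w))) := by
  have h := PolyExpr.eval_chainIdentity ![q, u, v, w]
  simp only [PolyExpr.chainIdentity, PolyExpr.eval_add, PolyExpr.eval_sub, PolyExpr.eval_mul,
    PolyExpr.eval_pow, PolyExpr.eval_factor, PolyExpr.eval_q, PolyExpr.eval_one,
    PolyExpr.eval_altTerm, PolyExpr.eval_weight', PolyExpr.eval_vand, PolyExpr.eval_part,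
    PolyExpr.eval_var, Matrix.cons_val] at h
  exact eq_neg_of_add_eq_zero_left h

end PumpIdentity

/-! ### The alternating sum as a rational function -/

section PumpField

variable {K : Type*} [Field K]

/-- The part of the sum over the chain that depends on the last three exponents separately. -/
def qInner (q x y z : K) : K := x * y ^ 2 * z ^ 3 * qRho q z / (qTriple q z * qPair q y z)

theorem alt_qInner {q x y z : K} (hx : qTriple q x ≠ 0) (hy : qTriple q y ≠ 0)
    (hz : qTriple q z ≠ 0) (hxy : qPair q x y ≠ 0) (hxz : qPair q x z ≠ 0)
    (hyz : qPair q y z ≠ 0) :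
    qInner q x y z - qInner q x z y - qInner q y x z + qInner q y z x + qInner q z x y -
      qInner q z y x = qAlt q x y z / (qTriple q x * qTriple q y * qTriple q z *
        (qPair q x y * qPair q x z * qPair q y z)) := by
  have hc : ∀ x y : K, qPair q x y = qPair q y x := fun x y => by
    rw [qPair, qPair, mul_comm x y]
  have h : ∀ {x y z : K}, qTriple q x ≠ 0 → qTriple q y ≠ 0 → qTriple q z ≠ 0 → qPair q x y ≠ 0 →
      qPair q x z ≠ 0 → qPair q y z ≠ 0 → qInner q x y z = qTerm q x y z /
        (qTriple q x * qTriple q y * qTriple q z * (qPair q x y * qPair q x z * qPair q y z)) := by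
    intro x y z hx hy hz hxy hxz hyz
    rw [qInner, qTerm]
    field_simp
  rw [h hx hy hz hxy hxz hyz, h hx hz hy hxz hxy (hc z y ▸ hyz), h hy hx hz (hc y x ▸ hxy) hyz hxz,
    h hy hz hx hyz (hc y x ▸ hxy) (hc z x ▸ hxz), h hz hx hy (hc z x ▸ hxz) (hc z y ▸ hyz) hxy,
    h hz hy hx (hc z y ▸ hyz) (hc z x ▸ hxz) (hc y x ▸ hxy), hc z y, hc y x, hc z x, qAlt]
  simp only [sub_div, add_div]
  congr 1
  · congr 1
    · congr 1
      · congr 1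
        · congr 1
          congr 1
          ring
        · congr 1
          ring
      · congr 1
        ring
    · congr 1
      ring
  · congr 1
    ring

/-- The part of the sum over the chain that depends on the first exponent. -/
def qOuter (q l s : K) : K := qWeight q l s / (qFactor q 0 s * qFactor q 1 s * qFactor q 2 s)

/-- The three factors in u v on the right of `qAlt_pair` are precisely the denominator of `qOuter`
at s = u v q ^ 3. The factors that involve q ^ 3 cancel as well. -/
theorem qOuter_mul_alt_pair {q l u v : K} (h₁ : qFactor q 2 1 * qFactor q 3 1 ≠ 0)
    (hq : qTriple q (q ^ 3) ≠ 0) (hu : qTriple q u ≠ 0) (hv : qTriple q v ≠ 0)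
    (huv : qPair q u v ≠ 0) (huq : qPair q u (q ^ 3) ≠ 0) (hvq : qPair q v (q ^ 3) ≠ 0)
    (h₂ : qFactor q 3 (u * v) * qFactor q 4 (u * v) * qFactor q 5 (u * v) ≠ 0) :
    qOuter q l (u * v * q ^ 3) * (qAlt q u v (q ^ 3) / (qTriple q u * qTriple q v *
      qTriple q (q ^ 3) * (qPair q u v * qPair q u (q ^ 3) * qPair q v (q ^ 3)))) =
    -(q ^ 3 * (u * v * (u - v) * (u - q ^ 3) * (v - q ^ 3)) * qWeight q l (u * v * q ^ 3)) /
      (qFactor q 2 1 * qFactor q 3 1 * (qTriple q u * qTriple q v * qPair q u v)) := by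
  have h := qAlt_pair q u v
  have e₀ : qFactor q 0 (u * v * q ^ 3) = qFactor q 3 (u * v) := by rw [qFactor, qFactor]; ring
  have e₁ : qFactor q 1 (u * v * q ^ 3) = qFactor q 4 (u * v) := by rw [qFactor, qFactor]; ring
  have e₂ : qFactor q 2 (u * v * q ^ 3) = qFactor q 5 (u * v) := by rw [qFactor, qFactor]; ring
  rw [qOuter, e₀, e₁, e₂]
  have h' := eq_div_of_mul_eq h₁ ((mul_comm _ _).trans h)
  rw [h']
  have := left_ne_zero_of_mul h₁
  have := right_ne_zero_of_mul h₁
  have := left_ne_zero_of_mul (left_ne_zero_of_mul h₂)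
  have := right_ne_zero_of_mul (left_ne_zero_of_mul h₂)
  have := right_ne_zero_of_mul h₂
  simp only [qVand]
  field_simp

/-- The sum over the chain, up to factors that are symmetric in the exponents. -/
theorem alt_qOuter_mul {q u v w : K} (h₁ : qFactor q 2 1 * qFactor q 3 1 ≠ 0)
    (hq : qTriple q (q ^ 3) ≠ 0) (hu : qTriple q u ≠ 0) (hv : qTriple q v ≠ 0)
    (hw : qTriple q w ≠ 0) (huv : qPair q u v ≠ 0) (huw : qPair q u w ≠ 0) (hvw : qPair q v w ≠ 0)
    (huq : qPair q u (q ^ 3) ≠ 0) (hvq : qPair q v (q ^ 3) ≠ 0) (hwq : qPair q w (q ^ 3) ≠ 0)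
    (huv' : qFactor q 3 (u * v) * qFactor q 4 (u * v) * qFactor q 5 (u * v) ≠ 0)
    (huw' : qFactor q 3 (u * w) * qFactor q 4 (u * w) * qFactor q 5 (u * w) ≠ 0)
    (hvw' : qFactor q 3 (v * w) * qFactor q 4 (v * w) * qFactor q 5 (v * w) ≠ 0)
    {l : K} (hl : l = u * v * w) (hl' : qFactor q 0 l * qFactor q 1 l * qFactor q 2 l ≠ 0) :
    qOuter q l (v * w * q ^ 3) * (qAlt q v w (q ^ 3) / (qTriple q v * qTriple q w *
      qTriple q (q ^ 3) * (qPair q v w * qPair q v (q ^ 3) * qPair q w (q ^ 3)))) -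
    qOuter q l (u * w * q ^ 3) * (qAlt q u w (q ^ 3) / (qTriple q u * qTriple q w *
      qTriple q (q ^ 3) * (qPair q u w * qPair q u (q ^ 3) * qPair q w (q ^ 3)))) +
    qOuter q l (u * v * q ^ 3) * (qAlt q u v (q ^ 3) / (qTriple q u * qTriple q v *
      qTriple q (q ^ 3) * (qPair q u v * qPair q u (q ^ 3) * qPair q v (q ^ 3)))) -
    qOuter q l l * (qAlt q u v w / (qTriple q u * qTriple q v *
      qTriple q w * (qPair q u v * qPair q u w * qPair q v w))) =
    qFactor q 3 l * qFactor q 4 l * qFactor q 5 l * qFactor q 6 l *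
      (qVand u v w * ((u - q ^ 3) * (v - q ^ 3) * (w - q ^ 3))) *
      (qFactor q 3 (l * u) * qFactor q 3 (l * v) * qFactor q 3 (l * w)) /
      (qFactor q 3 1 * (qFactor q 0 l * qFactor q 1 l) * (qTriple q u * qTriple q v *
      qTriple q w * (qPair q u v * qPair q u w * qPair q v w))) := by
  have hc : ∀ x y : K, qPair q x y = qPair q y x := fun x y => by
    rw [qPair, qPair, mul_comm x y]
  have h := qAlt_chain q u v w
  rw [qOuter_mul_alt_pair h₁ hq hv hw hvw hvq hwq hvw', qOuter_mul_alt_pair h₁ hq hu hw huw huq hwq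
    huw', qOuter_mul_alt_pair h₁ hq hu hv huv huq hvq huv']
  rw [← hl, qPart, qPart, qPart, ← hl, show v * u * w = l by rw [hl]; ring,
    show w * u * v = l by rw [hl]; ring, hc v u, hc w u, hc w v] at h
  have e : qOuter q l l = qWeight' q l / (qFactor q 0 l * qFactor q 1 l) := by
    rw [qOuter, div_eq_div_iff hl' (left_ne_zero_of_mul hl'), qWeight, qWeight']
    ring
  rw [e]
  have := left_ne_zero_of_mul h₁
  have := right_ne_zero_of_mul h₁
  have := left_ne_zero_of_mul (left_ne_zero_of_mul hl')
  have := right_ne_zero_of_mul (left_ne_zero_of_mul hl')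
  generalize qAlt q u v w = k at *
  generalize qWeight' q l = W at *
  generalize qWeight q l (v * w * q ^ 3) = W₁ at *
  generalize qWeight q l (u * w * q ^ 3) = W₂ at *
  generalize qWeight q l (u * v * q ^ 3) = W₃ at *
  generalize qTriple q u = t₁ at *
  generalize qTriple q v = t₂ at *
  generalize qTriple q w = t₃ at *
  generalize qPair q u v = p₁ at *
  generalize qPair q u w = p₂ at *
  generalize qPair q v w = p₃ at *
  generalize qFactor q 0 l = f₀ at *
  generalize qFactor q 1 l = f₁ at *
  generalize qFactor q 2 1 = g₂ at *
  generalize qFactor q 3 1 = g₃ at *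
  generalize qFactor q 3 l * qFactor q 4 l * qFactor q 5 l * qFactor q 6 l = f at *
  generalize qFactor q 3 (l * u) * qFactor q 3 (l * v) * qFactor q 3 (l * w) = f' at *
  generalize qVand u v w * ((u - q ^ 3) * (v - q ^ 3) * (w - q ^ 3)) = V at *
  generalize q ^ 3 = c at *
  clear huv' huw' hvw' hl' huq hvq hwq hq hc h₁ e
  clear hl
  -- In the identity `qAlt_chain` the product on the right carries an additional factor 1 - q ^ 2,
  -- which is cancelled here.
  have h' : ∀ s : K, g₂ * s = g₂ * (f * V * f') → s = f * V * f' := fun s hs =>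
    mul_left_cancel₀ ‹g₂ ≠ 0› hs
  rw [eq_div_iff (by simp only [ne_eq, mul_eq_zero]; tauto)]
  apply h'
  field_simp
  linear_combination -h

end PumpField

/-! ### Closed forms of the sums over the chain -/

section PumpField

variable {K : Type*} [Field K] (φ : ℚ⟦X⟧ →+* K)

/-- 1 - X ^ e is a unit among the power series, so no ring homomorphism to a field sends it to zero.
-/
theorem one_sub_map_X_pow_ne_zero {e : ℕ} (he : 1 ≤ e) : 1 - φ X ^ e ≠ 0 := by
  have h := congrArg φ (geom_mul he)
  rw [map_mul, map_sub, map_one, map_pow] at h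
  exact left_ne_zero_of_mul_eq_one h

theorem map_geom {e : ℕ} (he : 1 ≤ e) : φ (geom e) = (1 - φ X ^ e)⁻¹ := by
  have h := congrArg φ (geom_mul he)
  rw [map_mul, map_sub, map_one, map_pow] at h
  exact eq_inv_of_mul_eq_one_right h

theorem qFactor_pow (q : K) (k n : ℕ) : qFactor q k (q ^ n) = 1 - q ^ (k + n) := by
  rw [qFactor, pow_add]

theorem map_chainKappa {e : ℕ} (he : 1 ≤ e) :
    φ (chainKappa e) = (1 - φ X) / ((1 - φ X ^ e) * (1 - φ X ^ (e + 1))) := by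
  have h₀ := one_sub_map_X_pow_ne_zero φ he
  have h₁ := one_sub_map_X_pow_ne_zero φ (e := e + 1) (by omega)
  rw [chainKappa, map_sub, map_mul, map_geom φ he, map_geom φ (by omega)]
  generalize φ X = q at *
  rw [eq_div_iff (mul_ne_zero h₀ h₁)]
  field_simp
  ring

theorem map_chainSq {e : ℕ} (he : 1 ≤ e) :
    φ (chainSq e) = (1 - φ X) ^ 2 * (1 + φ X ^ (e + 1)) /
      ((1 - φ X ^ e) * (1 - φ X ^ (e + 1)) * (1 - φ X ^ (e + 2))) := by
  have h₀ := one_sub_map_X_pow_ne_zero φ he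
  have h₁ := one_sub_map_X_pow_ne_zero φ (e := e + 1) (by omega)
  have h₂ := one_sub_map_X_pow_ne_zero φ (e := e + 2) (by omega)
  rw [chainSq, map_add, map_sub, map_mul, map_mul, map_mul, map_pow, map_geom φ he,
    map_geom φ (by omega), map_geom φ (by omega), map_ofNat]
  generalize φ X = q at *
  rw [eq_div_iff (mul_ne_zero (mul_ne_zero h₀ h₁) h₂)]
  field_simp
  ring

theorem map_chainRho (d : ℕ) :
    φ (chainRho d) = φ X * (1 - φ X) ^ 2 / ((1 - φ X ^ 3) * (1 - φ X ^ 4)) *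
      (qRho (φ X) (φ X ^ (d + 3)) / qTriple (φ X) (φ X ^ (d + 3))) := by
  have g₁ := one_sub_map_X_pow_ne_zero φ (e := 1) le_rfl
  have g₂ := one_sub_map_X_pow_ne_zero φ (e := 2) (by omega)
  have g₃ := one_sub_map_X_pow_ne_zero φ (e := 3) (by omega)
  have g₄ := one_sub_map_X_pow_ne_zero φ (e := 4) (by omega)
  have h₁ := one_sub_map_X_pow_ne_zero φ (e := 4 + d) (by omega)
  have h₂ := one_sub_map_X_pow_ne_zero φ (e := 5 + d) (by omega)
  have h₃ := one_sub_map_X_pow_ne_zero φ (e := 6 + d) (by omega)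
  have hα : φ chainAlpha = φ X * (1 - φ X) * (1 + φ X ^ 2) / ((1 - φ X ^ 2) * (1 - φ X ^ 3)) := by
    simp only [chainAlpha, map_add, map_sub, map_mul, map_pow, map_ofNat]
    rw [map_geom φ le_rfl, map_geom φ (by omega), map_geom φ (by omega), pow_one]
    rw [pow_one] at g₁
    generalize φ X = q at *
    rw [eq_div_iff (mul_ne_zero g₂ g₃)]
    field_simp
    ring
  have hβ : φ chainBeta = φ X ^ 3 * (1 - φ X) ^ 2 * (1 + φ X ^ 3) /
      ((1 - φ X ^ 2) * (1 - φ X ^ 3) * (1 - φ X ^ 4)) := by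
    simp only [chainBeta, map_add, map_sub, map_mul, map_pow, map_ofNat]
    rw [map_geom φ (by omega), map_geom φ (by omega), map_geom φ (by omega)]
    generalize φ X = q at *
    rw [eq_div_iff (mul_ne_zero (mul_ne_zero g₂ g₃) g₄)]
    field_simp
    ring
  simp only [chainRho, map_add, map_sub, map_mul, hα, hβ]
  rw [map_geom φ (by omega), map_geom φ (by omega), map_geom φ (by omega)]
  generalize φ X = q at *
  have e₁ : qFactor q 1 (q ^ (d + 3)) = 1 - q ^ (4 + d) := by rw [qFactor_pow]; congr 2; ring
  have e₂ : qFactor q 2 (q ^ (d + 3)) = 1 - q ^ (5 + d) := by rw [qFactor_pow]; congr 2; ring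
  have e₃ : qFactor q 3 (q ^ (d + 3)) = 1 - q ^ (6 + d) := by rw [qFactor_pow]; congr 2; ring
  rw [qTriple, e₁, e₂, e₃, qRho]
  have w₁ : q ^ (4 + d) = q * q ^ (d + 3) := by ring
  have w₂ : q ^ (5 + d) = q ^ 2 * q ^ (d + 3) := by ring
  have w₃ : q ^ (6 + d) = q ^ 3 * q ^ (d + 3) := by ring
  rw [w₁] at h₁ ⊢
  rw [w₂] at h₂ ⊢
  rw [w₃] at h₃ ⊢
  generalize q ^ (d + 3) = z at *
  rw [div_mul_div_comm, eq_div_iff (mul_ne_zero (mul_ne_zero g₃ g₄)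
    (mul_ne_zero (mul_ne_zero h₁ h₂) h₃))]
  field_simp
  ring

/-- Separates the exponents: l is symmetric in all four, the first one enters otherwise only through
s = l - a, and the last three through `qInner`. The factor X ^ 18 turns X ^ (b + 2c + 3d) into x y²
z³, since 18 = 3 + 2 · 3 + 3 · 3. -/
theorem map_chainTotal (a b c d l s : ℕ) (hl : a + b + c + d + 9 = l) (hs : b + c + d + 9 = s) :
    φ X ^ 18 * φ (chainTotal a b c d) = φ X ^ 2 * (1 - φ X) ^ 6 / ((1 - φ X ^ 3) * (1 - φ X ^ 4) *
      (qFactor (φ X) 2 (φ X ^ l) * qFactor (φ X) 3 (φ X ^ l) * qFactor (φ X) 4 (φ X ^ l) *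
        qFactor (φ X) 5 (φ X ^ l) * qFactor (φ X) 6 (φ X ^ l))) *
      qOuter (φ X) (φ X ^ l) (φ X ^ s) *
      qInner (φ X) (φ X ^ (b + 3)) (φ X ^ (c + 3)) (φ X ^ (d + 3)) := by
  have h := fun e (he : 1 ≤ e) => one_sub_map_X_pow_ne_zero φ he
  rw [chainTotal]
  simp only [map_sub, map_mul, map_pow]
  rw [map_chainRho, map_chainKappa φ (by omega), map_chainKappa φ (by omega),
    map_chainKappa φ (by omega), map_chainSq φ (by omega), map_chainSq φ (by omega),
    map_geom φ (by omega), qOuter, qInner, qPair, ← pow_add (φ X) (c + 3), qWeight]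
  generalize φ X = q at *
  simp only [qFactor_pow]
  have h₁ := h (7 + c + d) (by omega)
  have h₂ := h (8 + c + d) (by omega)
  have h₃ := h (9 + b + c + d) (by omega)
  have h₄ := h (10 + b + c + d) (by omega)
  have h₅ := h (11 + b + c + d) (by omega)
  have h₆ := h (11 + a + b + c + d) (by omega)
  have h₇ := h (12 + a + b + c + d) (by omega)
  have h₈ := h (13 + a + b + c + d) (by omega)
  have h₉ := h (14 + a + b + c + d) (by omega)
  have h₁₀ := h (15 + a + b + c + d) (by omega)
  rw [show 7 + c + d + 1 = 8 + c + d by ring, show 9 + b + c + d + 1 = 10 + b + c + d by ring,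
    show 10 + b + c + d + 1 = 11 + b + c + d by ring,
    show 11 + a + b + c + d + 1 = 12 + a + b + c + d by ring,
    show 11 + a + b + c + d + 2 = 13 + a + b + c + d by ring,
    show 12 + a + b + c + d + 1 = 13 + a + b + c + d by ring,
    show 12 + a + b + c + d + 2 = 14 + a + b + c + d by ring,
    show 1 + (c + 3 + (d + 3)) = 7 + c + d by ring, show 2 + (c + 3 + (d + 3)) = 8 + c + d by ring,
    show 0 + s = 9 + b + c + d by omega, show 1 + s = 10 + b + c + d by omega,
    show 2 + s = 11 + b + c + d by omega, show 2 + l = 11 + a + b + c + d by omega,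
    show 3 + l = 12 + a + b + c + d by omega, show 4 + l = 13 + a + b + c + d by omega,
    show 5 + l = 14 + a + b + c + d by omega, show 6 + l = 15 + a + b + c + d by omega,
    ← pow_add q 3, ← pow_add q 4, show 3 + l = 12 + a + b + c + d by omega,
    show 4 + l = 13 + a + b + c + d by omega]
  have hx : q ^ 18 * q ^ (b + 2 * c + 3 * d) =
      q ^ (b + 3) * (q ^ (c + 3)) ^ 2 * (q ^ (d + 3)) ^ 3 := by ring
  rw [← hx]
  generalize q ^ (b + 2 * c + 3 * d) = y
  generalize qRho q (q ^ (d + 3)) = r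
  generalize qTriple q (q ^ (d + 3)) = t
  generalize (1 - q ^ 3) * (1 - q ^ 4) = g
  clear h hx
  generalize q ^ (7 + c + d) = y₁ at *
  generalize q ^ (8 + c + d) = y₂ at *
  generalize q ^ (9 + b + c + d) = y₃ at *
  generalize q ^ (10 + b + c + d) = y₄ at *
  generalize q ^ (11 + b + c + d) = y₅ at *
  generalize q ^ (11 + a + b + c + d) = y₆ at *
  generalize q ^ (12 + a + b + c + d) = y₇ at *
  generalize q ^ (13 + a + b + c + d) = y₈ at *
  generalize q ^ (14 + a + b + c + d) = y₉ at *
  generalize q ^ (15 + a + b + c + d) = y₁₀ at *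
  have e : (1 - q) / ((1 - y₃) * (1 - y₄)) * ((1 - q) ^ 2 * (1 + y₇) / ((1 - y₆) * (1 - y₇) * (1 - y₈))) -
      q ^ 2 * (((1 - q) / ((1 - y₄) * (1 - y₅))) * ((1 - q) ^ 2 * (1 + y₈) / ((1 - y₇) * (1 - y₈) * (1 - y₉)))) =
      (1 - q) ^ 3 * ((1 + y₇) * (1 - y₅) * (1 - y₉) - q ^ 2 * (1 + y₈) * (1 - y₃) * (1 - y₆)) /
        ((1 - y₃) * (1 - y₄) * (1 - y₅) * ((1 - y₆) * (1 - y₇) * (1 - y₈) * (1 - y₉))) := by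
    field_simp
  rw [mul_assoc (q ^ 2), e]
  generalize (1 + y₇) * (1 - y₅) * (1 - y₉) - q ^ 2 * (1 + y₈) * (1 - y₃) * (1 - y₆) = w
  simp only [div_eq_mul_inv, mul_inv]
  ring

end PumpField

section PumpField

variable {K : Type*} [Field K] (φ : ℚ⟦X⟧ →+* K)

theorem qTriple_pow (q : K) (a : ℕ) : qTriple q (q ^ (a + 3)) =
    (1 - q ^ (a + 4)) * (1 - q ^ (a + 5)) * (1 - q ^ (a + 6)) := by
  simp only [qTriple, qFactor_pow]
  rw [show 1 + (a + 3) = a + 4 by ring, show 2 + (a + 3) = a + 5 by ring,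
    show 3 + (a + 3) = a + 6 by ring]

theorem qPair_pow (q : K) (a b : ℕ) : qPair q (q ^ (a + 3)) (q ^ (b + 3)) =
    (1 - q ^ (a + b + 7)) * (1 - q ^ (a + b + 8)) := by
  simp only [qPair, ← pow_add q (a + 3), qFactor_pow]
  rw [show 1 + (a + 3 + (b + 3)) = a + b + 7 by ring, show 2 + (a + 3 + (b + 3)) = a + b + 8 by ring]

theorem qTriple_pow_ne_zero (a : ℕ) : qTriple (φ X) (φ X ^ (a + 3)) ≠ 0 := by
  have h := fun e (he : 1 ≤ e) => one_sub_map_X_pow_ne_zero φ he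
  rw [qTriple_pow]
  exact mul_ne_zero (mul_ne_zero (h _ (by omega)) (h _ (by omega))) (h _ (by omega))

theorem qPair_pow_ne_zero (a b : ℕ) : qPair (φ X) (φ X ^ (a + 3)) (φ X ^ (b + 3)) ≠ 0 := by
  have h := fun e (he : 1 ≤ e) => one_sub_map_X_pow_ne_zero φ he
  rw [qPair_pow]
  exact mul_ne_zero (h _ (by omega)) (h _ (by omega))

/-- The factor of the sums over the chain that is symmetric in the exponents. -/
def qScale (q l : K) : K := q ^ 2 * (1 - q) ^ 6 / ((1 - q ^ 3) * (1 - q ^ 4) *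
  (qFactor q 2 l * qFactor q 3 l * qFactor q 4 l * qFactor q 5 l * qFactor q 6 l))

theorem map_alt₃_chainTotal (a b c d l s : ℕ) (hl : a + b + c + d + 9 = l) (hs : b + c + d + 9 = s) :
    φ X ^ 18 * φ (alt₃ (chainTotal a) b c d) = qScale (φ X) (φ X ^ l) *
      (qOuter (φ X) (φ X ^ l) (φ X ^ s) * (qAlt (φ X) (φ X ^ (b + 3)) (φ X ^ (c + 3)) (φ X ^ (d + 3)) /
      (qTriple (φ X) (φ X ^ (b + 3)) * qTriple (φ X) (φ X ^ (c + 3)) *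
        qTriple (φ X) (φ X ^ (d + 3)) * (qPair (φ X) (φ X ^ (b + 3)) (φ X ^ (c + 3)) *
        qPair (φ X) (φ X ^ (b + 3)) (φ X ^ (d + 3)) *
        qPair (φ X) (φ X ^ (c + 3)) (φ X ^ (d + 3)))))) := by
  rw [← alt_qInner (qTriple_pow_ne_zero φ b) (qTriple_pow_ne_zero φ c) (qTriple_pow_ne_zero φ d)
    (qPair_pow_ne_zero φ b c) (qPair_pow_ne_zero φ b d) (qPair_pow_ne_zero φ c d), alt₃]
  simp only [map_sub, map_add, mul_sub, mul_add]
  rw [map_chainTotal φ a b c d l s (by omega) (by omega),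
    map_chainTotal φ a b d c l s (by omega) (by omega),
    map_chainTotal φ a c b d l s (by omega) (by omega),
    map_chainTotal φ a c d b l s (by omega) (by omega),
    map_chainTotal φ a d b c l s (by omega) (by omega),
    map_chainTotal φ a d c b l s (by omega) (by omega), ← qScale]
  simp only [mul_assoc]

/-- Bookkeeping: four factors in the denominator of `qScale` cancel against the numerator in
`alt_qOuter_mul`. -/
theorem div_mul_div_cancel_four {n V m N f₁ f₂ f₃ f₄ y₀ y₁ y₂ g₃ g₄ T c : K} (h₁ : f₁ ≠ 0)
    (h₂ : f₂ ≠ 0) (h₃ : f₃ ≠ 0) (h₄ : f₄ ≠ 0) (e : n * V = c * m) :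
    n / (g₃ * g₄ * (y₂ * f₁ * f₂ * f₃ * f₄)) * (f₁ * f₂ * f₃ * f₄ * V * N / (g₃ * (y₀ * y₁) * T)) =
      c * (m * N / (g₃ ^ 2 * g₄ * (y₀ * y₁ * y₂) * T)) := by
  rw [div_mul_div_comm, ← mul_div_assoc,
    show n * (f₁ * f₂ * f₃ * f₄ * V * N) = f₁ * f₂ * f₃ * f₄ * (c * (m * N)) by
      linear_combination f₁ * f₂ * f₃ * f₄ * N * e,
    show g₃ * g₄ * (y₂ * f₁ * f₂ * f₃ * f₄) * (g₃ * (y₀ * y₁) * T) =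
      f₁ * f₂ * f₃ * f₄ * (g₃ ^ 2 * g₄ * (y₀ * y₁ * y₂) * T) by ring,
    mul_div_mul_left _ _ (mul_ne_zero (mul_ne_zero (mul_ne_zero h₁ h₂) h₃) h₄)]

/-- The differences such as u - v in `alt_qOuter_mul` become powers of q times factors 1 - q ^ e, up
to sign. The six signs cancel, and the powers multiply to q ^ (18 + b + 2c); the remaining q ^ 2
comes from `qScale`. -/
theorem map_alt₄_chainTotal (hX : φ X ≠ 0) {a b c : ℕ} (hab : b ≤ a) (hbc : c ≤ b) :
    φ (alt₄ chainTotal a b c 0) = φ X ^ (2 + b + 2 * c) * (1 - φ X) ^ 6 *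
      ((1 - φ X ^ (a - b)) * (1 - φ X ^ (a - c)) * (1 - φ X ^ (b - c)) *
        ((1 - φ X ^ a) * (1 - φ X ^ b) * (1 - φ X ^ c))) *
      ((1 - φ X ^ (15 + (a + b + c) + a)) * (1 - φ X ^ (15 + (a + b + c) + b)) *
        (1 - φ X ^ (15 + (a + b + c) + c))) /
      ((1 - φ X ^ 3) ^ 2 * (1 - φ X ^ 4) * ((1 - φ X ^ (9 + (a + b + c))) *
        (1 - φ X ^ (10 + (a + b + c))) * (1 - φ X ^ (11 + (a + b + c)))) *
        ((1 - φ X ^ (a + 4)) * (1 - φ X ^ (a + 5)) * (1 - φ X ^ (a + 6)) *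
        ((1 - φ X ^ (b + 4)) * (1 - φ X ^ (b + 5)) * (1 - φ X ^ (b + 6))) *
        ((1 - φ X ^ (c + 4)) * (1 - φ X ^ (c + 5)) * (1 - φ X ^ (c + 6))) *
        ((1 - φ X ^ (a + b + 7)) * (1 - φ X ^ (a + b + 8)) *
        ((1 - φ X ^ (a + c + 7)) * (1 - φ X ^ (a + c + 8))) *
        ((1 - φ X ^ (b + c + 7)) * (1 - φ X ^ (b + c + 8)))))) := by
  have h := fun e (he : 1 ≤ e) => one_sub_map_X_pow_ne_zero φ he
  have hf : ∀ a b : ℕ, qFactor (φ X) 3 (φ X ^ (a + 3) * φ X ^ (b + 3)) *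
      qFactor (φ X) 4 (φ X ^ (a + 3) * φ X ^ (b + 3)) *
      qFactor (φ X) 5 (φ X ^ (a + 3) * φ X ^ (b + 3)) ≠ 0 := fun a b => by
    simp only [← pow_add (φ X) (a + 3), qFactor_pow]
    exact mul_ne_zero (mul_ne_zero (h _ (by omega)) (h _ (by omega))) (h _ (by omega))
  have e₀ : φ X ^ 3 = φ X ^ (0 + 3) := rfl
  have key := alt_qOuter_mul (q := φ X) (u := φ X ^ (a + 3)) (v := φ X ^ (b + 3))
    (w := φ X ^ (c + 3)) (by
      rw [qFactor, qFactor, mul_one, mul_one]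
      exact mul_ne_zero (h _ (by omega)) (h _ (by omega)))
    (qTriple_pow_ne_zero φ 0) (qTriple_pow_ne_zero φ a) (qTriple_pow_ne_zero φ b)
    (qTriple_pow_ne_zero φ c) (qPair_pow_ne_zero φ a b) (qPair_pow_ne_zero φ a c)
    (qPair_pow_ne_zero φ b c) (qPair_pow_ne_zero φ a 0) (qPair_pow_ne_zero φ b 0)
    (qPair_pow_ne_zero φ c 0) (hf a b) (hf a c) (hf b c) (l := φ X ^ (a + b + c + 9)) (by ring) (by
      simp only [qFactor_pow]
      exact mul_ne_zero (mul_ne_zero (h _ (by omega)) (h _ (by omega))) (h _ (by omega)))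
  have t₁ := map_alt₃_chainTotal φ a b c 0 (a + b + c + 9) (b + c + 9) (by omega) (by omega)
  have t₂ := map_alt₃_chainTotal φ b a c 0 (a + b + c + 9) (a + c + 9) (by omega) (by omega)
  have t₃ := map_alt₃_chainTotal φ c a b 0 (a + b + c + 9) (a + b + 9) (by omega) (by omega)
  have t₄ := map_alt₃_chainTotal φ 0 a b c (a + b + c + 9) (a + b + c + 9) (by omega) (by omega)
  have total := Eq.trans (a := φ X ^ 18 * φ (alt₄ chainTotal a b c 0)) (by
    rw [alt₄]
    simp only [map_sub, map_add, mul_sub, mul_add]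
    rw [t₁, t₂, t₃, t₄, ← e₀,
      show φ X ^ (b + c + 9) = φ X ^ (b + 3) * φ X ^ (c + 3) * φ X ^ 3 by ring,
      show φ X ^ (a + c + 9) = φ X ^ (a + 3) * φ X ^ (c + 3) * φ X ^ 3 by ring,
      show φ X ^ (a + b + 9) = φ X ^ (a + 3) * φ X ^ (b + 3) * φ X ^ 3 by ring])
    (congrArg (fun t => qScale (φ X) (φ X ^ (a + b + c + 9)) * t) key)
  clear t₁ t₂ t₃ t₄ key hf
  have hd : ∀ {a b : ℕ}, b ≤ a → φ X ^ (a + 3) - φ X ^ (b + 3) =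
      -(φ X ^ (b + 3) * (1 - φ X ^ (a - b))) := fun {a b} hab => by
    rw [mul_sub, ← pow_add, show b + 3 + (a - b) = a + 3 by omega]
    ring
  have hd₀ : ∀ a : ℕ, φ X ^ (a + 3) - φ X ^ 3 = -(φ X ^ 3 * (1 - φ X ^ a)) := fun a => by ring
  rw [qVand, hd hab, hd (hbc.trans hab), hd hbc, hd₀, hd₀, hd₀, qTriple_pow, qTriple_pow, qTriple_pow,
    qPair_pow, qPair_pow, qPair_pow, qScale] at total
  simp only [← pow_add (φ X) (a + b + c + 9), qFactor_pow] at total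
  rw [qFactor, mul_one] at total
  rw [show 2 + (a + b + c + 9) = 11 + (a + b + c) by ring,
    show 0 + (a + b + c + 9) = 9 + (a + b + c) by ring,
    show 1 + (a + b + c + 9) = 10 + (a + b + c) by ring,
    show 3 + (a + b + c + 9 + (a + 3)) = 15 + (a + b + c) + a by ring,
    show 3 + (a + b + c + 9 + (b + 3)) = 15 + (a + b + c) + b by ring,
    show 3 + (a + b + c + 9 + (c + 3)) = 15 + (a + b + c) + c by ring] at total
  have h₁ := h (3 + (a + b + c + 9)) (by omega)
  have h₂ := h (4 + (a + b + c + 9)) (by omega)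
  have h₃ := h (5 + (a + b + c + 9)) (by omega)
  have h₄ := h (6 + (a + b + c + 9)) (by omega)
  refine mul_left_cancel₀ (pow_ne_zero 18 hX) (total.trans ?_)
  refine div_mul_div_cancel_four h₁ h₂ h₃ h₄ ?_
  ring

end PumpField

/-! ### The product of the hook lengths -/

section PumpProduct

variable (lam : Par 3) {M : Type*} [CommMonoid M]

theorem prod_Ioc_add_sub (G : ℕ → M) (a b k : ℕ) :
    ∏ c ∈ Finset.Ioc (a + k) (b + k), G (c - k) = ∏ e ∈ Finset.Ioc a b, G e := by
  refine Finset.prod_nbij' (· - k) (· + k) ?_ ?_ ?_ ?_ ?_ <;> intro c hc <;>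
    simp only [Finset.mem_Ioc] at hc ⊢
  · omega
  · omega
  · omega
  · omega

theorem prod_Icc_add (G : ℕ → M) (n k : ℕ) :
    ∏ d ∈ Finset.Icc 1 n, G (d + k) = ∏ c ∈ Finset.Ioc k (k + n), G c := by
  refine Finset.prod_nbij' (· + k) (· - k) ?_ ?_ ?_ ?_ ?_ <;> intro c hc <;>
    simp only [Finset.mem_Ioc, Finset.mem_Icc] at hc ⊢
  · omega
  · omega
  · omega
  · omega

theorem prod_Ioc_reflect (f : ℕ → M) (n : ℕ) :
    ∏ e ∈ Finset.Ioc 0 (n - 1), f (n - e) = ∏ e ∈ Finset.Ioc 0 (n - 1), f e := by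
  refine Finset.prod_nbij' (n - ·) (n - ·) ?_ ?_ ?_ ?_ ?_ <;> intro c hc <;>
    simp only [Finset.mem_Ioc] at hc ⊢
  · omega
  · omega
  · omega
  · omega

theorem prod_Ioc_pred_mul (f : ℕ → M) {n : ℕ} (hn : 1 ≤ n) :
    (∏ e ∈ Finset.Ioc 0 (n - 1), f e) * f n = ∏ e ∈ Finset.Ioc 0 n, f e := by
  obtain ⟨n, rfl⟩ : ∃ k, n = k + 1 := ⟨n - 1, by omega⟩
  rw [Finset.prod_Ioc_succ_top (Nat.zero_le n), Nat.add_sub_cancel]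

/-- The difference between a strict part and the hook length in a column. -/
def colGap (c : ℕ) : ℕ := c - lam.1.colLen (c - 4)

theorem colLen_le_three (c : ℕ) : lam.1.colLen c ≤ 3 :=
  (lam.1.colLen_anti 0 c (Nat.zero_le c)).trans lam.2

theorem cellHook_eq_sub {r c : ℕ} (hc : 3 < c) : cellHook lam r c = lam.strict r - colGap lam c := by
  have := colLen_le_three lam (c - 4)
  rw [cellHook, if_neg (by omega), colGap]
  omega

theorem cellHook_of_le {r c : ℕ} (hc : c ≤ 3) : cellHook lam r c = lam.strict r + (7 - c) := by
  rw [cellHook, if_pos hc]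
  omega

/-- Along row r the gaps from column 4 on, together with the l_s for s > r, run through 1, …, l_r -
1: the gap grows by one from column to column and skips l_s where row s ends. This lemma and the
next two treat r = 2, 1, 0. -/
theorem prod_colGap_two (G : ℕ → M) : ∏ c ∈ Finset.Ioc 3 (2 + lam.strict 2), G (colGap lam c) =
    ∏ e ∈ Finset.Ioc 0 (lam.strict 2 - 1), G e := by
  obtain ⟨h₁, h₂, h₃⟩ := lam.strict_lt
  rw [← prod_Ioc_add_sub G 0 _ 3, show lam.strict 2 - 1 + 3 = 2 + lam.strict 2 by omega]
  refine Finset.prod_congr rfl fun c hc => ?_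
  rw [Finset.mem_Ioc] at hc
  have := (lam.lt_colLen_iff (r := 2) (c := c) (by omega) (by omega)).2 hc.2
  have := colLen_le_three lam (c - 4)
  rw [colGap, show lam.1.colLen (c - 4) = 3 by omega]

theorem prod_colGap_one (G : ℕ → M) :
    (∏ c ∈ Finset.Ioc 3 (1 + lam.strict 1), G (colGap lam c)) * G (lam.strict 2) =
    ∏ e ∈ Finset.Ioc 0 (lam.strict 1 - 1), G e := by
  obtain ⟨h₁, h₂, h₃⟩ := lam.strict_lt
  rw [← Finset.prod_Ioc_consecutive _ (show 3 ≤ 2 + lam.strict 2 by omega)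
    (show 2 + lam.strict 2 ≤ 1 + lam.strict 1 by omega), prod_colGap_two, mul_right_comm,
    prod_Ioc_pred_mul G h₃, ← Finset.prod_Ioc_consecutive G (Nat.zero_le (lam.strict 2))
    (show lam.strict 2 ≤ lam.strict 1 - 1 by omega), ← prod_Ioc_add_sub G (lam.strict 2) _ 2,
    show lam.strict 1 - 1 + 2 = 1 + lam.strict 1 by omega, add_comm 2]
  congr 1
  refine Finset.prod_congr rfl fun c hc => ?_
  rw [Finset.mem_Ioc] at hc
  have := (lam.lt_colLen_iff (r := 1) (c := c) (by omega) (by omega)).2 hc.2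
  have := mt (lam.lt_colLen_iff (r := 2) (c := c) (by omega) (by omega)).1 (by omega)
  rw [colGap, show lam.1.colLen (c - 4) = 2 by omega]

theorem prod_colGap_zero (G : ℕ → M) :
    (∏ c ∈ Finset.Ioc 3 (lam.strict 0), G (colGap lam c)) * (G (lam.strict 1) * G (lam.strict 2)) =
    ∏ e ∈ Finset.Ioc 0 (lam.strict 0 - 1), G e := by
  obtain ⟨h₁, h₂, h₃⟩ := lam.strict_lt
  rw [← Finset.prod_Ioc_consecutive _ (show 3 ≤ 1 + lam.strict 1 by omega)
    (show 1 + lam.strict 1 ≤ lam.strict 0 by omega), mul_right_comm, mul_comm (G (lam.strict 1)),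
    ← mul_assoc, prod_colGap_one, prod_Ioc_pred_mul G (by omega),
    ← Finset.prod_Ioc_consecutive G (Nat.zero_le (lam.strict 1))
    (show lam.strict 1 ≤ lam.strict 0 - 1 by omega), ← prod_Ioc_add_sub G (lam.strict 1) _ 1,
    show lam.strict 0 - 1 + 1 = lam.strict 0 by omega, add_comm 1]
  congr 1
  refine Finset.prod_congr rfl fun c hc => ?_
  rw [Finset.mem_Ioc] at hc
  have := (lam.lt_colLen_iff (r := 0) (c := c) (by omega) (by omega)).2 (by omega)
  have := mt (lam.lt_colLen_iff (r := 1) (c := c) (by omega) (by omega)).1 (by omega)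
  rw [colGap, show lam.1.colLen (c - 4) = 1 by omega]

/-- Apply `prod_colGap_zero` to f (l₀ - e): the hook lengths from column 4 on, the differences l₀ -
l₁ and l₀ - l₂, and l₀ itself make up 1, …, l₀. The columns 1, 2, 3 contribute l₀ + 6, l₀ + 5, l₀ +
4. -/
theorem prod_row_zero (f : ℕ → M) :
    (∏ d ∈ Finset.Icc 1 (lam.strict 0), f (cellHook lam 0 d)) *
      (f (lam.strict 0 - lam.strict 1) * f (lam.strict 0 - lam.strict 2)) * f (lam.strict 0) =
    f (lam.strict 0 + 6) * f (lam.strict 0 + 5) * f (lam.strict 0 + 4) *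
      ∏ i ∈ Finset.Ioc 0 (lam.strict 0), f i := by
  obtain ⟨h₁, h₂, h₃⟩ := lam.strict_lt
  have h : Finset.Icc 1 (lam.strict 0) = Finset.Ioc 0 (lam.strict 0) := rfl
  rw [h, ← Finset.prod_Ioc_consecutive _ (Nat.zero_le 3) (show 3 ≤ lam.strict 0 by omega),
    Finset.prod_congr (M := M) (s₁ := Finset.Ioc 3 (lam.strict 0)) rfl fun c hc => by
      rw [cellHook_eq_sub lam (Finset.mem_Ioc.1 hc).1],
    mul_assoc (∏ i ∈ Finset.Ioc 0 3, _),
    prod_colGap_zero lam fun e => f (lam.strict 0 - e), prod_Ioc_reflect, mul_assoc,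
    prod_Ioc_pred_mul f (by omega)]
  congr 1
  have e : Finset.Ioc 0 3 = {1, 2, 3} := rfl
  rw [e, Finset.prod_insert (by decide), Finset.prod_pair (by decide), ← mul_assoc, cellHook_of_le lam (by omega),
    cellHook_of_le lam (by omega), cellHook_of_le lam (by omega)]

theorem prod_row_one (f : ℕ → M) :
    (∏ d ∈ Finset.Icc 1 (lam.strict 1), f (cellHook lam 1 (d + 1))) *
      f (lam.strict 1 - lam.strict 2) * f (lam.strict 1) =
    f (lam.strict 1 + 5) * f (lam.strict 1 + 4) * ∏ i ∈ Finset.Ioc 0 (lam.strict 1), f i := by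
  obtain ⟨h₁, h₂, h₃⟩ := lam.strict_lt
  have h := prod_Icc_add (fun c => f (cellHook lam 1 c)) (lam.strict 1) 1
  rw [h, ← Finset.prod_Ioc_consecutive _ (show 1 ≤ 3 by omega) (show 3 ≤ 1 + lam.strict 1 by omega),
    Finset.prod_congr (M := M) (s₁ := Finset.Ioc 3 (1 + lam.strict 1)) rfl fun c hc => by
      rw [cellHook_eq_sub lam (Finset.mem_Ioc.1 hc).1],
    mul_assoc (∏ i ∈ Finset.Ioc 1 3, _),
    prod_colGap_one lam fun e => f (lam.strict 1 - e), prod_Ioc_reflect, mul_assoc,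
    prod_Ioc_pred_mul f (by omega)]
  congr 1
  have e : Finset.Ioc 1 3 = {2, 3} := rfl
  rw [e, Finset.prod_pair (by decide), cellHook_of_le lam (by omega),
    cellHook_of_le lam (by omega)]

theorem prod_row_two (f : ℕ → M) :
    (∏ d ∈ Finset.Icc 1 (lam.strict 2), f (cellHook lam 2 (d + 2))) * f (lam.strict 2) =
    f (lam.strict 2 + 4) * ∏ i ∈ Finset.Ioc 0 (lam.strict 2), f i := by
  obtain ⟨h₁, h₂, h₃⟩ := lam.strict_lt
  have h := prod_Icc_add (fun c => f (cellHook lam 2 c)) (lam.strict 2) 2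
  rw [h, ← Finset.prod_Ioc_consecutive _ (show 2 ≤ 3 by omega) (show 3 ≤ 2 + lam.strict 2 by omega),
    Finset.prod_congr (M := M) (s₁ := Finset.Ioc 3 (2 + lam.strict 2)) rfl fun c hc => by
      rw [cellHook_eq_sub lam (Finset.mem_Ioc.1 hc).1],
    prod_colGap_two lam fun e => f (lam.strict 2 - e), prod_Ioc_reflect, mul_assoc,
    prod_Ioc_pred_mul f (by omega)]
  congr 1
  have e : Finset.Ioc 2 3 = {3} := rfl
  rw [e, Finset.prod_singleton, cellHook_of_le lam (by omega)]

/-- From column 4 on, subtracting `cellHook` leaves 15 + L plus the gap of the column. So the gaps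
of row 0 occur again, now counted upwards. The columns 1, 2, 3 contribute 9 + L, 10 + L, 11 + L. -/
theorem prod_top (f : ℕ → M) {L : ℕ} (hL : L = lam.strict 0 + lam.strict 1 + lam.strict 2) :
    (∏ d ∈ Finset.Icc 1 (lam.strict 0),
      f (15 + 2 * lam.strict 0 + lam.strict 1 + lam.strict 2 - cellHook lam 0 d)) *
      (f (15 + L + lam.strict 1) * f (15 + L + lam.strict 2)) * f (15 + L + lam.strict 0) =
    f (9 + L) * f (10 + L) * f (11 + L) * ∏ i ∈ Finset.Ioc 0 (lam.strict 0), f (15 + L + i) := by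
  obtain ⟨h₁, h₂, h₃⟩ := lam.strict_lt
  have h : Finset.Icc 1 (lam.strict 0) = Finset.Ioc 0 (lam.strict 0) := rfl
  rw [h, ← Finset.prod_Ioc_consecutive _ (Nat.zero_le 3) (show 3 ≤ lam.strict 0 by omega),
    Finset.prod_congr (M := M) (s₁ := Finset.Ioc 3 (lam.strict 0))
      (g := fun c => f (15 + L + colGap lam c)) rfl fun c hc => by
      rw [Finset.mem_Ioc] at hc
      have : colGap lam c ≤ c := Nat.sub_le _ _
      rw [cellHook_eq_sub lam hc.1]
      congr 1
      omega,
    mul_assoc (∏ i ∈ Finset.Ioc 0 3, _),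
    prod_colGap_zero lam fun e => f (15 + L + e), mul_assoc,
    prod_Ioc_pred_mul (fun e => f (15 + L + e)) (by omega)]
  congr 1
  have e : Finset.Ioc 0 3 = {1, 2, 3} := rfl
  rw [e, Finset.prod_insert (by decide), Finset.prod_pair (by decide), ← mul_assoc, cellHook_of_le lam (by omega),
    cellHook_of_le lam (by omega), cellHook_of_le lam (by omega)]
  congr 1
  · congr 1 <;> (congr 1; omega)
  · congr 1
    omega

end PumpProduct

/-! ### Comparison of the generating function with the hook lengths -/

section PumpFormula

variable (lam : Par 3)

/-- The product over the hook lengths of the pump. -/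
theorem prod_pumpHook {M : Type*} [CommRing M] (f : ℕ → M) {a b c L : ℕ} (ha : lam.strict 0 = a)
    (hb : lam.strict 1 = b) (hc : lam.strict 2 = c) (hL : L = a + b + c) :
    (∏ x : Pump lam, f (pumpHook x)) * (f (a - b) * f (a - c) * f (b - c) * (f a * f b * f c) *
      (f (15 + L + a) * f (15 + L + b) * f (15 + L + c))) =
    (f 1 * f 2 ^ 2 * f 3 ^ 2 * f 4) * (f (9 + L) * f (10 + L) * f (11 + L)) *
      (f (a + 4) * f (a + 5) * f (a + 6) * (f (b + 4) * f (b + 5) * f (b + 6)) *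
        (f (c + 4) * f (c + 5) * f (c + 6)) * (f (a + b + 7) * f (a + b + 8) *
        (f (a + c + 7) * f (a + c + 8)) * (f (b + c + 7) * f (b + c + 8)))) *
      ((∏ i ∈ Finset.Ioc 0 a, f i) * (∏ i ∈ Finset.Ioc 0 b, f i) * (∏ i ∈ Finset.Ioc 0 c, f i)) *
      ∏ i ∈ Finset.Ioc 0 a, f (15 + L + i) := by
  have h₀ := prod_row_zero lam f
  have h₁ := prod_row_one lam f
  have h₂ := prod_row_two lam f
  have h₃ := prod_top lam f (L := L) (by omega)
  have h := prod_pump (lam := lam) fun a d h => f (pumpHookAt lam a d h)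
  have e₀ : pumpHookAt lam 0 0 2 = 1 := rfl
  have e₁ : pumpHookAt lam 0 0 4 = 3 := rfl
  have e₂ : pumpHookAt lam 0 0 6 = c + 5 := by rw [← hc, add_comm]; rfl
  have e₃ : pumpHookAt lam 0 0 8 = b + 6 := by rw [← hb, add_comm]; rfl
  have e₄ : pumpHookAt lam 0 0 10 = a + c + 7 := by
    rw [← ha, ← hc, add_comm, ← add_assoc]; rfl
  have e₅ : pumpHookAt lam 0 0 12 = a + b + 8 := by
    rw [← ha, ← hb, add_comm, ← add_assoc]; rfl
  have e₆ : pumpHookAt lam 1 1 3 = 2 := rfl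
  have e₇ : pumpHookAt lam 1 1 7 = c + 6 := by rw [← hc, add_comm]; rfl
  have e₈ : pumpHookAt lam 1 1 11 = a + b + 7 := by
    rw [← ha, ← hb, add_comm, ← add_assoc]; rfl
  have e₉ : pumpHookAt lam 2 1 3 = 2 := rfl
  have e₁₀ : pumpHookAt lam 2 1 5 = 4 := rfl
  have e₁₁ : pumpHookAt lam 2 1 9 = b + c + 7 := by
    rw [← hb, ← hc, add_comm, ← add_assoc]; rfl
  have e₁₂ : pumpHookAt lam 2 1 11 = a + c + 8 := by
    rw [← ha, ← hc, add_comm, ← add_assoc]; rfl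
  have e₁₃ : pumpHookAt lam 2 2 4 = 3 := rfl
  have e₁₄ : pumpHookAt lam 2 2 10 = b + c + 8 := by
    rw [← hb, ← hc, add_comm, ← add_assoc]; rfl
  rw [e₀, e₁, e₂, e₃, e₄, e₅, e₆, e₇, e₈, e₉, e₁₀, e₁₁, e₁₂, e₁₃, e₁₄,
    Finset.prod_congr (s₁ := Finset.Icc 1 (lam.strict 0)) (M := M)
      (f := fun d => f (pumpHookAt lam 0 d (12 + d))) rfl fun d hd => by
      rw [pumpHookAt_top lam (Finset.mem_Icc.1 hd).1],
    Finset.prod_congr (s₁ := Finset.Icc 1 (lam.strict 0)) (M := M)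
      (f := fun d => f (pumpHookAt lam 0 d (10 - d))) rfl fun d hd => by
      rw [pumpHookAt_row_zero lam (Finset.mem_Icc.1 hd).1],
    Finset.prod_congr (s₁ := Finset.Icc 1 (lam.strict 1)) rfl fun d hd => by
      rw [pumpHookAt_row_one lam (Finset.mem_Icc.1 hd).1],
    Finset.prod_congr (s₁ := Finset.Icc 1 (lam.strict 2)) rfl fun d hd => by
      rw [pumpHookAt_row_two lam (Finset.mem_Icc.1 hd).1]] at h
  change ∏ x : Pump lam, f (pumpHook x) = _ at h
  rw [h]
  generalize ∏ d ∈ Finset.Icc 1 (lam.strict 0), f (cellHook lam 0 d) = r₀ at *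
  generalize ∏ d ∈ Finset.Icc 1 (lam.strict 1), f (cellHook lam 1 (d + 1)) = r₁ at *
  generalize ∏ d ∈ Finset.Icc 1 (lam.strict 2), f (cellHook lam 2 (d + 2)) = r₂ at *
  generalize ∏ d ∈ Finset.Icc 1 (lam.strict 0),
      f (15 + 2 * lam.strict 0 + lam.strict 1 + lam.strict 2 - cellHook lam 0 d) = r₃ at *
  rw [ha] at h₃
  rw [ha, hb, hc] at h₀
  rw [hb, hc] at h₁ h₃
  rw [hc] at h₂
  calc _ = r₃ * (f (15 + L + b) * f (15 + L + c)) * f (15 + L + a) *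
        (r₀ * (f (a - b) * f (a - c)) * f a) * (r₁ * f (b - c) * f b) * (r₂ * f c) *
        (f 1 * f 3 * f (c + 5) * f (b + 6) * f (a + c + 7) * f (a + b + 8) *
        (f 2 * f (c + 6) * f (a + b + 7)) *
        (f 2 * f 4 * f (b + c + 7) * f (a + c + 8) * f 3 * f (b + c + 8))) := by ring
    _ = _ := by rw [h₀, h₁, h₂, h₃]; ring

/-- `prod_pump` with constant factors counts the whole pump, from which the l₀ elements of the upper
chain are removed. -/
theorem card_pump : Fintype.card (AttachedPoset 0 (pumpData lam)) =
    15 + (lam.strict 0 + lam.strict 1 + lam.strict 2) := by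
  have h := prod_pump (lam := lam) (M := Multiplicative ℕ) fun _ _ _ => Multiplicative.ofAdd 1
  have h' : ∏ x : Pump lam, Multiplicative.ofAdd 1 =
      Multiplicative.ofAdd (Fintype.card (Pump lam)) := by
    rw [Finset.prod_const, Finset.card_univ, ← ofAdd_nsmul, smul_eq_mul, mul_one]
  rw [h'] at h
  simp only [Finset.prod_const, ← ofAdd_add, ← ofAdd_nsmul, Nat.card_Icc, smul_eq_mul] at h
  have h₁ := Multiplicative.ofAdd.injective h
  have h₂ : ∀ m, Fintype.card (AttachedPoset m (pumpData lam)) =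
      Fintype.card (AttachedPoset 0 (pumpData lam)) + m := by
    intro m
    induction m with
    | zero => rfl
    | succ m ih => rw [AttachedPoset.card_succ, ih]; rfl
  have h₃ : lam.1.rowLen 0 + 3 = lam.strict 0 := rfl
  rw [h₂, h₃] at h₁
  omega

/-- Clears denominators after every factor 1 - q ^ e has been written as the inverse of a geometric
series. Here g stands for 1 / (1 - q), and n is a power of q. -/
theorem mul_eq_of_eq_mul_div {K : Type*} [Field K] {n g g' P A B D G : K} (hn : n ≠ 0) (hg : g ≠ 0)
    (hA : A * B ≠ 0) (h : n * G = g ^ 7 * g' * P * (n * (g ^ 6)⁻¹ * A⁻¹ * B⁻¹ / D⁻¹)) :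
    G * (A * B) = g * g' * P * D := by
  have := left_ne_zero_of_mul hA
  have := right_ne_zero_of_mul hA
  refine mul_left_cancel₀ hn ?_
  rw [← mul_assoc, h, div_inv_eq_mul]
  field_simp

theorem X_ne_zero_fractionRing : algebraMap ℚ⟦X⟧ (FractionRing ℚ⟦X⟧) X ≠ 0 := by
  rw [ne_eq, map_eq_zero_iff _ (IsFractionRing.injective ℚ⟦X⟧ (FractionRing ℚ⟦X⟧))]
  exact X_ne_zero

/-- The hook length formula for the pump. -/
theorem partitionGF_pump : partitionGF (Pump lam) = ∏ x : Pump lam, geom (pumpHook x) := by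
  obtain ⟨h₁, h₂, h₃⟩ := lam.strict_lt
  -- In the fraction field powers of X can be cancelled and the rational functions of the closed
  -- form make sense.
  refine IsFractionRing.injective ℚ⟦X⟧ (FractionRing ℚ⟦X⟧) ?_
  have hX := X_ne_zero_fractionRing
  generalize algebraMap ℚ⟦X⟧ (FractionRing ℚ⟦X⟧) = φ at *
  have hprod := prod_pumpHook lam (fun e => φ (geom e)) rfl rfl rfl rfl
  have hGF := congrArg φ (X_pow_mul_partitionGF_pump lam)
  rw [AttachedPoset.partitionGF_chain, card_pump, map_mul, map_prod, map_prod]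
  have hr : (∏ r ∈ Finset.range 3, ∏ i ∈ Finset.Icc 1 (lam.strict r), geom i) =
      (∏ i ∈ Finset.Ioc 0 (lam.strict 0), geom i) * (∏ i ∈ Finset.Ioc 0 (lam.strict 1), geom i) *
        (∏ i ∈ Finset.Ioc 0 (lam.strict 2), geom i) := by
    rw [Finset.prod_range_succ, Finset.prod_range_succ, Finset.prod_range_one]
    rfl
  rw [hr] at hGF
  simp only [map_mul, map_pow, map_prod] at hGF
  rw [map_alt₄_chainTotal φ hX h₁.le h₂.le] at hGF
  have hf : ∀ e, 1 ≤ e → 1 - φ X ^ e = (φ (geom e))⁻¹ := fun e he => by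
    rw [map_geom φ he, inv_inv]
  have hf₀ : ∀ e, 1 ≤ e → φ (geom e) ≠ 0 := fun e he => by
    rw [map_geom φ he]
    exact inv_ne_zero (one_sub_map_X_pow_ne_zero φ he)
  have hr' : Finset.Icc 1 (lam.1.rowLen 0 + 3) = Finset.Ioc 0 (lam.strict 0) := rfl
  rw [hr']
  have h1 := hf 1 le_rfl
  rw [pow_one] at h1
  generalize lam.strict 0 = a at *
  generalize lam.strict 1 = b at *
  generalize lam.strict 2 = c at *
  rw [h1, hf 3 (by omega), hf 4 (by omega), hf (a - b) (by omega), hf (a - c) (by omega),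
    hf (b - c) (by omega), hf a (by omega), hf b (by omega), hf c (by omega),
    hf (a + 4) (by omega), hf (a + 5) (by omega), hf (a + 6) (by omega),
    hf (b + 4) (by omega), hf (b + 5) (by omega), hf (b + 6) (by omega),
    hf (c + 4) (by omega), hf (c + 5) (by omega), hf (c + 6) (by omega),
    hf (a + b + 7) (by omega), hf (a + b + 8) (by omega),
    hf (a + c + 7) (by omega), hf (a + c + 8) (by omega),
    hf (b + c + 7) (by omega), hf (b + c + 8) (by omega),
    hf (9 + (a + b + c)) (by omega), hf (10 + (a + b + c)) (by omega),
    hf (11 + (a + b + c)) (by omega), hf (15 + (a + b + c) + a) (by omega),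
    hf (15 + (a + b + c) + b) (by omega), hf (15 + (a + b + c) + c) (by omega)] at hGF
  have hg := hf₀ 1 le_rfl
  have hS : φ (geom (a - b)) * φ (geom (a - c)) * φ (geom (b - c)) *
      (φ (geom a) * φ (geom b) * φ (geom c)) * (φ (geom (15 + (a + b + c) + a)) *
      φ (geom (15 + (a + b + c) + b)) * φ (geom (15 + (a + b + c) + c))) ≠ 0 := by
    refine mul_ne_zero (mul_ne_zero (mul_ne_zero (mul_ne_zero ?_ ?_) ?_)
      (mul_ne_zero (mul_ne_zero ?_ ?_) ?_)) (mul_ne_zero (mul_ne_zero ?_ ?_) ?_) <;>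
    exact hf₀ _ (by omega)
  -- The product in `hS` is the extra factor on the left of `prod_pumpHook`. Multiplied by it, both
  -- sides turn into the same product.
  refine mul_right_cancel₀ hS (Eq.trans ?_ hprod.symm)
  simp only [← mul_inv, inv_pow] at hGF
  have hGF' := mul_eq_of_eq_mul_div (pow_ne_zero _ hX) hg hS hGF
  rw [mul_assoc, hGF']
  ring

end PumpFormula

theorem mainTheorem10 (lam : Par 3) : HasHookLengthProperty (Pump lam) :=
  ⟨pump_spiderHeap.isDComplete, pumpHook,
    pump_spiderHeap.isHookLength (fun _ _ _ _ => pumpHook_add) pumpHook_eq_card,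
    partitionGF_pump lam⟩
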